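/- **Setting.** For $\theta\in\mathbb R^{p^2}$ (entries $\theta_{s,t}$, $1\le s,t\le p$) the Ising model on $\{-1,1\}^p$ is $p(x\mid\theta)=Z(\theta)^{-1}\exp\langle\theta,T(x)\rangle$ with $T(x)=(x_sx_t)_{s,t=1}^p$. Let $\theta_1^*,\theta_2^*\in\mathbb R^{p^2}$ and $\delta\theta^*=\theta_1^*-\theta_2^*$. Let $x^1_1,\dots,x^1_{n_1}$ be i.i.d. from $p(\cdot\mid\theta_1^*)$ and $x^2_1,\dots,x^2_{n_2}$ i.i.d. from $p(\cdot\mid\theta_2^*)$, $n_1,n_2\ge 1$, and $$\mathcal L(\delta)=-\frac1{n_1}\sum_{i=1}^{n_1}\langle T(x_i^1),\delta\rangle+\log\frac1{n_2}\sum_{i=1}^{n_2}e^{\langle T(x_i^2),\delta\rangle},\qquad r(x\mid\delta)=\frac{e^{\langle T(x),\delta\rangle}}{E_{X\sim p(\cdot\mid\theta_2^*)}e^{\langle T(X),\delta\rangle}} .$$ Let $G_1,\dots,G_{N_G}$ be pairwise disjoint sets of entries $(s,t)$, each invariant under $(s,t)\mapsto(t,s)$ (for instance $G_g=V_g\times V_g$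 for disjoint sets $V_g$ of variables), and let $m=\max_g|G_g|$ be the maximum number of entries in a group. Let $\mathcal V\subset\mathbb R^{p^2}$ be the space of symmetric matrices with zero diagonal that vanish at all entries lying in no group, on which $R(\delta)=\sum_{g=1}^{N_G}\|\delta_{G_g}\|_F$ is the group-sparse norm. Assume that $\delta\theta^*\in\mathcal V$ vanishes on every group outside a set of $s_G$ groups. For $\lambda\ge0$ let $\delta\hat\theta$ denote any minimizer of $\mathcal L+\lambda R$ over $\mathcal V$, and $\Delta=\delta\hat\theta-\delta\theta^*$. For $\beta>1$ put $$E_r=\{u\in\mathcal V: R(\delta\theta^*+u)\le R(\delta\theta^*)+\tfrac1\beta R(u)\},\quad C_r=\{tu:t\ge0,\ u\in E_r\},\quad \Psi(C_r)=\sup_{0\ne u\in C_r}\frac{R(u)}{\|u\|_2}$$ (with $\Psi(C_r)=0$ if $C_r=\{0\}$). **Assumptions**, for given constants $\beta>1$ and $K,\rho,\eta_0>0$, all expectations being over $X\sim p(\cdot\mid\theta_2^*)$: 1. (smooth density ratio) $E\exp\{t\,(r(X\mid\delta\theta^*+u)-1)\}\le e^{t^2}$ for all $t\in\mathbb R$ and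 all $u\in\mathcal V$ with $\|u\|_2\le\|\delta\theta^*\|_2$; 2. (sub-Gaussian design) $\big(E|\langle u,T(X)\rangle-E\langle u,T(X)\rangle|^q\big)^{1/q}\le K\sqrt q\,\|u\|_2$ for all real $q\ge1$ and all $u\in\mathcal V$; 3. (nondegeneracy) $E\big[(\langle u,T(X)\rangle-a)^2\,\mathbb I(r(X\mid\delta\theta^*)>\eta_0)\big]\ge\rho\|u\|_2^2$ for all $u\in C_r$ and $a\in\mathbb R$. **Claim.** There are positive constants $c,\eta,c_3,C,C_0,c_0$ depending only on $\beta,K,\rho,\eta_0$ (and not on $p$, the groups, $s_G$, $n_1,n_2,\theta_1^*,\theta_2^*$) such that the following holds. If $\beta\ge2$, then $\Psi(C_r)\le4\sqrt{s_G}$. If $n_2\ge c\,(m s_G+s_G\log N_G)$, then for every $\varepsilon\ge0$, with $\lambda_0=\eta(1+\varepsilon)\sqrt{\frac{m+\log N_G}{\min(n_1,n_2)}}$, with probability at least $1-C_0\big(e^{-\varepsilon^2}+e^{-c_0n_2}\big)$: for all $\lambda\ge\lambda_0$ and all minimizers, $$\|\Delta\|_2\le c_3\,\Psi(C_r)\,\lambda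 ,$$ and, for $\lambda=\lambda_0$, $$\|\Delta\|_2\le C(1+\varepsilon)\sqrt{\frac{s_G\,m+s_G\log N_G}{\min(n_1,n_2)}} .$$ -/

import Mathlib

open scoped RealInnerProductSpace BigOperators

noncomputable section

namespace DirectChange

open MeasureTheory

/-- Spin configurations `x ∈ {-1, 1}^p`. -/
abbrev Config (p : ℕ) : Type := Fin p → ℤˣ

instance instMeasurableSingletonClassIntUnits : MeasurableSingletonClass ℤˣ where
  measurableSet_singleton a := by
    refine ⟨{(a : ℤ)}, MeasurableSet.singleton _, ?_⟩
    ext b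
    simp [Units.ext_iff]

/-- Parameters `θ = (θ_{s,t}) ∈ ℝ^{p²}` with the Euclidean (Frobenius) norm. -/
abbrev Param (p : ℕ) : Type := EuclideanSpace ℝ (Fin p × Fin p)

/-- The sufficient statistic `T(x) = (x_s x_t)_{s,t}`. -/
def suffStat {p : ℕ} (x : Config p) : Param p :=
  WithLp.toLp 2 fun e => (((x e.1 : ℤˣ) : ℤ) : ℝ) * (((x e.2 : ℤˣ) : ℤ) : ℝ)

/-- The partition function `Z(θ) = ∑ₓ exp ⟨θ, T(x)⟩`. -/
def partitionFn {p : ℕ} (θ : Param p) : ℝ :=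
  ∑ x : Config p, Real.exp ⟪θ, suffStat x⟫

/-- The Ising probability mass function `p(x | θ) = exp ⟨θ, T(x)⟩ / Z(θ)`. -/
def isingProb {p : ℕ} (θ : Param p) (x : Config p) : ℝ :=
  Real.exp ⟪θ, suffStat x⟫ / partitionFn θ

/-- The Ising distribution as a measure on the finite configuration space. -/
def isingMeasure {p : ℕ} (θ : Param p) : Measure (Config p) :=
  ∑ x : Config p, ENNReal.ofReal (isingProb θ x) • Measure.dirac x

/-- The expectation `E_{X ∼ p(·|θ)} [f(X)]` (a finite sum). -/
def isingExp {p : ℕ} (θ : Param p) (f : Config p → ℝ) : ℝ :=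
  ∑ x : Config p, isingProb θ x * f x

/-- The density ratio `r(x | δ) = exp ⟨T(x), δ⟩ / Z(δ)` with
`Z(δ) = E_{X ∼ p(·|θ₂)} [exp ⟨T(X), δ⟩]`. -/
def densityRatio {p : ℕ} (θ₂ δ : Param p) (x : Config p) : ℝ :=
  Real.exp ⟪suffStat x, δ⟫ / isingExp θ₂ (fun y => Real.exp ⟪suffStat y, δ⟫)

/-- The empirical loss
`L(δ) = -(1/n₁) ∑ᵢ ⟨T(xᵢ¹), δ⟩ + log ((1/n₂) ∑ᵢ exp ⟨T(xᵢ²), δ⟩)`. -/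
def loss {p n₁ n₂ : ℕ} (x₁ : Fin n₁ → Config p) (x₂ : Fin n₂ → Config p) (δ : Param p) : ℝ :=
  -(1 / (n₁ : ℝ)) * ∑ i, ⟪suffStat (x₁ i), δ⟫
    + Real.log ((1 / (n₂ : ℝ)) * ∑ i, Real.exp ⟪suffStat (x₂ i), δ⟫)

/-- A system of `N` groups of entries `(s,t)` of a symmetric `p × p` matrix: the groups are pairwise
disjoint and invariant under `(s,t) ↦ (t,s)`. For pairwise disjoint sets of variables `V₁, …, V_N`,
the blocks `V_g × V_g` are such a system. -/
structure IsGroupSystem {p N : ℕ} (G : Fin N → Finset (Fin p × Fin p)) : Prop where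
  disjoint : ∀ g h, g ≠ h → Disjoint (G g) (G h)
  swap_mem : ∀ g s t, (s, t) ∈ G g → (t, s) ∈ G g

/-- The maximum size `m` of a group (its number of entries). -/
def maxGroupSize {p N : ℕ} (G : Fin N → Finset (Fin p × Fin p)) : ℕ :=
  Finset.univ.sup fun g => (G g).card

/-- The parameter space of the change: symmetric, zero diagonal (the edges of the graph are
unordered pairs of distinct vertices), and zero at the entries that lie in no group. -/
def admissible {p N : ℕ} (G : Fin N → Finset (Fin p × Fin p)) : Set (Param p) :=
  {δ | (∀ s t, δ (s, t) = δ (t, s)) ∧ (∀ s, δ (s, s) = 0) ∧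
    ∀ s t, (∀ g, (s, t) ∉ G g) → δ (s, t) = 0}

/-- The group-sparse norm `R(δ) = ∑_g ‖δ_{G_g}‖_F`. -/
def groupNorm {p N : ℕ} (G : Fin N → Finset (Fin p × Fin p)) (δ : Param p) : ℝ :=
  ∑ g, Real.sqrt (∑ e ∈ G g, δ e ^ 2)

/-- `δhat` minimizes `L + lam R` over the parameter space. -/
def IsEstimator {p N n₁ n₂ : ℕ} (G : Fin N → Finset (Fin p × Fin p))
    (x₁ : Fin n₁ → Config p) (x₂ : Fin n₂ → Config p) (lam : ℝ) (δhat : Param p) : Prop :=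
  δhat ∈ admissible G ∧
    IsMinOn (fun δ => loss x₁ x₂ δ + lam * groupNorm G δ) (admissible G) δhat

/-- The error set `E_r = {Δ | R(δ* + Δ) ≤ R(δ*) + R(Δ)/β}`. -/
def errorSet {p N : ℕ} (G : Fin N → Finset (Fin p × Fin p)) (δstar : Param p) (β : ℝ) :
    Set (Param p) :=
  {Δ | Δ ∈ admissible G ∧
    groupNorm G (δstar + Δ) ≤ groupNorm G δstar + 1 / β * groupNorm G Δ}

/-- The cone `C_r = {t Δ | t ≥ 0, Δ ∈ E_r}`. -/
def errorCone {p N : ℕ} (G : Fin N → Finset (Fin p × Fin p)) (δstar : Param p) (β : ℝ) :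
    Set (Param p) :=
  {u | ∃ t : ℝ, 0 ≤ t ∧ ∃ Δ ∈ errorSet G δstar β, u = t • Δ}

/-- The norm compatibility constant `Ψ(C) = sup_{u ∈ C, u ≠ 0} R(u) / ‖u‖₂`. -/
def compatConst {p N : ℕ} (G : Fin N → Finset (Fin p × Fin p)) (C : Set (Param p)) : ℝ :=
  sSup {a | ∃ u ∈ C, u ≠ 0 ∧ a = groupNorm G u / ‖u‖}

/-- Smooth density ratio assumption: for every `u` in the parameter space with `‖u‖ ≤ ‖δ*‖` and
every real `t`, `E_{θ₂} [exp (t (r(X | δ* + u) - 1))] ≤ exp (t²)`. -/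
def SmoothDensityRatio {p N : ℕ} (G : Fin N → Finset (Fin p × Fin p)) (θ₂ δstar : Param p) :
    Prop :=
  ∀ u ∈ admissible G, ‖u‖ ≤ ‖δstar‖ → ∀ t : ℝ,
    isingExp θ₂ (fun x => Real.exp (t * (densityRatio θ₂ (δstar + u) x - 1))) ≤ Real.exp (t ^ 2)

/-- The centred statistic `T(X) - E T(X)`, `X ∼ p(·|θ₂)`, is sub-Gaussian on the parameter space
with sub-Gaussian norm at most `K`: for all directions `u` and all real `q ≥ 1`,
`(E |⟨u, T(X)⟩ - E ⟨u, T(X)⟩|^q)^{1/q} ≤ K √q ‖u‖`. -/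
def SubGaussianStat {p N : ℕ} (G : Fin N → Finset (Fin p × Fin p)) (θ₂ : Param p) (K : ℝ) : Prop :=
  ∀ u ∈ admissible G, ∀ q : ℝ, 1 ≤ q →
    (isingExp θ₂ (fun x =>
      |⟪u, suffStat x⟫ - isingExp θ₂ (fun y => ⟪u, suffStat y⟫)| ^ q)) ^ (1 / q)
      ≤ K * Real.sqrt q * ‖u‖

open Classical in
/-- Nondegeneracy on the cone: `E_{θ₂} [(⟨u, T(X)⟩ - a)² 1{r(X | δ*) > η₀}] ≥ ρ ‖u‖²` for all
`u ∈ C_r` and all centrings `a`. -/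
def NondegenerateStat {p N : ℕ} (G : Fin N → Finset (Fin p × Fin p)) (θ₂ δstar : Param p)
    (β η₀ ρ : ℝ) : Prop :=
  ∀ u ∈ errorCone G δstar β, ∀ a : ℝ,
    ρ * ‖u‖ ^ 2 ≤ isingExp θ₂ (fun x =>
      if η₀ < densityRatio θ₂ δstar x then (⟪u, suffStat x⟫ - a) ^ 2 else 0)

/-- The reference level `(1 + ε) √((m + log N) / min(n₁, n₂))`. -/
def refLevel {p N : ℕ} (G : Fin N → Finset (Fin p × Fin p)) (n₁ n₂ : ℕ) (ε : ℝ) : ℝ :=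
  (1 + ε) * Real.sqrt (((maxGroupSize G : ℝ) + Real.log N) / (min n₁ n₂ : ℕ))

end DirectChange

end

open MeasureTheory ProbabilityTheory DirectChange

open MeasureTheory ProbabilityTheory DirectChange

namespace DirectChange

/-! ### Exponential moments under finite weights. -/

section FiniteProbability

variable {α : Type*} [Fintype α] {w : α → ℝ}

/-! The loss is a linear term plus a log-sum-exp, so its expansion at `δ*` is exact (`loss_add`):
`L(δ* + u) = L(δ*) - score u + divergence u`. Here `divergence u` is the log of a weighted mean of
`exp` of the centred values of `⟨u, T⟩`, the weights on the second sample being proportional to `r(x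
| δ*)`. It is nonnegative by Jensen. If `score u ≤ (λ/β) R(u)` for all admissible `u`, optimality
bounds `divergence Δ` by `λ (R(δ*) + R(Δ)/β - R(δ* + Δ))`. This forces `Δ ∈ E_r`, and a lower bound
on the divergence over the cone then controls `‖Δ‖`.

Score (`exists_score_bound`). The unit ball of `R` lies in twice the convex hull of at most `N 5^m`
admissible vectors of norm at most one (`exists_admissible_net`). The score is linear, so only these
vectors need a tail bound. The first-sample term is sub-Gaussian under `θ₁` by change of measure,
since `E r² ≤ 12`. The second-sample term `r · (⟨a, T⟩ - E_{θ₁}⟨a, T⟩)` has mean zero under `θ₂`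
and, as a product of two sub-Gaussian factors, is sub-exponential.

Curvature (`exists_restricted_lower_bound`). Nondegeneracy together with fourth moments bounds below
the mean of a truncated positive part of the centred `⟨u, T⟩` on `{r > η₀}`. The bound passes to the
sample uniformly over the cone by Maurey's method: a unit vector of the cone is, up to a small error
in both empirical and population mean square, a scaled average of order `s_G` net points, and such
averages are few enough for a union bound when `n₂` exceeds a multiple of `s_G (m + log N)`.

Conclusion (`norm_sub_le_of_isEstimator`). The truncated bound makes the divergence grow
quadratically up to a fixed radius and linearly beyond it. In the linear regime the upper bound `2 λ
R(δ*)` on the divergence is used, and `‖δ*‖` is bounded by a constant (`norm_le_of_nondegenerate`).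
Hence no upper restriction on `λ` is needed. -/

lemma sum_exp_sq_le_two {Y : α → ℝ} {B : ℝ} (hB : 0 < B)
    (h : ∀ k : ℕ, ∑ x, w x * Y x ^ (2 * k) ≤ B ^ k * k.factorial) :
    ∑ x, w x * Real.exp (1 / (2 * B) * Y x ^ 2) ≤ 2 := by
  have h1 : ∀ x, HasSum (fun k : ℕ => w x * ((1 / (2 * B) * Y x ^ 2) ^ k / k.factorial))
      (w x * Real.exp (1 / (2 * B) * Y x ^ 2)) := by
    intro x
    have := NormedSpace.expSeries_div_hasSum_exp (1 / (2 * B) * Y x ^ 2)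
    rw [← Real.exp_eq_exp_ℝ] at this
    exact this.mul_left _
  have h2 := hasSum_sum (s := Finset.univ) fun x _ => h1 x
  refine hasSum_le (fun k => ?_) h2 hasSum_geometric_two
  have hk : (0 : ℝ) < k.factorial := by exact_mod_cast k.factorial_pos
  calc ∑ x, w x * ((1 / (2 * B) * Y x ^ 2) ^ k / k.factorial)
      = (1 / (2 * B)) ^ k / k.factorial * ∑ x, w x * Y x ^ (2 * k) := by
        rw [Finset.mul_sum]
        refine Finset.sum_congr rfl fun x _ => ?_
        rw [mul_pow, ← pow_mul]; ring
    _ ≤ (1 / (2 * B)) ^ k / k.factorial * (B ^ k * k.factorial) := by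
        gcongr; exact h k
    _ = (1 / 2) ^ k := by
        rw [div_mul_eq_mul_div, mul_comm (B ^ k), ← mul_assoc, mul_right_comm,
          mul_div_assoc, div_self hk.ne', mul_one, ← mul_pow]
        congr 1; field_simp

lemma exp_mul_le_one_add {s : ℝ} (hs0 : 0 ≤ s) (hs1 : s ≤ 1) (x : ℝ) :
    Real.exp (s * x) ≤ 1 - s + s * Real.exp x := by
  have := convexOn_exp.2 (Set.mem_univ (0 : ℝ)) (Set.mem_univ x) (sub_nonneg.2 hs1) hs0 (by ring)
  simpa using this

lemma sum_exp_mul_le (hw : ∀ x, 0 ≤ w x) (hw1 : ∑ x, w x = 1) {F : α → ℝ} {b s : ℝ}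
    (hF : ∑ x, w x * Real.exp (F x) ≤ b) (hs0 : 0 ≤ s) (hs1 : s ≤ 1) :
    ∑ x, w x * Real.exp (s * F x) ≤ 1 + s * (b - 1) := by
  calc ∑ x, w x * Real.exp (s * F x) ≤ ∑ x, w x * (1 - s + s * Real.exp (F x)) :=
        Finset.sum_le_sum fun x _ =>
          mul_le_mul_of_nonneg_left (exp_mul_le_one_add hs0 hs1 _) (hw x)
    _ = (1 - s) * ∑ x, w x + s * ∑ x, w x * Real.exp (F x) := by
        rw [Finset.mul_sum, Finset.mul_sum, ← Finset.sum_add_distrib]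
        exact Finset.sum_congr rfl fun x _ => by ring
    _ ≤ 1 + s * (b - 1) := by
        rw [hw1]; nlinarith [mul_le_mul_of_nonneg_left hF hs0]

lemma exp_le_add_exp_sq (x : ℝ) : Real.exp x ≤ x + Real.exp (x ^ 2) := by
  have key : ∀ y : ℝ, 0 ≤ y → y ≤ 1 → Real.exp y ≤ 1 + y + y ^ 2 := fun y h0 h1 => by
    have := Real.abs_exp_sub_one_sub_id_le (x := y) (by rw [abs_le]; constructor <;> linarith)
    linarith [le_abs_self (Real.exp y - 1 - y)]
  rcases le_or_gt |x| 1 with h | h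
  · have := Real.abs_exp_sub_one_sub_id_le h
    linarith [le_abs_self (Real.exp x - 1 - x), Real.add_one_le_exp (x ^ 2)]
  · rcases le_or_gt 0 x with h0 | h0
    · rw [abs_of_nonneg h0] at h
      have : Real.exp x ≤ Real.exp (x ^ 2) := Real.exp_le_exp.2 (by nlinarith)
      linarith
    · rw [abs_of_neg h0] at h
      have h1 : Real.exp x ≤ 1 := Real.exp_le_one_iff.2 h0.le
      nlinarith [Real.add_one_le_exp (x ^ 2)]

/-- For `t² ≤ θ` the inequality `e^x ≤ x + e^{x²}` removes the linear term by centring, and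
convexity of `exp` lowers the exponent from `θ` to `t²`. For larger `t`, Young's inequality `tY ≤
t²/(2θ) + θY²/2` suffices, because the constant it leaves is absorbed by `t²/θ ≥ 1`. -/
lemma sum_exp_le_of_sq (hw : ∀ x, 0 ≤ w x) (hw1 : ∑ x, w x = 1) {Y : α → ℝ} {θ : ℝ}
    (hθ : 0 < θ) (h0 : ∑ x, w x * Y x = 0)
    (h : ∑ x, w x * Real.exp (θ * Y x ^ 2) ≤ 2) (t : ℝ) :
    ∑ x, w x * Real.exp (t * Y x) ≤ Real.exp (1 / θ * t ^ 2) := by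
  have hst : 1 / θ * t ^ 2 = t ^ 2 / θ := by ring
  rw [hst]
  rcases le_or_gt (t ^ 2) θ with ht | ht
  · have hs := sum_exp_mul_le hw hw1 h (s := t ^ 2 / θ) (by positivity) ((div_le_one hθ).2 ht)
    calc ∑ x, w x * Real.exp (t * Y x)
        ≤ ∑ x, w x * (t * Y x + Real.exp (t ^ 2 / θ * (θ * Y x ^ 2))) := by
          refine Finset.sum_le_sum fun x _ => mul_le_mul_of_nonneg_left ?_ (hw x)
          have : t ^ 2 / θ * (θ * Y x ^ 2) = (t * Y x) ^ 2 := by field_simp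
          rw [this]; exact exp_le_add_exp_sq _
      _ = t * ∑ x, w x * Y x + ∑ x, w x * Real.exp (t ^ 2 / θ * (θ * Y x ^ 2)) := by
          rw [Finset.mul_sum, ← Finset.sum_add_distrib]
          exact Finset.sum_congr rfl fun x _ => by ring
      _ ≤ Real.exp (t ^ 2 / θ) := by
          rw [h0]; linarith [Real.add_one_le_exp (t ^ 2 / θ)]
  · have hs := sum_exp_mul_le hw hw1 h (s := 1 / 2) (by norm_num) (by norm_num)
    calc ∑ x, w x * Real.exp (t * Y x)
        ≤ ∑ x, Real.exp (t ^ 2 / θ / 2) * (w x * Real.exp (1 / 2 * (θ * Y x ^ 2))) := by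
          refine Finset.sum_le_sum fun x _ => ?_
          rw [mul_left_comm, ← Real.exp_add]
          refine mul_le_mul_of_nonneg_left (Real.exp_le_exp.2 ?_) (hw x)
          have : 0 ≤ (t - θ * Y x) ^ 2 / (2 * θ) := by positivity
          have e : (t - θ * Y x) ^ 2 / (2 * θ)
            = t ^ 2 / θ / 2 + 1 / 2 * (θ * Y x ^ 2) - t * Y x := by field_simp; ring
          linarith
      _ ≤ Real.exp (t ^ 2 / θ / 2) * Real.exp (t ^ 2 / θ / 2) := by
          rw [← Finset.mul_sum]
          refine mul_le_mul_of_nonneg_left ?_ (Real.exp_pos _).le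
          have h1 : 1 ≤ t ^ 2 / θ := (one_le_div hθ).2 ht.le
          linarith [Real.add_one_le_exp (t ^ 2 / θ / 2)]
      _ = Real.exp (t ^ 2 / θ) := by rw [← Real.exp_add]; congr 1; ring

/-- Compare Taylor series term by term: `s^k ≤ s²` from the second order on. -/
lemma exp_mul_sub_le {s : ℝ} (hs0 : 0 ≤ s) (hs1 : s ≤ 1) (x : ℝ) :
    Real.exp (s * x) ≤ 1 + s * x + s ^ 2 * Real.exp |x| := by
  have hE : ∀ y : ℝ, HasSum (fun k : ℕ => y ^ k / k.factorial) (Real.exp y) := fun y => by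
    have := NormedSpace.expSeries_div_hasSum_exp y
    rwa [← Real.exp_eq_exp_ℝ] at this
  have h1 := (hE (s * x)).sub (hasSum_sum_of_ne_finset_zero (f := fun k : ℕ =>
    if k < 2 then (s * x) ^ k / k.factorial else 0) (s := Finset.range 2) (by
      intro b hb; simp only [Finset.mem_range] at hb; simp [hb]))
  have h2 := (hE |x|).mul_left (s ^ 2)
  have h3 := hasSum_le (fun k => ?_) h1 h2
  · simp [Finset.sum_range_succ] at h3
    linarith
  · have hk : (0 : ℝ) < k.factorial := by exact_mod_cast k.factorial_pos
    by_cases hk2 : k < 2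
    · simp only [hk2, if_true, sub_self]; positivity
    · simp only [hk2, if_false, sub_zero]
      rw [← mul_div_assoc, mul_pow]
      gcongr ?_ / _
      calc s ^ k * x ^ k ≤ s ^ k * |x| ^ k := by
            rw [← abs_pow]; gcongr; exact le_abs_self _
        _ ≤ s ^ 2 * |x| ^ k := by
            refine mul_le_mul_of_nonneg_right ?_ (by positivity)
            exact pow_le_pow_of_le_one hs0 hs1 (not_lt.1 hk2)

/-- Bernstein's regime: a single finite exponential moment of `|W|` already gives a quadratic
log-mgf on `[0, t₀]`. -/
lemma sum_exp_le_of_abs (hw : ∀ x, 0 ≤ w x) (hw1 : ∑ x, w x = 1) {W : α → ℝ} {t₀ B : ℝ}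
    (ht₀ : 0 < t₀) (h0 : ∑ x, w x * W x = 0)
    (h : ∑ x, w x * Real.exp (t₀ * |W x|) ≤ B) {t : ℝ} (ht : 0 ≤ t) (htt : t ≤ t₀) :
    ∑ x, w x * Real.exp (t * W x) ≤ Real.exp (B / t₀ ^ 2 * t ^ 2) := by
  calc ∑ x, w x * Real.exp (t * W x)
      ≤ ∑ x, w x * (1 + t * W x + (t / t₀) ^ 2 * Real.exp (t₀ * |W x|)) := by
        refine Finset.sum_le_sum fun x _ => mul_le_mul_of_nonneg_left ?_ (hw x)
        have := exp_mul_sub_le (s := t / t₀) (by positivity) ((div_le_one ht₀).2 htt) (t₀ * W x)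
        have e : t / t₀ * (t₀ * W x) = t * W x := by field_simp
        rwa [e, abs_mul, abs_of_pos ht₀] at this
    _ = ∑ x, w x + t * ∑ x, w x * W x + (t / t₀) ^ 2 * ∑ x, w x * Real.exp (t₀ * |W x|) := by
        rw [Finset.mul_sum, Finset.mul_sum, ← Finset.sum_add_distrib, ← Finset.sum_add_distrib]
        exact Finset.sum_congr rfl fun x _ => by ring
    _ ≤ 1 + (t / t₀) ^ 2 * B := by
        rw [hw1, h0]; nlinarith [mul_le_mul_of_nonneg_left h (sq_nonneg (t / t₀))]
    _ ≤ Real.exp (B / t₀ ^ 2 * t ^ 2) := by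
        have e : B / t₀ ^ 2 * t ^ 2 = (t / t₀) ^ 2 * B := by ring
        rw [e]; linarith [Real.add_one_le_exp ((t / t₀) ^ 2 * B)]

lemma exp_neg_le_quadratic {x : ℝ} (hx : 0 ≤ x) : Real.exp (-x) ≤ 1 - x + x ^ 2 / 2 := by
  rw [Real.exp_neg]
  have h := Real.quadratic_le_exp_of_nonneg hx
  have h1 : 0 < 1 + x + x ^ 2 / 2 := by positivity
  calc (Real.exp x)⁻¹ ≤ (1 + x + x ^ 2 / 2)⁻¹ := inv_anti₀ h1 h
    _ ≤ 1 - x + x ^ 2 / 2 := by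
      rw [inv_le_iff_one_le_mul₀ h1]
      nlinarith [sq_nonneg (x ^ 2)]

lemma sum_exp_neg_le (hw : ∀ x, 0 ≤ w x) (hw1 : ∑ x, w x = 1) {f : α → ℝ} {M : ℝ}
    (hf0 : ∀ x, 0 ≤ f x) (hfM : ∀ x, f x ≤ M) {t : ℝ} (ht : 0 ≤ t) :
    ∑ x, w x * Real.exp (t * ((∑ y, w y * f y) - f x)) ≤ Real.exp (M ^ 2 / 2 * t ^ 2) := by
  obtain ⟨m, hm⟩ : ∃ m, ∑ y, w y * f y = m := ⟨_, rfl⟩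
  rw [hm]
  calc ∑ x, w x * Real.exp (t * (m - f x))
      ≤ ∑ x, Real.exp (t * m) * (w x * (1 - t * f x + t ^ 2 * M ^ 2 / 2)) := by
        refine Finset.sum_le_sum fun x _ => ?_
        rw [mul_left_comm, show t * (m - f x) = t * m + -(t * f x) by ring, Real.exp_add]
        refine mul_le_mul_of_nonneg_left (mul_le_mul_of_nonneg_left ?_ (Real.exp_pos _).le) (hw x)
        refine (exp_neg_le_quadratic (mul_nonneg ht (hf0 x))).trans ?_
        have : (t * f x) ^ 2 ≤ t ^ 2 * M ^ 2 := by
          rw [mul_pow]; gcongr; exacts [hf0 x, hfM x]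
        linarith
    _ = Real.exp (t * m) * (∑ x, w x - t * m + t ^ 2 * M ^ 2 / 2 * ∑ x, w x) := by
        rw [← Finset.mul_sum]
        congr 1
        rw [← hm, Finset.mul_sum, Finset.mul_sum, ← Finset.sum_sub_distrib,
          ← Finset.sum_add_distrib]
        exact Finset.sum_congr rfl fun x _ => by ring
    _ ≤ Real.exp (t * m) * Real.exp (-(t * m) + M ^ 2 / 2 * t ^ 2) := by
        refine mul_le_mul_of_nonneg_left ?_ (Real.exp_pos _).le
        rw [hw1]; linarith [Real.add_one_le_exp (-(t * m) + M ^ 2 / 2 * t ^ 2)]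
    _ = _ := by rw [← Real.exp_add]; congr 1; ring

lemma sum_sq_le_of_exp_sq (hw : ∀ x, 0 ≤ w x) (hw1 : ∑ x, w x = 1) {Y : α → ℝ} {θ : ℝ}
    (hθ : 0 < θ) (h : ∑ x, w x * Real.exp (θ * Y x ^ 2) ≤ 2) :
    ∑ x, w x * Y x ^ 2 ≤ 1 / θ := by
  rw [le_div_iff₀ hθ]
  have : ∑ x, w x * (θ * Y x ^ 2 + 1) ≤ 2 :=
    (Finset.sum_le_sum fun x _ => mul_le_mul_of_nonneg_left
      (Real.add_one_le_exp _) (hw x)).trans h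
  have e : ∑ x, w x * (θ * Y x ^ 2 + 1) = (∑ x, w x * Y x ^ 2) * θ + ∑ x, w x := by
    rw [Finset.sum_mul, ← Finset.sum_add_distrib]
    exact Finset.sum_congr rfl fun x _ => by ring
  linarith

lemma sq_sum_le_sum_sq (hw : ∀ x, 0 ≤ w x) (hw1 : ∑ x, w x ≤ 1) (Y : α → ℝ) :
    (∑ x, w x * Y x) ^ 2 ≤ ∑ x, w x * Y x ^ 2 := by
  have h := Finset.sum_sq_le_sum_mul_sum_of_sq_le_mul Finset.univ (r := fun x => w x * Y x)
    (f := w) (g := fun x => w x * Y x ^ 2) (fun x _ => hw x)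
    (fun x _ => mul_nonneg (hw x) (sq_nonneg _)) (fun x _ => le_of_eq (by ring))
  refine h.trans ?_
  have : 0 ≤ ∑ x, w x * Y x ^ 2 := Finset.sum_nonneg fun x _ => mul_nonneg (hw x) (sq_nonneg _)
  nlinarith

/-- Recentring costs a factor `8` in the rate: `(Y - d)² ≤ 2Y² + 2d²` leaves `exp(1/4)` times the
moment at rate `θ/4`, at most `3/2 · 5/4 < 2`. -/
lemma sum_exp_sq_sub_le (hw : ∀ x, 0 ≤ w x) (hw1 : ∑ x, w x = 1) {Y : α → ℝ} {θ d : ℝ}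
    (hθ : 0 < θ) (h : ∑ x, w x * Real.exp (θ * Y x ^ 2) ≤ 2) (hd : d ^ 2 ≤ 1 / θ) :
    ∑ x, w x * Real.exp (θ / 8 * (Y x - d) ^ 2) ≤ 2 := by
  have hs := sum_exp_mul_le hw hw1 h (s := 1 / 4) (by norm_num) (by norm_num)
  have hd' : θ * d ^ 2 ≤ 1 := by rwa [le_div_iff₀ hθ, mul_comm] at hd
  have hexp : Real.exp (1 / 4) ≤ 3 / 2 := by
    have := Real.abs_exp_sub_one_sub_id_le (x := 1 / 4) (by rw [abs_le]; constructor <;> norm_num)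
    have h2 := le_abs_self (Real.exp (1 / 4) - 1 - 1 / 4)
    norm_num at this h2 ⊢
    linarith
  calc ∑ x, w x * Real.exp (θ / 8 * (Y x - d) ^ 2)
      ≤ ∑ x, Real.exp (1 / 4) * (w x * Real.exp (1 / 4 * (θ * Y x ^ 2))) := by
        refine Finset.sum_le_sum fun x _ => ?_
        rw [mul_left_comm, ← Real.exp_add]
        refine mul_le_mul_of_nonneg_left (Real.exp_le_exp.2 ?_) (hw x)
        nlinarith [mul_nonneg hθ.le (sq_nonneg (Y x + d))]
    _ = Real.exp (1 / 4) * ∑ x, w x * Real.exp (1 / 4 * (θ * Y x ^ 2)) := by rw [Finset.mul_sum]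
    _ ≤ 3 / 2 * (1 + 1 / 4 * (2 - 1)) := by
        refine mul_le_mul hexp hs (Finset.sum_nonneg fun x _ => ?_) (by norm_num)
        exact mul_nonneg (hw x) (Real.exp_pos _).le
    _ ≤ 2 := by norm_num

lemma sum_exp_sq_mono (hw : ∀ x, 0 ≤ w x) {Y : α → ℝ} {θ θ' : ℝ} (hθ : θ' ≤ θ)
    (h : ∑ x, w x * Real.exp (θ * Y x ^ 2) ≤ 2) :
    ∑ x, w x * Real.exp (θ' * Y x ^ 2) ≤ 2 :=
  (Finset.sum_le_sum fun x _ => mul_le_mul_of_nonneg_left (Real.exp_le_exp.2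
    (mul_le_mul_of_nonneg_right hθ (sq_nonneg _))) (hw x)).trans h

lemma even_moment_le_of_exp_le (hw : ∀ x, 0 ≤ w x) (hw1 : ∑ x, w x = 1) {Y : α → ℝ}
    (h : ∀ t : ℝ, ∑ x, w x * Real.exp (t * Y x) ≤ Real.exp (t ^ 2)) (k : ℕ) :
    ∑ x, w x * Y x ^ (2 * k) ≤ (4 * Real.exp 1) ^ k * k.factorial := by
  rcases Nat.eq_zero_or_pos k with rfl | hk
  · simp [hw1]
  have hk0 : (0 : ℝ) < k := by exact_mod_cast hk
  -- At `t = √k` the factor `t^(2k)` equals `k^k`, which cancels the growth of `(2k)!/k!`, while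
  -- `exp(t²)` is only `e^k`.
  set t := Real.sqrt k
  have ht2 : t ^ 2 = k := Real.sq_sqrt hk0.le
  have hfac : ((2 * k).factorial : ℝ) ≤ k.factorial * (2 * k : ℝ) ^ k := by
    have h1 := Nat.factorial_mul_descFactorial (n := 2 * k) (k := k) (by omega)
    have h2 := Nat.descFactorial_le_pow (2 * k) k
    rw [← h1, show 2 * k - k = k by omega]
    exact_mod_cast Nat.mul_le_mul_left _ h2
  have hpt : ∀ x, (k : ℝ) ^ k * Y x ^ (2 * k) ≤
      (2 * k).factorial * (Real.exp (t * Y x) + Real.exp ((-t) * Y x)) := by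
    intro x
    have h1 := Real.pow_div_factorial_le_exp |t * Y x| (abs_nonneg _) (2 * k)
    have hf : (0 : ℝ) < (2 * k).factorial := by exact_mod_cast Nat.factorial_pos _
    rw [div_le_iff₀ hf, pow_mul, sq_abs, mul_pow, ht2, mul_pow, ← pow_mul] at h1
    refine h1.trans ?_
    rw [mul_comm]
    refine mul_le_mul_of_nonneg_left ?_ hf.le
    rcases abs_cases (t * Y x) with ⟨e, _⟩ | ⟨e, _⟩ <;> rw [e]
    · linarith [Real.exp_pos ((-t) * Y x)]
    · rw [show -(t * Y x) = (-t) * Y x by ring]; linarith [Real.exp_pos (t * Y x)]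
  have hkk : (0 : ℝ) < (k : ℝ) ^ k := by positivity
  refine le_of_mul_le_mul_left ?_ hkk
  calc (k : ℝ) ^ k * ∑ x, w x * Y x ^ (2 * k)
      ≤ ∑ x, w x * ((2 * k).factorial * (Real.exp (t * Y x) + Real.exp ((-t) * Y x))) := by
        rw [Finset.mul_sum]
        refine Finset.sum_le_sum fun x _ => ?_
        rw [mul_left_comm]
        exact mul_le_mul_of_nonneg_left (hpt x) (hw x)
    _ = (2 * k).factorial * (∑ x, w x * Real.exp (t * Y x)
          + ∑ x, w x * Real.exp ((-t) * Y x)) := by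
        rw [← Finset.sum_add_distrib, Finset.mul_sum]
        exact Finset.sum_congr rfl fun x _ => by ring
    _ ≤ (k.factorial * (2 * k : ℝ) ^ k) * (Real.exp k + Real.exp k) := by
        have h1 := h t
        have h2 := h (-t)
        rw [neg_sq, ht2] at h2
        rw [ht2] at h1
        refine mul_le_mul hfac (add_le_add h1 h2) ?_ (by positivity)
        rw [← Finset.sum_add_distrib]
        exact Finset.sum_nonneg fun x _ => add_nonneg (mul_nonneg (hw x) (Real.exp_pos _).le)
          (mul_nonneg (hw x) (Real.exp_pos _).le)
    _ = (k : ℝ) ^ k * (2 * (2 * Real.exp 1) ^ k * k.factorial) := by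
        rw [← Real.exp_one_pow k, mul_pow, mul_pow]; ring
    _ ≤ (k : ℝ) ^ k * ((4 * Real.exp 1) ^ k * k.factorial) := by
        have h2 : (2 : ℝ) ≤ 2 ^ k := by
          calc (2 : ℝ) = 2 ^ 1 := by norm_num
            _ ≤ 2 ^ k := pow_le_pow_right₀ (by norm_num) hk
        have e : (4 * Real.exp 1) ^ k = 2 ^ k * (2 * Real.exp 1) ^ k := by
          rw [← mul_pow]; congr 1; ring
        rw [e]; gcongr

lemma even_moment_le_of_pow_le {K : ℝ} {Y : α → ℝ} (hw : ∀ x, 0 ≤ w x)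
    (hw1 : ∑ x, w x = 1)
    (h : ∀ q : ℝ, 1 ≤ q → (∑ x, w x * |Y x| ^ q) ^ (1 / q) ≤ K * Real.sqrt q) (k : ℕ) :
    ∑ x, w x * Y x ^ (2 * k) ≤ (2 * K ^ 2 * k) ^ k := by
  rcases Nat.eq_zero_or_pos k with rfl | hk
  · simp [hw1]
  have hk1 : (1 : ℝ) ≤ k := by exact_mod_cast hk
  have hq := h (2 * k : ℕ) (by push_cast; linarith)
  have e : ∀ x, |Y x| ^ ((2 * k : ℕ) : ℝ) = Y x ^ (2 * k) := fun x => by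
    rw [Real.rpow_natCast, pow_mul, sq_abs, ← pow_mul]
  simp only [e] at hq
  have h0 : 0 ≤ ∑ x, w x * Y x ^ (2 * k) :=
    Finset.sum_nonneg fun x _ => mul_nonneg (hw x) (by rw [pow_mul]; positivity)
  have h1 := pow_le_pow_left₀ (Real.rpow_nonneg h0 _) hq (2 * k)
  rw [← Real.rpow_natCast, ← Real.rpow_mul h0, one_div, inv_mul_cancel₀ (by positivity),
    Real.rpow_one] at h1
  refine h1.trans (le_of_eq ?_)
  rw [pow_mul, mul_pow, Real.sq_sqrt (by positivity)]
  push_cast; ring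

lemma nat_pow_self_le (k : ℕ) : (k : ℝ) ^ k ≤ Real.exp 1 ^ k * k.factorial := by
  have h := Real.pow_div_factorial_le_exp (k : ℝ) (Nat.cast_nonneg k) k
  have hf : (0 : ℝ) < k.factorial := by exact_mod_cast Nat.factorial_pos _
  rwa [div_le_iff₀ hf, ← Real.exp_one_pow] at h

end FiniteProbability

end DirectChange

namespace DirectChange

/-! ### Ising expectations and Chernoff bounds for i.i.d. samples. -/

section Ising

variable {p : ℕ}

lemma partitionFn_pos (θ : Param p) : 0 < partitionFn θ :=
  Finset.sum_pos (fun _ _ => Real.exp_pos _) Finset.univ_nonempty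

lemma isingProb_nonneg (θ : Param p) (x : Config p) : 0 ≤ isingProb θ x :=
  div_nonneg (Real.exp_pos _).le (partitionFn_pos θ).le

lemma sum_isingProb (θ : Param p) : ∑ x, isingProb θ x = 1 := by
  simp only [isingProb]
  rw [← Finset.sum_div]
  exact div_self (partitionFn_pos θ).ne'

lemma integral_isingMeasure (θ : Param p) (f : Config p → ℝ) :
    ∫ x, f x ∂(isingMeasure θ) = isingExp θ f := by
  unfold isingMeasure isingExp
  rw [integral_finsetSum_measure]
  · refine Finset.sum_congr rfl fun x _ => ?_
    rw [integral_smul_measure, integral_dirac, ENNReal.toReal_ofReal (isingProb_nonneg θ x),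
      smul_eq_mul]
  · intro x _
    exact (integrable_dirac (by simp)).smul_measure ENNReal.ofReal_ne_top

lemma isingExp_mono (θ : Param p) {f g : Config p → ℝ} (h : ∀ x, f x ≤ g x) :
    isingExp θ f ≤ isingExp θ g :=
  Finset.sum_le_sum fun x _ => mul_le_mul_of_nonneg_left (h x) (isingProb_nonneg θ x)

lemma isingExp_nonneg (θ : Param p) {f : Config p → ℝ} (h : ∀ x, 0 ≤ f x) :
    0 ≤ isingExp θ f :=
  Finset.sum_nonneg fun x _ => mul_nonneg (isingProb_nonneg θ x) (h x)

lemma isingExp_add (θ : Param p) (f g : Config p → ℝ) :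
    isingExp θ (fun x => f x + g x) = isingExp θ f + isingExp θ g := by
  simp only [isingExp, mul_add, Finset.sum_add_distrib]

lemma isingExp_sub (θ : Param p) (f g : Config p → ℝ) :
    isingExp θ (fun x => f x - g x) = isingExp θ f - isingExp θ g := by
  simp only [isingExp, mul_sub, Finset.sum_sub_distrib]

lemma isingExp_const_mul (θ : Param p) (c : ℝ) (f : Config p → ℝ) :
    isingExp θ (fun x => c * f x) = c * isingExp θ f := by
  simp only [isingExp, Finset.mul_sum]
  exact Finset.sum_congr rfl fun x _ => by ring

lemma isingExp_const (θ : Param p) (c : ℝ) : isingExp θ (fun _ => c) = c := by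
  simp only [isingExp, ← Finset.sum_mul, sum_isingProb, one_mul]

lemma isingExp_exp_pos (θ : Param p) (f : Config p → ℝ) :
    0 < isingExp θ (fun x => Real.exp (f x)) :=
  Finset.sum_pos (fun _ _ => mul_pos (div_pos (Real.exp_pos _) (partitionFn_pos θ))
    (Real.exp_pos _)) Finset.univ_nonempty

variable {Ω : Type*} [MeasurableSpace Ω] {P : Measure Ω} [IsProbabilityMeasure P] {n : ℕ}
  {X : Fin n → Ω → Config p} {θ : Param p}

lemma prob_le_sum_le (hX : ∀ i, HasLaw (X i) (isingMeasure θ) P) (hind : iIndepFun X P)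
    (f : Config p → ℝ) {t : ℝ} (ht : 0 ≤ t) (b : ℝ) :
    P.real {ω | n * b ≤ ∑ i, f (X i ω)} ≤
      (Real.exp (-(t * b)) * isingExp θ (fun x => Real.exp (t * f x))) ^ n := by
  have hf : Measurable f := measurable_of_finite f
  have hm : ∀ i, AEMeasurable (fun ω => f (X i ω)) P := fun i =>
    hf.comp_aemeasurable (hX i).aemeasurable
  have hi : iIndepFun (fun i ω => f (X i ω)) P := hind.comp (fun _ => f) fun _ => hf
  have hmgf : ∀ i, mgf (fun ω => f (X i ω)) P t = isingExp θ (fun x => Real.exp (t * f x)) := by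
    intro i
    have := (hX i).integral_comp (f := fun x => Real.exp (t * f x))
      (measurable_of_finite _).aestronglyMeasurable
    rw [integral_isingMeasure] at this
    exact this
  have hsum := hi.mgf_sum₀ (t := t) hm Finset.univ
  simp only [hmgf, Finset.prod_const, Finset.card_univ, Fintype.card_fin] at hsum
  have hint : Integrable (fun ω => Real.exp (t * (∑ i, fun ω => f (X i ω)) ω)) P := by
    refine Integrable.of_bound (C := Real.exp (t * ∑ _i : Fin n, ∑ x, |f x|)) ?_ ?_
    · have : AEMeasurable (∑ i, fun ω => f (X i ω)) P :=
        Finset.aemeasurable_sum _ fun i _ => hm i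
      exact (Real.measurable_exp.comp_aemeasurable (this.const_mul t)).aestronglyMeasurable
    · refine Filter.Eventually.of_forall fun ω => ?_
      rw [Real.norm_of_nonneg (Real.exp_pos _).le, Finset.sum_apply]
      refine Real.exp_le_exp.2 (mul_le_mul_of_nonneg_left (Finset.sum_le_sum fun i _ => ?_) ht)
      exact (le_abs_self _).trans
        (Finset.single_le_sum (f := fun x => |f x|) (fun x _ => abs_nonneg _) (Finset.mem_univ _))
  have := measure_ge_le_exp_mul_mgf (n * b) ht hint
  rw [hsum] at this
  simp only [Finset.sum_apply] at this
  refine this.trans (le_of_eq ?_)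
  rw [mul_pow, ← Real.exp_nat_mul]
  congr 2; ring

/-- The Chernoff optimum `t = τ/(2A)` must stay inside the range where the quadratic mgf bound
holds; this is the condition `τ ≤ 2At₀`. -/
lemma prob_le_sum_le_of_quadratic (hX : ∀ i, HasLaw (X i) (isingMeasure θ) P)
    (hind : iIndepFun X P) {f : Config p → ℝ} {A t₀ τ : ℝ} (hA : 0 < A)
    (h : ∀ t, 0 ≤ t → t ≤ t₀ →
      isingExp θ (fun x => Real.exp (t * f x)) ≤ Real.exp (A * t ^ 2))
    (hτ : 0 ≤ τ) (hτt : τ ≤ 2 * A * t₀) :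
    P.real {ω | n * τ ≤ ∑ i, f (X i ω)} ≤ Real.exp (-(n * (τ ^ 2 / (4 * A)))) := by
  have ht : 0 ≤ τ / (2 * A) := by positivity
  refine (prob_le_sum_le hX hind f ht τ).trans ?_
  rw [show -((n : ℝ) * (τ ^ 2 / (4 * A))) = n * (-(τ ^ 2 / (4 * A))) by ring, Real.exp_nat_mul]
  have hE := h _ ht ((div_le_iff₀ (by positivity)).2 (by linarith))
  refine pow_le_pow_left₀ (mul_nonneg (Real.exp_pos _).le (isingExp_nonneg _ fun _ =>
    (Real.exp_pos _).le)) ?_ n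
  refine (mul_le_mul_of_nonneg_left hE (Real.exp_pos _).le).trans (le_of_eq ?_)
  rw [← Real.exp_add]
  congr 1
  field_simp; ring

end Ising

/-! ### Finite nets and Maurey's empirical method. -/

section Net

/-- A maximal `1/2`-separated subset of the ball is a `1/2`-net, and by duality the hull of a
`1/2`-net contains the ball of radius `1/2`. -/
lemma exists_finset_unitBall_subset_two_smul_convexHull (E : Type*) [NormedAddCommGroup E]
    [NormedSpace ℝ E] [FiniteDimensional ℝ E] :
    ∃ A : Finset E, A.card ≤ 5 ^ Module.finrank ℝ E ∧ (∀ a ∈ A, ‖a‖ ≤ 1) ∧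
      ∀ x : E, ‖x‖ ≤ 1 → ∃ v ∈ convexHull ℝ (A : Set E), x = (2 : ℝ) • v := by
  classical
  let V : Finset E → Prop := fun s =>
    (∀ c ∈ s, ‖c‖ ≤ 1) ∧ ∀ c ∈ s, ∀ d ∈ s, c ≠ d → 1 / 2 ≤ ‖c - d‖
  have hbd : ∀ s, V s → s.card ≤ 5 ^ Module.finrank ℝ E := by
    intro s hs
    have hinj : Function.Injective fun c : E => (2 : ℝ) • c :=
      smul_right_injective E two_ne_zero
    rw [← Finset.card_image_of_injective s hinj]
    -- Doubling turns the set into a `1`-separated subset of the ball of radius `2`, for which the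
    -- packing number is `5^d`.
    refine Besicovitch.card_le_of_separated _ ?_ ?_
    · intro c hc
      obtain ⟨a, ha, rfl⟩ := Finset.mem_image.1 hc
      rw [norm_smul]; norm_num; exact hs.1 a ha
    · intro c hc d hd hcd
      obtain ⟨a, ha, rfl⟩ := Finset.mem_image.1 hc
      obtain ⟨b, hb, rfl⟩ := Finset.mem_image.1 hd
      have hab : a ≠ b := fun h => hcd (by rw [h])
      rw [← smul_sub, norm_smul]; norm_num
      linarith [hs.2 a ha b hb hab]
  have hmem := Nat.sSup_mem (s := {k | ∃ s, V s ∧ s.card = k})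
    ⟨0, ∅, ⟨by simp, by simp⟩, rfl⟩ ⟨5 ^ Module.finrank ℝ E, by
      rintro k ⟨s, hs, rfl⟩; exact hbd s hs⟩
  obtain ⟨A, hA, hAcard⟩ := hmem
  have hmax : ∀ s, V s → s.card ≤ A.card := fun s hs => by
    rw [hAcard]
    exact le_csSup ⟨5 ^ Module.finrank ℝ E, by rintro k ⟨s, hs, rfl⟩; exact hbd s hs⟩ ⟨s, hs, rfl⟩
  have hnet : ∀ y : E, ‖y‖ ≤ 1 → ∃ c ∈ A, ‖y - c‖ ≤ 1 / 2 := by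
    intro y hy
    by_contra hcon
    push Not at hcon
    have hyA : y ∉ A := fun h => by
      have := hcon y h; rw [sub_self, norm_zero] at this; linarith
    have hV : V (insert y A) := by
      refine ⟨fun c hc => ?_, fun c hc d hd hcd => ?_⟩
      · rcases Finset.mem_insert.1 hc with rfl | hc
        exacts [hy, hA.1 c hc]
      · rcases Finset.mem_insert.1 hc with hc' | hc' <;>
          rcases Finset.mem_insert.1 hd with hd' | hd'
        · exact absurd (hc'.trans hd'.symm) hcd
        · rw [hc']; exact (hcon d hd').le
        · rw [hd', norm_sub_rev]; exact (hcon c hc').le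
        · exact hA.2 c hc' d hd' hcd
    have := hmax _ hV
    rw [Finset.card_insert_of_notMem hyA] at this
    omega
  refine ⟨A, hbd A hA, hA.1, fun x hx => ?_⟩
  refine ⟨(1 / 2 : ℝ) • x, ?_, by rw [smul_smul]; norm_num⟩
  -- A functional `f` separating `x/2` from the hull at level `u` has `‖f‖ ≤ u + ‖f‖/2` by the net
  -- property, so `f (x/2) ≤ ‖f‖/2 ≤ u`, a contradiction.
  by_contra hcon
  obtain ⟨f, u, hfA, hfx⟩ := geometric_hahn_banach_closed_point (convex_convexHull ℝ (A : Set E))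
    (A.finite_toSet.isClosed_convexHull ℝ) hcon
  have hle : ∀ y : E, ‖y‖ ≤ 1 → f y ≤ u + ‖f‖ / 2 := by
    intro y hy
    obtain ⟨c, hc, hyc⟩ := hnet y hy
    have h1 := hfA c (subset_convexHull ℝ _ hc)
    have h2 := (le_abs_self _).trans (f.le_opNorm (y - c))
    rw [map_sub] at h2
    nlinarith [norm_nonneg f]
  have h0 : 0 ≤ u + ‖f‖ / 2 := by simpa using hle 0 (by simp)
  have hn : ‖f‖ ≤ u + ‖f‖ / 2 := by
    refine ContinuousLinearMap.opNorm_le_of_unit_norm h0 fun y hy => ?_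
    rw [Real.norm_eq_abs, abs_le]
    have := hle (-y) (by rw [norm_neg, hy])
    rw [map_neg] at this
    exact ⟨by linarith, hle y hy.le⟩
  have hfx' := (le_abs_self _).trans (f.le_opNorm x)
  rw [map_smul, smul_eq_mul] at hfx
  nlinarith [norm_nonneg f]

/-- A deterministic form of Maurey's lemma: points are added greedily so that the cross term with
the current error is nonpositive, and the squared error grows by at most `4D` per step instead of
quadratically in `k`. -/
lemma exists_sum_near_smul {J E : Type*} [Fintype J] [AddCommGroup E] [Module ℝ E]
    {c : J → ℝ} (hc : ∀ j, 0 ≤ c j) (l : J → E →ₗ[ℝ] ℝ) {A : Set E} {v : E}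
    (hv : v ∈ convexHull ℝ A) {D : ℝ} (hD : ∀ a ∈ A, ∑ j, c j * l j a ^ 2 ≤ D) (k : ℕ) :
    ∃ f : Fin k → E, (∀ i, f i ∈ A) ∧
      ∑ j, c j * l j (∑ i, f i - (k : ℝ) • v) ^ 2 ≤ k * (4 * D) := by
  have hvD : ∑ j, c j * l j v ^ 2 ≤ D := by
    have hconv : Convex ℝ {x : E | ∑ j, c j * l j x ^ 2 ≤ D} := by
      have h : ConvexOn ℝ Set.univ fun x : E => ∑ j, c j * l j x ^ 2 := by
        refine ⟨convex_univ, fun x _ y _ a b ha hb hab => ?_⟩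
        simp only [smul_eq_mul, Finset.mul_sum, ← Finset.sum_add_distrib, map_add, map_smul]
        refine Finset.sum_le_sum fun j _ => ?_
        have hab' : b = 1 - a := by linarith
        subst hab'
        nlinarith [mul_nonneg (hc j) (mul_nonneg (mul_nonneg ha hb) (sq_nonneg (l j x - l j y)))]
      simpa using h.convex_le D
    exact convexHull_min hD hconv hv
  have hstep : ∀ a ∈ A, ∑ j, c j * l j (a - v) ^ 2 ≤ 4 * D := by
    intro a ha
    calc ∑ j, c j * l j (a - v) ^ 2
        ≤ ∑ j, (2 * (c j * l j a ^ 2) + 2 * (c j * l j v ^ 2)) := by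
          refine Finset.sum_le_sum fun j _ => ?_
          rw [map_sub]
          nlinarith [mul_nonneg (hc j) (sq_nonneg (l j a + l j v))]
      _ ≤ 4 * D := by
          rw [Finset.sum_add_distrib, ← Finset.mul_sum, ← Finset.mul_sum]
          linarith [hD a ha]
  induction k with
  | zero => exact ⟨Fin.elim0, fun i => i.elim0, by simp⟩
  | succ k ih =>
    obtain ⟨f, hf, hfk⟩ := ih
    obtain ⟨S, hS⟩ : ∃ S, S = ∑ i, f i - (k : ℝ) • v := ⟨_, rfl⟩
    rw [← hS] at hfk
    -- The cross term is affine in `a` and vanishes at `a = v`. Were it positive on all of `A`, it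
    -- would be positive on the hull, hence at `v`.
    have hex : ∃ a ∈ A, ∑ j, c j * (l j S * l j (a - v)) ≤ 0 := by
      by_contra hcon
      push Not at hcon
      have hlin : IsLinearMap ℝ fun x : E => ∑ j, c j * (l j S * l j x) := by
        constructor
        · intro x y
          rw [← Finset.sum_add_distrib]
          exact Finset.sum_congr rfl fun j _ => by rw [map_add]; ring
        · intro a x
          rw [smul_eq_mul, Finset.mul_sum]
          exact Finset.sum_congr rfl fun j _ => by rw [map_smul, smul_eq_mul]; ring
      have hsub : A ⊆ {x | ∑ j, c j * (l j S * l j v) < ∑ j, c j * (l j S * l j x)} := by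
        intro a ha
        have := hcon a ha
        have e : ∑ j, c j * (l j S * l j (a - v)) =
            ∑ j, c j * (l j S * l j a) - ∑ j, c j * (l j S * l j v) := by
          rw [← Finset.sum_sub_distrib]
          exact Finset.sum_congr rfl fun j _ => by rw [map_sub]; ring
        rw [e] at this
        exact sub_pos.1 this
      have hlt : ∑ j, c j * (l j S * l j v) < ∑ j, c j * (l j S * l j v) :=
        convexHull_min hsub (convex_halfSpace_gt hlin _) hv
      exact lt_irrefl _ hlt
    obtain ⟨a, ha, hle⟩ := hex
    refine ⟨Fin.snoc f a, fun i => ?_, ?_⟩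
    · refine Fin.lastCases ?_ (fun i => ?_) i
      · simpa using ha
      · simpa using hf i
    · have e : ∑ i, (Fin.snoc f a : Fin (k + 1) → E) i - ((k + 1 : ℕ) : ℝ) • v = S + (a - v) := by
        rw [Fin.sum_univ_castSucc]
        simp only [Fin.snoc_castSucc, Fin.snoc_last, hS]
        push_cast
        rw [add_smul, one_smul]; abel
      rw [e]
      calc ∑ j, c j * l j (S + (a - v)) ^ 2
          = ∑ j, c j * l j S ^ 2 + 2 * ∑ j, c j * (l j S * l j (a - v))
            + ∑ j, c j * l j (a - v) ^ 2 := by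
            rw [Finset.mul_sum, ← Finset.sum_add_distrib, ← Finset.sum_add_distrib]
            exact Finset.sum_congr rfl fun j _ => by rw [map_add]; ring
        _ ≤ k * (4 * D) + 2 * 0 + 4 * D :=
            add_le_add (add_le_add hfk (mul_le_mul_of_nonneg_left hle zero_le_two)) (hstep a ha)
        _ = ((k + 1 : ℕ) : ℝ) * (4 * D) := by push_cast; ring

end Net

/-! ### The group norm, its net, and the geometry of the error cone. -/

section GroupNorm

variable {p N : ℕ}

/-- The restriction of a parameter to a set of entries. -/
def restrictEntries (s : Finset (Fin p × Fin p)) : Param p →ₗ[ℝ] Param p where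
  toFun u := WithLp.toLp 2 fun e => if e ∈ s then u e else 0
  map_add' u v := by
    ext e; by_cases h : e ∈ s <;> simp [h]
  map_smul' a u := by
    ext e; by_cases h : e ∈ s <;> simp [h]

lemma restrictEntries_apply (s : Finset (Fin p × Fin p)) (u : Param p) (e : Fin p × Fin p) :
    restrictEntries s u e = if e ∈ s then u e else 0 := rfl

lemma norm_restrictEntries (s : Finset (Fin p × Fin p)) (u : Param p) :
    ‖restrictEntries s u‖ = Real.sqrt (∑ e ∈ s, u e ^ 2) := by
  classical
  rw [EuclideanSpace.norm_eq]
  congr 1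
  simp only [restrictEntries_apply, Real.norm_eq_abs, sq_abs, ite_pow]
  simp [Finset.sum_ite_mem]

variable {G : Fin N → Finset (Fin p × Fin p)}

lemma groupNorm_eq (u : Param p) : groupNorm G u = ∑ g, ‖restrictEntries (G g) u‖ := by
  simp only [norm_restrictEntries, groupNorm]

lemma groupNorm_nonneg (u : Param p) : 0 ≤ groupNorm G u := by
  rw [groupNorm_eq]; positivity

lemma groupNorm_add_le (u v : Param p) : groupNorm G (u + v) ≤ groupNorm G u + groupNorm G v := by
  simp only [groupNorm_eq, map_add, ← Finset.sum_add_distrib]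
  exact Finset.sum_le_sum fun g _ => norm_add_le _ _

lemma groupNorm_smul (a : ℝ) (u : Param p) : groupNorm G (a • u) = |a| * groupNorm G u := by
  simp only [groupNorm_eq, map_smul, norm_smul, Real.norm_eq_abs, Finset.mul_sum]

lemma groupNorm_neg (u : Param p) : groupNorm G (-u) = groupNorm G u := by
  rw [← neg_one_smul ℝ u, groupNorm_smul]; simp

lemma sum_restrictEntries (hG : IsGroupSystem G) {u : Param p} (hu : u ∈ admissible G) :
    ∑ g, restrictEntries (G g) u = u := by
  ext e
  simp only [WithLp.ofLp_sum, Finset.sum_apply, restrictEntries_apply]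
  by_cases h : ∃ g, e ∈ G g
  · obtain ⟨g, hg⟩ := h
    rw [Finset.sum_eq_single g, if_pos hg]
    · intro g' _ hne
      rw [if_neg]
      exact fun hg' => Finset.disjoint_left.1 (hG.disjoint g' g hne) hg' hg
    · simp
  · push Not at h
    simp only [h, if_false, Finset.sum_const_zero]
    exact (hu.2.2 e.1 e.2 h).symm

lemma norm_le_groupNorm (hG : IsGroupSystem G) {u : Param p} (hu : u ∈ admissible G) :
    ‖u‖ ≤ groupNorm G u := by
  rw [groupNorm_eq]
  conv_lhs => rw [← sum_restrictEntries hG hu]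
  exact norm_sum_le _ _

lemma sum_norm_restrictEntries_sq_le (hG : IsGroupSystem G) (u : Param p) (S : Finset (Fin N)) :
    ∑ g ∈ S, ‖restrictEntries (G g) u‖ ^ 2 ≤ ‖u‖ ^ 2 := by
  classical
  have : ∀ g, ‖restrictEntries (G g) u‖ ^ 2 = ∑ e ∈ G g, u e ^ 2 := fun g => by
    rw [norm_restrictEntries, Real.sq_sqrt (Finset.sum_nonneg fun _ _ => sq_nonneg _)]
  simp only [this]
  rw [← Finset.sum_biUnion fun g _ h _ hne => hG.disjoint g h hne, EuclideanSpace.norm_sq_eq]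
  simp only [Real.norm_eq_abs, sq_abs]
  exact Finset.sum_le_sum_of_subset_of_nonneg (Finset.subset_univ _) fun _ _ _ => sq_nonneg _

/-- The admissible parameters as a subspace. -/
def admissibleSubmodule (G : Fin N → Finset (Fin p × Fin p)) : Submodule ℝ (Param p) where
  carrier := admissible G
  add_mem' {u v} hu hv := ⟨fun s t => by simp [hu.1 s t, hv.1 s t],
    fun s => by simp [hu.2.1 s, hv.2.1 s],
    fun s t h => by simp [hu.2.2 s t h, hv.2.2 s t h]⟩
  zero_mem' := ⟨fun _ _ => rfl, fun _ => rfl, fun _ _ _ => rfl⟩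
  smul_mem' a u hu := ⟨fun s t => by simp [hu.1 s t], fun s => by simp [hu.2.1 s],
    fun s t h => by simp [hu.2.2 s t h]⟩

/-- The admissible parameters supported in one group. -/
def groupSubmodule (G : Fin N → Finset (Fin p × Fin p)) (g : Fin N) : Submodule ℝ (Param p) where
  carrier := {u | u ∈ admissible G ∧ ∀ e, e ∉ G g → u e = 0}
  add_mem' {u v} hu hv := ⟨(admissibleSubmodule G).add_mem hu.1 hv.1,
    fun e he => by simp [hu.2 e he, hv.2 e he]⟩
  zero_mem' := ⟨(admissibleSubmodule G).zero_mem, fun _ _ => rfl⟩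
  smul_mem' a u hu := ⟨(admissibleSubmodule G).smul_mem a hu.1,
    fun e he => by simp [hu.2 e he]⟩

lemma finrank_groupSubmodule_le (g : Fin N) :
    Module.finrank ℝ (groupSubmodule G g) ≤ maxGroupSize G := by
  let φ : groupSubmodule G g →ₗ[ℝ] (G g → ℝ) :=
    { toFun := fun u e => (u : Param p) e
      map_add' := fun u v => rfl
      map_smul' := fun a u => rfl }
  have hφ : Function.Injective φ := by
    intro u v h
    ext e
    by_cases he : e ∈ G g
    · exact congrFun h ⟨e, he⟩
    · rw [u.2.2 e he, v.2.2 e he]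
  have := LinearMap.finrank_le_finrank_of_injective hφ
  rw [Module.finrank_fintype_fun_eq_card, Fintype.card_coe] at this
  exact this.trans (Finset.le_sup (f := fun g => (G g).card) (Finset.mem_univ g))

lemma restrictEntries_mem_groupSubmodule (hG : IsGroupSystem G) {u : Param p}
    (hu : u ∈ admissible G) (g : Fin N) : restrictEntries (G g) u ∈ groupSubmodule G g := by
  refine ⟨⟨fun s t => ?_, fun s => ?_, fun s t h => ?_⟩, fun e he => ?_⟩
  · have : (s, t) ∈ G g ↔ (t, s) ∈ G g := ⟨hG.swap_mem g s t, hG.swap_mem g t s⟩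
    simp only [restrictEntries_apply, this, hu.1 s t]
  · simp only [restrictEntries_apply, hu.2.1 s, ite_self]
  · simp only [restrictEntries_apply, if_neg (h g)]
  · simp only [restrictEntries_apply, if_neg he]

/-- Every admissible `u` is `R(u)` times a convex combination of the normalised blocks `u_g/‖u_g‖`.
Each block is admissible by swap invariance of the groups and lies in a space of dimension at most
`m`, so the union of the `N` blockwise nets works. -/
lemma exists_admissible_net (hG : IsGroupSystem G) (hN : 0 < N) :
    ∃ A : Finset (Param p), A.card ≤ N * 5 ^ maxGroupSize G ∧
      (∀ a ∈ A, a ∈ admissible G ∧ ‖a‖ ≤ 1) ∧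
      ∀ u ∈ admissible G, ∀ L : ℝ, groupNorm G u ≤ L →
        ∃ v ∈ convexHull ℝ (A : Set (Param p)), u = (2 * L) • v := by
  classical
  choose A hcard hA hnet using fun g : Fin N =>
    exists_finset_unitBall_subset_two_smul_convexHull (groupSubmodule G g)
  let B : Finset (Param p) := Finset.univ.biUnion fun g => (A g).image (groupSubmodule G g).subtype
  have hsub : ∀ g, ∀ v ∈ convexHull ℝ (A g : Set (groupSubmodule G g)),
      (v : Param p) ∈ convexHull ℝ (B : Set (Param p)) := by
    intro g v hv
    have h1 := Set.mem_image_of_mem (groupSubmodule G g).subtype hv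
    rw [LinearMap.image_convexHull] at h1
    refine convexHull_mono ?_ h1
    rintro _ ⟨a, ha, rfl⟩
    exact Finset.mem_biUnion.2 ⟨g, Finset.mem_univ _, Finset.mem_image_of_mem _ ha⟩
  have hcB := convex_convexHull ℝ (B : Set (Param p))
  have h0 : (0 : Param p) ∈ convexHull ℝ (B : Set (Param p)) := by
    obtain ⟨v, hv, hv0⟩ := hnet ⟨0, hN⟩ 0 (by simp)
    have : v = 0 := by simpa using hv0.symm
    subst this
    exact hsub _ _ hv
  refine ⟨B, ?_, ?_, ?_⟩
  · refine Finset.card_biUnion_le.trans ?_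
    calc ∑ g, ((A g).image (groupSubmodule G g).subtype).card
        ≤ ∑ _g : Fin N, 5 ^ maxGroupSize G := by
          refine Finset.sum_le_sum fun g _ => Finset.card_image_le.trans ((hcard g).trans ?_)
          exact Nat.pow_le_pow_right (by norm_num) (finrank_groupSubmodule_le g)
      _ = _ := by simp
  · intro a ha
    obtain ⟨g, _, hg⟩ := Finset.mem_biUnion.1 ha
    obtain ⟨a', ha', rfl⟩ := Finset.mem_image.1 hg
    exact ⟨a'.2.1, hA g a' ha'⟩
  · intro u hu L hL
    have hR := groupNorm_nonneg (G := G) u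
    have hblock : ∀ g, ∃ v ∈ convexHull ℝ (B : Set (Param p)),
        restrictEntries (G g) u = (2 * ‖restrictEntries (G g) u‖) • v := by
      intro g
      set w : groupSubmodule G g := ⟨_, restrictEntries_mem_groupSubmodule hG hu g⟩ with hw
      have hwn : ‖w‖ = ‖restrictEntries (G g) u‖ := rfl
      obtain ⟨v, hv, hv'⟩ := hnet g (‖w‖⁻¹ • w) (by
        rw [norm_smul, norm_inv, norm_norm]; exact inv_mul_le_one)
      refine ⟨v, hsub g v hv, ?_⟩
      rw [← hwn]
      have : w = (2 * ‖w‖) • v := by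
        rw [mul_comm, mul_smul, ← hv']
        rcases eq_or_ne w 0 with h | h
        · simp [h]
        · rw [smul_inv_smul₀ (norm_ne_zero_iff.2 h)]
      exact congrArg Subtype.val this
    choose v hv hvu using hblock
    rcases hR.eq_or_lt with hR0 | hRpos
    · refine ⟨0, h0, ?_⟩
      have := norm_le_groupNorm hG hu
      rw [← hR0] at this
      rw [smul_zero]
      exact norm_le_zero_iff.1 this
    have hv' : ∑ g, (‖restrictEntries (G g) u‖ / groupNorm G u) • v g ∈
        convexHull ℝ (B : Set (Param p)) := by
      refine hcB.sum_mem (fun g _ => by positivity) ?_ fun g _ => hv g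
      rw [← Finset.sum_div, ← groupNorm_eq, div_self hRpos.ne']
    have hLpos : 0 < L := hRpos.trans_le hL
    refine ⟨(groupNorm G u / L) • _, hcB.smul_mem_of_zero_mem h0 hv'
      ⟨by positivity, (div_le_one hLpos).2 hL⟩, ?_⟩
    conv_lhs => rw [← sum_restrictEntries hG hu]
    rw [smul_smul, Finset.smul_sum]
    refine Finset.sum_congr rfl fun g _ => ?_
    rw [smul_smul]
    conv_lhs => rw [hvu g]
    congr 1
    field_simp

variable {S : Finset (Fin N)} {δ : Param p} {β : ℝ}

/-- Decomposability: with `a` and `b` the parts of `R(u)` on and off `S`, the defining inequality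
becomes `b - a ≤ (a + b)/β`, so `R(u) ≤ (2β/(β-1)) a`. Cauchy–Schwarz over the groups of `S` gives
the factor `√|S|`. -/
lemma groupNorm_le_of_mem_errorSet (hG : IsGroupSystem G) (hβ : 1 < β)
    (hδS : ∀ g, g ∉ S → ∀ e ∈ G g, δ e = 0) {u : Param p} (hu : u ∈ errorSet G δ β) :
    groupNorm G u ≤ 2 * β / (β - 1) * Real.sqrt S.card * ‖u‖ := by
  classical
  obtain ⟨-, hu⟩ := hu
  have hδ0 : ∀ g ∈ Sᶜ, restrictEntries (G g) δ = 0 := by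
    intro g hg
    ext e
    rw [restrictEntries_apply]
    split_ifs with h
    · exact hδS g (Finset.mem_compl.1 hg) e h
    · rfl
  simp only [groupNorm_eq, map_add] at hu ⊢
  rw [← Finset.sum_add_sum_compl S, ← Finset.sum_add_sum_compl S (fun g => ‖_‖),
    ← Finset.sum_add_sum_compl S (fun g => ‖restrictEntries (G g) u‖)] at hu
  rw [← Finset.sum_add_sum_compl S]
  have e1 : ∑ g ∈ Sᶜ, ‖restrictEntries (G g) δ + restrictEntries (G g) u‖
      = ∑ g ∈ Sᶜ, ‖restrictEntries (G g) u‖ :=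
    Finset.sum_congr rfl fun g hg => by rw [hδ0 g hg, zero_add]
  have e2 : ∑ g ∈ Sᶜ, ‖restrictEntries (G g) δ‖ = 0 :=
    Finset.sum_eq_zero fun g hg => by rw [hδ0 g hg, norm_zero]
  have e3 : ∑ g ∈ S, ‖restrictEntries (G g) δ‖ ≤
      ∑ g ∈ S, ‖restrictEntries (G g) δ + restrictEntries (G g) u‖
        + ∑ g ∈ S, ‖restrictEntries (G g) u‖ := by
    rw [← Finset.sum_add_distrib]
    refine Finset.sum_le_sum fun g _ => ?_
    have := norm_sub_le (restrictEntries (G g) δ + restrictEntries (G g) u)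
      (restrictEntries (G g) u)
    rwa [add_sub_cancel_right] at this
  rw [e1, e2] at hu
  set a := ∑ g ∈ S, ‖restrictEntries (G g) u‖
  set b := ∑ g ∈ Sᶜ, ‖restrictEntries (G g) u‖
  have ha : a ≤ Real.sqrt S.card * ‖u‖ := by
    have hc := Finset.sum_mul_sq_le_sq_mul_sq S (fun _ => (1 : ℝ))
      (fun g => ‖restrictEntries (G g) u‖)
    simp only [one_mul, one_pow, Finset.sum_const, nsmul_eq_mul, mul_one] at hc
    have h2 := sum_norm_restrictEntries_sq_le hG u S
    refine Real.le_sqrt_of_sq_le (hc.trans (mul_le_mul_of_nonneg_left h2 (by positivity)))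
      |>.trans (le_of_eq ?_)
    rw [Real.sqrt_mul (by positivity), Real.sqrt_sq (norm_nonneg _)]
  have hb1 : 0 < β - 1 := by linarith
  have hab : (β - 1) * (a + b) ≤ 2 * β * a := by
    have h1 : b - a ≤ 1 / β * (a + b) := by linarith
    rw [div_mul_eq_mul_div, one_mul, le_div_iff₀ (by linarith)] at h1
    linarith
  calc a + b ≤ 2 * β / (β - 1) * a := by
        rw [div_mul_eq_mul_div, le_div_iff₀ hb1]; linarith
    _ ≤ 2 * β / (β - 1) * (Real.sqrt S.card * ‖u‖) :=
        mul_le_mul_of_nonneg_left ha (by positivity)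
    _ = _ := by ring

lemma groupNorm_le_of_mem_errorCone (hG : IsGroupSystem G) (hβ : 1 < β)
    (hδS : ∀ g, g ∉ S → ∀ e ∈ G g, δ e = 0) {u : Param p} (hu : u ∈ errorCone G δ β) :
    groupNorm G u ≤ 2 * β / (β - 1) * Real.sqrt S.card * ‖u‖ := by
  obtain ⟨t, ht, v, hv, rfl⟩ := hu
  have := groupNorm_le_of_mem_errorSet hG hβ hδS hv
  rw [groupNorm_smul, norm_smul, Real.norm_eq_abs, abs_of_nonneg ht]
  nlinarith

lemma errorCone_subset_admissible {u : Param p} (hu : u ∈ errorCone G δ β) :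
    u ∈ admissible G := by
  obtain ⟨t, -, v, hv, rfl⟩ := hu
  exact (admissibleSubmodule G).smul_mem t hv.1

lemma smul_mem_errorCone {u : Param p} (hu : u ∈ errorCone G δ β) {a : ℝ} (ha : 0 ≤ a) :
    a • u ∈ errorCone G δ β := by
  obtain ⟨t, ht, v, hv, rfl⟩ := hu
  exact ⟨a * t, mul_nonneg ha ht, v, hv, smul_smul a t v⟩

lemma errorSet_subset_errorCone {u : Param p} (hu : u ∈ errorSet G δ β) :
    u ∈ errorCone G δ β := ⟨1, zero_le_one, u, hu, (one_smul ℝ u).symm⟩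

/-- This puts the direction of `δ*` itself in the cone, so that nondegeneracy and norm compatibility
apply to it. -/
lemma neg_mem_errorSet (hβ : 1 < β) (hδ : δ ∈ admissible G) : -δ ∈ errorSet G δ β := by
  refine ⟨(admissibleSubmodule G).neg_mem hδ, ?_⟩
  have h0 : groupNorm G (0 : Param p) = 0 := by simp [groupNorm]
  rw [add_neg_cancel, h0]
  have h1 := groupNorm_nonneg (G := G) δ
  have h2 := groupNorm_nonneg (G := G) (-δ)
  have : 0 < β := by linarith
  positivity

lemma compatConst_nonneg (C : Set (Param p)) : 0 ≤ compatConst G C := by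
  refine Real.sSup_nonneg ?_
  rintro _ ⟨u, -, -, rfl⟩
  exact div_nonneg (groupNorm_nonneg u) (norm_nonneg u)

lemma compatConst_errorCone_le (hG : IsGroupSystem G) (hβ : 1 < β)
    (hδS : ∀ g, g ∉ S → ∀ e ∈ G g, δ e = 0) :
    compatConst G (errorCone G δ β) ≤ 2 * β / (β - 1) * Real.sqrt S.card := by
  have : 0 < β - 1 := by linarith
  refine Real.sSup_le ?_ (by positivity)
  rintro _ ⟨u, hu, hu0, rfl⟩
  rw [div_le_iff₀ (norm_pos_iff.2 hu0)]
  exact groupNorm_le_of_mem_errorCone hG hβ hδS hu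

lemma groupNorm_le_compatConst_mul (hG : IsGroupSystem G) (hβ : 1 < β)
    (hδS : ∀ g, g ∉ S → ∀ e ∈ G g, δ e = 0) {u : Param p} (hu : u ∈ errorCone G δ β) :
    groupNorm G u ≤ compatConst G (errorCone G δ β) * ‖u‖ := by
  rcases eq_or_ne u 0 with rfl | hu0
  · simp [groupNorm]
  rw [← div_le_iff₀ (norm_pos_iff.2 hu0)]
  -- Boundedness is needed here: a real `sSup` of an unbounded set takes the default value `0`.
  refine le_csSup ⟨2 * β / (β - 1) * Real.sqrt S.card, ?_⟩ ⟨u, hu, hu0, rfl⟩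
  rintro _ ⟨v, hv, hv0, rfl⟩
  rw [div_le_iff₀ (norm_pos_iff.2 hv0)]
  exact groupNorm_le_of_mem_errorCone hG hβ hδS hv

lemma compatConst_errorCone_le_four (hG : IsGroupSystem G) (hβ : 2 ≤ β)
    (hδS : ∀ g, g ∉ S → ∀ e ∈ G g, δ e = 0) :
    compatConst G (errorCone G δ β) ≤ 4 * Real.sqrt S.card := by
  refine (compatConst_errorCone_le hG (by linarith) hδS).trans ?_
  refine mul_le_mul_of_nonneg_right ?_ (Real.sqrt_nonneg _)
  rw [div_le_iff₀ (by linarith)]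
  linarith

end GroupNorm

end DirectChange

namespace DirectChange

/-! ### Density ratios and sub-Gaussian statistics under both laws. -/

section Moments

variable {p N : ℕ} {G : Fin N → Finset (Fin p × Fin p)}

lemma densityRatio_pos (θ δ : Param p) (x : Config p) : 0 < densityRatio θ δ x :=
  div_pos (Real.exp_pos _) (isingExp_exp_pos θ _)

lemma isingProb_eq_mul_densityRatio (θ₁ θ₂ : Param p) (x : Config p) :
    isingProb θ₁ x = isingProb θ₂ x * densityRatio θ₂ (θ₁ - θ₂) x := by
  have hexp : ∀ y : Config p, Real.exp ⟪θ₂, suffStat y⟫ * Real.exp ⟪suffStat y, θ₁ - θ₂⟫ =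
      Real.exp ⟪θ₁, suffStat y⟫ := by
    intro y
    rw [← Real.exp_add, real_inner_comm (θ₁ - θ₂), inner_sub_left]
    congr 1; ring
  have hZ : isingExp θ₂ (fun y => Real.exp ⟪suffStat y, θ₁ - θ₂⟫) =
      partitionFn θ₁ / partitionFn θ₂ := by
    unfold isingExp isingProb
    simp only [div_mul_eq_mul_div, hexp]
    rw [← Finset.sum_div]; rfl
  have h1 := partitionFn_pos θ₁
  have h2 := partitionFn_pos θ₂
  rw [densityRatio, hZ, isingProb, isingProb, ← hexp]
  field_simp

lemma isingExp_eq_densityRatio_mul (θ₁ θ₂ : Param p) (f : Config p → ℝ) :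
    isingExp θ₁ f = isingExp θ₂ (fun x => densityRatio θ₂ (θ₁ - θ₂) x * f x) := by
  unfold isingExp
  exact Finset.sum_congr rfl fun x _ => by rw [isingProb_eq_mul_densityRatio θ₁ θ₂, mul_assoc]

lemma isingExp_densityRatio (θ δ : Param p) : isingExp θ (densityRatio θ δ) = 1 := by
  have h := isingExp_eq_densityRatio_mul (θ + δ) θ (fun _ => 1)
  rw [isingExp_const] at h
  simpa using h.symm

lemma densityRatio_zero (θ : Param p) (x : Config p) : densityRatio θ 0 x = 1 := by
  simp [densityRatio, isingExp_const]

section Ratio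

variable {θ δ : Param p} (hs : SmoothDensityRatio G θ δ)
include hs

lemma isingExp_exp_densityRatio_le (t : ℝ) :
    isingExp θ (fun x => Real.exp (t * (densityRatio θ δ x - 1))) ≤ Real.exp (t ^ 2) := by
  have := hs 0 (admissibleSubmodule G).zero_mem (by simp) t
  simpa using this

lemma isingExp_exp_sq_densityRatio_le :
    isingExp θ (fun x => Real.exp (1 / (8 * Real.exp 1) * (densityRatio θ δ x - 1) ^ 2)) ≤ 2 := by
  have h := sum_exp_sq_le_two (w := isingProb θ) (Y := fun x => densityRatio θ δ x - 1)
    (B := 4 * Real.exp 1) (by positivity)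
    (even_moment_le_of_exp_le (isingProb_nonneg θ) (sum_isingProb θ)
      (isingExp_exp_densityRatio_le hs))
  rwa [show 2 * (4 * Real.exp 1) = 8 * Real.exp 1 by ring] at h

lemma isingExp_densityRatio_sq_le : isingExp θ (fun x => densityRatio θ δ x ^ 2) ≤ 12 := by
  have h := even_moment_le_of_exp_le (isingProb_nonneg θ) (sum_isingProb θ)
      (isingExp_exp_densityRatio_le hs) 1
  change isingExp θ (fun x => (densityRatio θ δ x - 1) ^ (2 * 1)) ≤ _ at h
  have e : isingExp θ (fun x => densityRatio θ δ x ^ 2) =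
      isingExp θ (fun x => (densityRatio θ δ x - 1) ^ (2 * 1)) + 1 := by
    have e1 : (fun x => densityRatio θ δ x ^ 2) =
        fun x => (densityRatio θ δ x - 1) ^ (2 * 1) + (2 * densityRatio θ δ x - 1) := by
      funext x; ring
    have e2 : isingExp θ (fun x => 2 * densityRatio θ δ x - 1) = 1 := by
      rw [isingExp_sub, isingExp_const, isingExp_const_mul]
      have := isingExp_densityRatio θ δ
      change isingExp θ (fun x => densityRatio θ δ x) = 1 at this
      rw [this]; norm_num
    rw [e1, isingExp_add, e2]
  rw [e]
  have := Real.exp_one_lt_d9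
  norm_num at h
  linarith

end Ratio

/-- The statistic `⟨a, T(x)⟩` centred at its mean under `p(· | θ)`. -/
noncomputable def centredStat (θ a : Param p) (x : Config p) : ℝ :=
  ⟪a, suffStat x⟫ - isingExp θ (fun y => ⟪a, suffStat y⟫)

lemma isingExp_centredStat (θ a : Param p) : isingExp θ (centredStat θ a) = 0 := by
  change isingExp θ (fun x => _ - _) = 0
  rw [isingExp_sub, isingExp_const, sub_self]

lemma centredStat_eq_sub (θ₁ θ₂ a : Param p) (x : Config p) :
    centredStat θ₁ a x = centredStat θ₂ a x - isingExp θ₁ (centredStat θ₂ a) := by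
  have : isingExp θ₁ (centredStat θ₂ a) = isingExp θ₁ (fun y => ⟪a, suffStat y⟫)
      - isingExp θ₂ (fun y => ⟪a, suffStat y⟫) := by
    change isingExp θ₁ (fun x => _ - _) = _
    rw [isingExp_sub, isingExp_const]
  rw [this]; unfold centredStat; ring

/-- A rate `κ` with `E exp (κ Y²) ≤ 2` for the centred statistics `Y`, under both laws. -/
noncomputable def expSqRate (K : ℝ) : ℝ := 1 / (384 * Real.exp 1 * K ^ 2)

lemma expSqRate_pos {K : ℝ} (hK : 0 < K) : 0 < expSqRate K := by
  unfold expSqRate; positivity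

section SubGaussian

variable {K : ℝ} {θ₁ θ₂ a : Param p} (hK : 0 < K) (hsub : SubGaussianStat G θ₂ K)
  (ha : a ∈ admissible G) (ha1 : ‖a‖ ≤ 1)
include hK hsub ha ha1

lemma isingExp_centredStat_pow_le (k : ℕ) :
    isingExp θ₂ (fun x => centredStat θ₂ a x ^ (2 * k)) ≤ (2 * K ^ 2 * k) ^ k := by
  refine even_moment_le_of_pow_le (isingProb_nonneg θ₂) (sum_isingProb θ₂) (fun q hq => ?_) k
  refine (hsub a ha q hq).trans ?_
  exact mul_le_of_le_one_right (by positivity) ha1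

lemma isingExp_exp_centredStat_sq_le :
    isingExp θ₂ (fun x => Real.exp (96 * expSqRate K * centredStat θ₂ a x ^ 2)) ≤ 2 := by
  have h := sum_exp_sq_le_two (w := isingProb θ₂) (Y := centredStat θ₂ a)
    (B := 2 * Real.exp 1 * K ^ 2) (by positivity) (fun k => by
      refine (isingExp_centredStat_pow_le hK hsub ha ha1 k).trans ?_
      have := nat_pow_self_le k
      calc (2 * K ^ 2 * k) ^ k = (2 * K ^ 2) ^ k * (k : ℝ) ^ k := by rw [mul_pow]
        _ ≤ (2 * K ^ 2) ^ k * (Real.exp 1 ^ k * k.factorial) := by gcongr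
        _ = (2 * Real.exp 1 * K ^ 2) ^ k * k.factorial := by
          rw [← mul_assoc, ← mul_pow]; congr 2; ring)
  have e : 1 / (2 * (2 * Real.exp 1 * K ^ 2)) = 96 * expSqRate K := by
    unfold expSqRate; field_simp; norm_num
  rwa [e] at h

variable (hs : SmoothDensityRatio G θ₂ (θ₁ - θ₂))
include hs

/-- Change of measure: `r e^Q ≤ r²/2 + e^{2Q}/2` halves the rate from `96` to `48` units of
`expSqRate` and leaves the bound `12/2 + 2/2 = 7`. -/
lemma isingExp_exp_sq_le_changed :
    isingExp θ₁ (fun x => Real.exp (8 * expSqRate K * centredStat θ₂ a x ^ 2)) ≤ 2 := by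
  have h7 : isingExp θ₁ (fun x => Real.exp (48 * expSqRate K * centredStat θ₂ a x ^ 2)) ≤ 7 := by
    rw [isingExp_eq_densityRatio_mul θ₁ θ₂]
    calc _ ≤ isingExp θ₂ (fun x => 1 / 2 * densityRatio θ₂ (θ₁ - θ₂) x ^ 2
          + 1 / 2 * Real.exp (96 * expSqRate K * centredStat θ₂ a x ^ 2)) := by
          refine isingExp_mono _ fun x => ?_
          have e : Real.exp (96 * expSqRate K * centredStat θ₂ a x ^ 2) =
              Real.exp (48 * expSqRate K * centredStat θ₂ a x ^ 2) ^ 2 := by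
            rw [← Real.exp_nat_mul]; congr 1; push_cast; ring
          rw [e]
          nlinarith [sq_nonneg (densityRatio θ₂ (θ₁ - θ₂) x -
            Real.exp (48 * expSqRate K * centredStat θ₂ a x ^ 2))]
      _ ≤ 7 := by
          rw [isingExp_add, isingExp_const_mul, isingExp_const_mul]
          linarith [isingExp_densityRatio_sq_le hs, isingExp_exp_centredStat_sq_le hK hsub ha ha1]
  -- Dividing the exponent by `6` brings the bound `7` down to `1 + (7 - 1)/6 = 2`; the rate becomes
  -- `48/6 = 8` units, exactly what the later recentring consumes.
  have := sum_exp_mul_le (isingProb_nonneg θ₁) (sum_isingProb θ₁) h7 (s := 1 / 6)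
    (by norm_num) (by norm_num)
  refine le_trans (le_of_eq ?_) (this.trans (by norm_num))
  unfold isingExp
  refine Finset.sum_congr rfl fun x _ => ?_
  congr 2; ring_nf

lemma isingExp_exp_centredStat_sq_le_two :
    isingExp θ₁ (fun x => Real.exp (expSqRate K * centredStat θ₁ a x ^ 2)) ≤ 2 ∧
    isingExp θ₂ (fun x => Real.exp (expSqRate K * centredStat θ₁ a x ^ 2)) ≤ 2 := by
  have hr := expSqRate_pos hK
  have h8 : 0 < 8 * expSqRate K := by positivity
  have h1 := isingExp_exp_sq_le_changed hK hsub ha ha1 hs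
  have h2 := sum_exp_sq_mono (isingProb_nonneg θ₂) (θ' := 8 * expSqRate K) (by linarith)
    (isingExp_exp_centredStat_sq_le hK hsub ha ha1)
  have hd : isingExp θ₁ (centredStat θ₂ a) ^ 2 ≤ 1 / (8 * expSqRate K) :=
    (sq_sum_le_sum_sq (isingProb_nonneg θ₁) (sum_isingProb θ₁).le _).trans
      (sum_sq_le_of_exp_sq (isingProb_nonneg θ₁) (sum_isingProb θ₁) h8 h1)
  have g1 := sum_exp_sq_sub_le (isingProb_nonneg θ₁) (sum_isingProb θ₁) h8 h1 hd
  have g2 := sum_exp_sq_sub_le (isingProb_nonneg θ₂) (sum_isingProb θ₂) h8 h2 hd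
  have e : 8 * expSqRate K / 8 = expSqRate K := by ring
  simp only [centredStat_eq_sub θ₁ θ₂ a]
  rw [e] at g1 g2
  exact ⟨g1, g2⟩

lemma isingExp_exp_centredStat_le (t : ℝ) :
    isingExp θ₁ (fun x => Real.exp (t * centredStat θ₁ a x)) ≤
      Real.exp (1 / expSqRate K * t ^ 2) :=
  sum_exp_le_of_sq (isingProb_nonneg θ₁) (sum_isingProb θ₁) (expSqRate_pos hK)
    (isingExp_centredStat θ₁ a) (isingExp_exp_centredStat_sq_le_two hK hsub ha ha1 hs).1 t

/-- The variable has mean zero under `θ₂` because `E_{θ₂}[r f] = E_{θ₁} f`. As a product of two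
sub-Gaussian factors it is only sub-exponential, whence the restriction on `t`. -/
lemma isingExp_exp_weightedStat_le {t : ℝ} (ht : 0 ≤ t)
    (htt : t ≤ Real.sqrt (expSqRate K / (16 * Real.exp 1))) :
    isingExp θ₂ (fun x => Real.exp (t * -(densityRatio θ₂ (θ₁ - θ₂) x * centredStat θ₁ a x))) ≤
      Real.exp (48 * Real.exp 1 / expSqRate K * t ^ 2) := by
  have hr := expSqRate_pos hK
  -- With `α = 1/(8e)`, the rate available for `r - 1`, this makes `t₀²` the product of `α/2` and
  -- the rate of the statistic, so AM-GM splits `t₀|ry|` into the two controlled squares; `r² ≤ 2 +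
  -- 2(r - 1)²` recentres `r`.
  set t₀ := Real.sqrt (expSqRate K / (16 * Real.exp 1)) with ht₀
  have ht₀pos : 0 < t₀ := Real.sqrt_pos.2 (by positivity)
  have ht₀sq : t₀ ^ 2 = expSqRate K / (16 * Real.exp 1) := Real.sq_sqrt (by positivity)
  have hB : 48 * Real.exp 1 / expSqRate K = 3 / t₀ ^ 2 := by rw [ht₀sq]; field_simp; norm_num
  rw [hB]
  refine sum_exp_le_of_abs (isingProb_nonneg θ₂) (sum_isingProb θ₂) ht₀pos ?_ ?_ ht htt
  · have := isingExp_eq_densityRatio_mul θ₁ θ₂ (centredStat θ₁ a)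
    rw [isingExp_centredStat] at this
    unfold isingExp at this
    simp only [mul_neg, Finset.sum_neg_distrib, ← this, neg_zero]
  set α := 1 / (8 * Real.exp 1) with hα
  have hαpos : 0 < α := by positivity
  have hexpα : Real.exp α ≤ 2 := by
    have h1 : α ≤ 1 / 2 := by
      rw [hα]
      have := Real.add_one_le_exp 1
      refine one_div_le_one_div_of_le (by norm_num) ?_
      linarith
    have h2 : Real.exp (1 / 2) ^ 2 ≤ 2 ^ 2 := by
      rw [← Real.exp_nat_mul]
      have := Real.exp_one_lt_d9
      norm_num; linarith
    exact (Real.exp_le_exp.2 h1).trans (abs_le_of_sq_le_sq' h2 (by norm_num)).2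
  calc ∑ x, isingProb θ₂ x *
        Real.exp (t₀ * |-(densityRatio θ₂ (θ₁ - θ₂) x * centredStat θ₁ a x)|)
      ≤ isingExp θ₂ (fun x => Real.exp α / 2 *
          Real.exp (α * (densityRatio θ₂ (θ₁ - θ₂) x - 1) ^ 2)
          + 1 / 2 * Real.exp (expSqRate K * centredStat θ₁ a x ^ 2)) := by
        refine isingExp_mono θ₂ fun x => ?_
        set r := densityRatio θ₂ (θ₁ - θ₂) x
        set y := centredStat θ₁ a x
        have h1 : t₀ * |-(r * y)| ≤ 1 / 2 * (α + α * (r - 1) ^ 2) + 1 / 2 * (expSqRate K * y ^ 2) := by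
          have hA : t₀ * |-(r * y)| ≤ 1 / 2 * (α / 2 * r ^ 2 + expSqRate K * y ^ 2) := by
            refine abs_le_of_sq_le_sq' ?_ (by positivity) |>.2
            rw [mul_pow, sq_abs, ht₀sq]
            have e : expSqRate K / (16 * Real.exp 1) = α / 2 * expSqRate K := by
              rw [hα]; field_simp; norm_num
            rw [e]
            nlinarith [sq_nonneg (α / 2 * r ^ 2 - expSqRate K * y ^ 2)]
          nlinarith [mul_nonneg hαpos.le (sq_nonneg (r - 2))]
        have h2 : ∀ u v : ℝ, Real.exp (1 / 2 * u + 1 / 2 * v) ≤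
            1 / 2 * Real.exp u + 1 / 2 * Real.exp v := fun u v => by
          have := convexOn_exp.2 (Set.mem_univ u) (Set.mem_univ v)
            (by norm_num : (0 : ℝ) ≤ 1 / 2) (by norm_num : (0 : ℝ) ≤ 1 / 2) (by norm_num)
          simpa only [smul_eq_mul] using this
        refine (Real.exp_le_exp.2 h1).trans ((h2 _ _).trans (le_of_eq ?_))
        rw [Real.exp_add]; ring
    _ ≤ 2 / 2 * 2 + 1 / 2 * 2 := by
        rw [isingExp_add, isingExp_const_mul, isingExp_const_mul]
        have h1 := isingExp_exp_sq_densityRatio_le hs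
        have h2 := (isingExp_exp_centredStat_sq_le_two hK hsub ha ha1 hs).2
        refine add_le_add (mul_le_mul (by linarith) h1 (isingExp_nonneg _ fun _ =>
          (Real.exp_pos _).le) (by norm_num)) (by linarith)
    _ = 3 := by norm_num

end SubGaussian

end Moments

end DirectChange

namespace DirectChange

/-! ### Lower bounds for truncated positive parts. -/

section Truncation

/-- The truncated positive part. -/
noncomputable def clip (M y : ℝ) : ℝ := min (max y 0) M

lemma clip_nonneg {M : ℝ} (hM : 0 ≤ M) (y : ℝ) : 0 ≤ clip M y :=
  le_min (le_max_right _ _) hM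

lemma clip_le (M y : ℝ) : clip M y ≤ M := min_le_right _ _

lemma abs_clip_sub_clip_le (M x y : ℝ) : |clip M x - clip M y| ≤ |x - y| :=
  (abs_min_sub_min_le_max _ _ _ _).trans (by
    rw [sub_self, abs_zero]
    refine max_le ((abs_max_sub_max_le_max _ _ _ _).trans ?_) (abs_nonneg _)
    simp)

lemma le_clip {M : ℝ} (hM : 0 < M) (y : ℝ) : 1 / 2 * y + 1 / 2 * |y| - 1 / (4 * M) * y ^ 2 ≤ clip M y := by
  have h0 : 0 ≤ 1 / (4 * M) * y ^ 2 := by positivity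
  unfold clip
  rcases le_or_gt y 0 with hy | hy
  · rw [abs_of_nonpos hy]
    exact le_min (le_max_of_le_right (by linarith)) (by linarith)
  · rw [abs_of_pos hy, max_eq_left hy.le]
    refine le_min (by linarith) ?_
    have : 0 ≤ 1 / (4 * M) * (y - 2 * M) ^ 2 := by positivity
    have e : 1 / (4 * M) * (y - 2 * M) ^ 2 = 1 / (4 * M) * y ^ 2 - y + M := by field_simp; ring
    linarith

variable {α : Type*} [Fintype α] {w : α → ℝ}

lemma sq_sum_sq_le (hw : ∀ x, 0 ≤ w x) (Y : α → ℝ) :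
    (∑ x, w x * Y x ^ 2) ^ 2 ≤ (∑ x, w x) * ∑ x, w x * Y x ^ 4 :=
  Finset.sum_sq_le_sum_mul_sum_of_sq_le_mul Finset.univ (fun x _ => hw x)
    (fun x _ => mul_nonneg (hw x) (by positivity)) (fun x _ => le_of_eq (by ring))

/-- From `y² ≤ L|y| + y⁴/L²`: the choice `L² = 2V/ρ` lets the fourth-moment term use up only half of
`ρ`. -/
lemma le_sum_abs (hw : ∀ x, 0 ≤ w x) {Y : α → ℝ} {ρ V : ℝ} (hρ : 0 < ρ) (hV : 0 < V)
    (h2 : ρ ≤ ∑ x, w x * Y x ^ 2) (h4 : ∑ x, w x * Y x ^ 4 ≤ V) :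
    ρ / (2 * Real.sqrt (2 * V / ρ)) ≤ ∑ x, w x * |Y x| := by
  set L := Real.sqrt (2 * V / ρ) with hL
  have hLpos : 0 < L := Real.sqrt_pos.2 (by positivity)
  have hL2 : L ^ 2 = 2 * V / ρ := Real.sq_sqrt (by positivity)
  have hpt : ∀ y : ℝ, y ^ 2 ≤ L * |y| + y ^ 4 / L ^ 2 := by
    intro y
    have e4 : y ^ 4 = |y| ^ 4 := by rw [show 4 = 2 * 2 by norm_num, pow_mul, pow_mul, sq_abs]
    rw [e4, ← sq_abs y]
    have h0 := abs_nonneg y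
    rcases le_or_gt |y| L with h | h
    · have : 0 ≤ |y| ^ 4 / L ^ 2 := by positivity
      nlinarith
    · have : |y| ^ 2 ≤ |y| ^ 4 / L ^ 2 := by
        rw [le_div_iff₀ (by positivity)]
        have : L ^ 2 ≤ |y| ^ 2 := by gcongr
        nlinarith [sq_nonneg |y|]
      nlinarith
  have h := calc ρ ≤ ∑ x, w x * Y x ^ 2 := h2
    _ ≤ ∑ x, w x * (L * |Y x| + Y x ^ 4 / L ^ 2) :=
        Finset.sum_le_sum fun x _ => mul_le_mul_of_nonneg_left (hpt _) (hw x)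
    _ = L * ∑ x, w x * |Y x| + (∑ x, w x * Y x ^ 4) / L ^ 2 := by
        rw [Finset.mul_sum, Finset.sum_div, ← Finset.sum_add_distrib]
        exact Finset.sum_congr rfl fun x _ => by ring
    _ ≤ L * ∑ x, w x * |Y x| + V / L ^ 2 := by gcongr
    _ = L * ∑ x, w x * |Y x| + ρ / 2 := by rw [hL2]; congr 1; field_simp
  rw [div_le_iff₀ (by positivity)]
  linarith

/-- Centring makes the positive part carry half of the absolute moment, at least `h/2`. Truncation
at `M` loses at most `y²/(4M)` pointwise, which costs `h/4` on average at `M = V/h`. -/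
lemma le_sum_clip (hw : ∀ x, 0 ≤ w x) {Y : α → ℝ} {h V : ℝ} (hh : 0 < h) (hV : 0 < V)
    (h0 : ∑ x, w x * Y x = 0) (h1 : h ≤ ∑ x, w x * |Y x|) (h2 : ∑ x, w x * Y x ^ 2 ≤ V) :
    h / 4 ≤ ∑ x, w x * clip (V / h) (Y x) := by
  have hM : 0 < V / h := by positivity
  calc h / 4 = 1 / 2 * 0 + 1 / 2 * h - 1 / (4 * (V / h)) * V := by field_simp; ring
    _ ≤ 1 / 2 * ∑ x, w x * Y x + 1 / 2 * ∑ x, w x * |Y x|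
          - 1 / (4 * (V / h)) * ∑ x, w x * Y x ^ 2 := by
        rw [h0]; gcongr
    _ = ∑ x, w x * (1 / 2 * Y x + 1 / 2 * |Y x| - 1 / (4 * (V / h)) * Y x ^ 2) := by
        rw [Finset.mul_sum, Finset.mul_sum, Finset.mul_sum, ← Finset.sum_add_distrib,
          ← Finset.sum_sub_distrib]
        exact Finset.sum_congr rfl fun x _ => by ring
    _ ≤ _ := Finset.sum_le_sum fun x _ => mul_le_mul_of_nonneg_left (le_clip hM _) (hw x)

end Truncation

/-! ### Statistics centred on the event of large density ratio. -/

section Conditional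

variable {p N : ℕ} {G : Fin N → Finset (Fin p × Fin p)}

/-- The linear statistic `u ↦ ⟨u, T(x)⟩` centred at its mean under the weight `I`. -/
noncomputable def condStat (θ : Param p) (I : Config p → ℝ) (x : Config p) : Param p →ₗ[ℝ] ℝ where
  toFun u := ⟪u, suffStat x⟫ - isingExp θ (fun y => I y * ⟪u, suffStat y⟫) / isingExp θ I
  map_add' u v := by
    simp only [inner_add_left, mul_add]
    rw [isingExp_add]; ring
  map_smul' a u := by
    simp only [real_inner_smul_left, mul_left_comm _ a]
    rw [isingExp_const_mul, RingHom.id_apply, smul_eq_mul]; ring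

lemma condStat_apply (θ : Param p) (I : Config p → ℝ) (x : Config p) (u : Param p) :
    condStat θ I x u =
      ⟪u, suffStat x⟫ - isingExp θ (fun y => I y * ⟪u, suffStat y⟫) / isingExp θ I := rfl

lemma isingExp_mul_condStat (θ : Param p) {I : Config p → ℝ} (hI : isingExp θ I ≠ 0)
    (u : Param p) : isingExp θ (fun x => I x * condStat θ I x u) = 0 := by
  simp only [condStat_apply, mul_sub]
  rw [isingExp_sub]
  simp only [mul_comm (I _) (_ / _)]
  rw [isingExp_const_mul, div_mul_cancel₀ _ hI, sub_self]

variable {K p₀ : ℝ} {θ a : Param p} {I : Config p → ℝ}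

/-- Centring at the `I`-weighted mean instead of the plain mean is a bounded shift, by
Cauchy–Schwarz and the lower bound on the mass of `I`, so moment bounds carry over. -/
lemma condStat_eq_centredStat_sub (hK : 0 < K) (hsub : SubGaussianStat G θ K)
    (ha : a ∈ admissible G) (ha1 : ‖a‖ ≤ 1) (hI0 : ∀ x, 0 ≤ I x) (hI1 : ∀ x, I x ≤ 1)
    (hp₀ : 0 < p₀) (hI : p₀ ≤ isingExp θ I) :
    ∃ d : ℝ, d ^ 2 ≤ 2 * K ^ 2 / p₀ ∧ ∀ x, condStat θ I x a = centredStat θ a x - d := by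
  have hIpos : 0 < isingExp θ I := hp₀.trans_le hI
  refine ⟨isingExp θ (fun x => I x * centredStat θ a x) / isingExp θ I, ?_, fun x => ?_⟩
  · have h2 := isingExp_centredStat_pow_le hK hsub ha ha1 1
    have hc := Finset.sum_sq_le_sum_mul_sum_of_sq_le_mul Finset.univ
      (r := fun x => isingProb θ x * (I x * centredStat θ a x))
      (f := fun x => isingProb θ x * I x)
      (g := fun x => isingProb θ x * centredStat θ a x ^ 2)
      (fun x _ => mul_nonneg (isingProb_nonneg θ x) (hI0 x))
      (fun x _ => mul_nonneg (isingProb_nonneg θ x) (sq_nonneg _)) (fun x _ => by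
        have := mul_nonneg (mul_nonneg (sq_nonneg (isingProb θ x)) (sq_nonneg (centredStat θ a x)))
          (mul_nonneg (hI0 x) (sub_nonneg.2 (hI1 x)))
        nlinarith)
    change isingExp θ _ ^ 2 ≤ isingExp θ I * isingExp θ (fun x => centredStat θ a x ^ 2) at hc
    norm_num at h2
    have h0 := isingExp_nonneg θ (f := fun x => centredStat θ a x ^ 2) fun x => sq_nonneg _
    rw [div_pow, div_le_div_iff₀ (by positivity) hp₀]
    calc _ ≤ (isingExp θ I * (2 * K ^ 2)) * isingExp θ I := by
          refine mul_le_mul (hc.trans (mul_le_mul_of_nonneg_left h2 hIpos.le)) hI hp₀.le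
            (by positivity)
      _ = _ := by ring
  · have e : isingExp θ (fun x => I x * centredStat θ a x) =
        isingExp θ (fun y => I y * ⟪a, suffStat y⟫) -
          isingExp θ (fun y => ⟪a, suffStat y⟫) * isingExp θ I := by
      unfold centredStat
      simp only [mul_sub]
      rw [isingExp_sub]
      simp only [mul_comm (I _) (isingExp θ _)]
      rw [isingExp_const_mul]
    rw [condStat_apply, e, sub_div, mul_div_cancel_right₀ _ hIpos.ne']
    unfold centredStat; ring

lemma isingExp_mul_condStat_moments (hK : 0 < K) (hsub : SubGaussianStat G θ K)
    (ha : a ∈ admissible G) (ha1 : ‖a‖ ≤ 1) (hI0 : ∀ x, 0 ≤ I x) (hI1 : ∀ x, I x ≤ 1)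
    (hp₀ : 0 < p₀) (hI : p₀ ≤ isingExp θ I) :
    isingExp θ (fun x => I x * condStat θ I x a ^ 2) ≤ 4 * K ^ 2 + 2 * (2 * K ^ 2 / p₀) ∧
    isingExp θ (fun x => I x * condStat θ I x a ^ 4) ≤
      128 * K ^ 4 + 8 * (2 * K ^ 2 / p₀) ^ 2 := by
  obtain ⟨d, hd, hc⟩ := condStat_eq_centredStat_sub hK hsub ha ha1 hI0 hI1 hp₀ hI
  have h2 := isingExp_centredStat_pow_le hK hsub ha ha1 1
  have h4 := isingExp_centredStat_pow_le hK hsub ha ha1 2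
  norm_num at h2 h4
  simp only [hc]
  constructor
  · calc _ ≤ isingExp θ (fun x => 2 * centredStat θ a x ^ 2 + 2 * d ^ 2) := by
          refine isingExp_mono θ fun x => ?_
          refine (mul_le_of_le_one_left (sq_nonneg _) (hI1 x)).trans ?_
          nlinarith [sq_nonneg (centredStat θ a x + d)]
      _ ≤ _ := by
          rw [isingExp_add, isingExp_const_mul, isingExp_const]; linarith
  · have hd4 : d ^ 4 ≤ (2 * K ^ 2 / p₀) ^ 2 := by
      calc d ^ 4 = (d ^ 2) ^ 2 := by ring
        _ ≤ _ := by gcongr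
    calc _ ≤ isingExp θ (fun x => 8 * centredStat θ a x ^ 4 + 8 * d ^ 4) := by
          refine isingExp_mono θ fun x => ?_
          refine (mul_le_of_le_one_left (by positivity) (hI1 x)).trans ?_
          set y := centredStat θ a x
          have h1 : (y - d) ^ 2 ≤ 2 * y ^ 2 + 2 * d ^ 2 := by nlinarith [sq_nonneg (y + d)]
          calc (y - d) ^ 4 = ((y - d) ^ 2) ^ 2 := by ring
            _ ≤ (2 * y ^ 2 + 2 * d ^ 2) ^ 2 := by gcongr
            _ ≤ _ := by nlinarith [sq_nonneg (y ^ 2 - d ^ 2)]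
      _ ≤ _ := by
          rw [isingExp_add, isingExp_const_mul, isingExp_const]
          have e : (2 * K ^ 2 * 2) ^ 2 = 16 * K ^ 4 := by ring
          linarith

/-- A point at which all net averages are controlled has controlled truncated averages on the
convex hull of the net, by Maurey's empirical method. -/
lemma le_clip_average_of_net {n k : ℕ} (hn : 0 < n) (hk : 0 < k) (x : Fin n → Config p)
    {A : Finset (Param p)} {M ξ L κ D₁ D₂ : ℝ}
    (hI0 : ∀ x, 0 ≤ I x) (hI1 : ∀ x, I x ≤ 1)
    (hemp : ∀ a ∈ A, (1 / (n : ℝ)) * ∑ i, I (x i) * condStat θ I (x i) a ^ 2 ≤ D₁)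
    (hpop : ∀ a ∈ A, isingExp θ (fun y => I y * condStat θ I y a ^ 2) ≤ D₂)
    (hclip : ∀ f : Fin k → Param p, (∀ i, f i ∈ A) →
      isingExp θ (fun y => I y * clip M (condStat θ I y ((2 * L / k) • ∑ i, f i))) - ξ ≤
        (1 / (n : ℝ)) * ∑ i, I (x i) * clip M (condStat θ I (x i) ((2 * L / k) • ∑ i, f i)))
    (hξ : 0 ≤ ξ) (hkξ : 16 * L ^ 2 * (D₁ + D₂) ≤ ξ ^ 2 * k)
    {v : Param p} (hv : v ∈ convexHull ℝ (A : Set (Param p)))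
    (hκ : κ ≤ isingExp θ (fun y => I y * clip M (condStat θ I y ((2 * L) • v)))) :
    κ - 3 * ξ ≤ (1 / (n : ℝ)) * ∑ i, I (x i) * clip M (condStat θ I (x i) ((2 * L) • v)) := by
  have hn0 : (0 : ℝ) < n := by exact_mod_cast hn
  have hk0 : (0 : ℝ) < k := by exact_mod_cast hk
  have hw1 : ∀ i : Fin n, 0 ≤ 1 / (n : ℝ) * I (x i) := fun i => mul_nonneg (by positivity) (hI0 _)
  have hw2 : ∀ y, 0 ≤ isingProb θ y * I y := fun y => mul_nonneg (isingProb_nonneg θ y) (hI0 y)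
  have hs1 : ∑ i : Fin n, 1 / (n : ℝ) * I (x i) ≤ 1 := by
    calc ∑ i : Fin n, 1 / (n : ℝ) * I (x i) ≤ ∑ _i : Fin n, 1 / (n : ℝ) * 1 := by
          gcongr; exact hI1 _
      _ = 1 := by simp [hn0.ne']
  have hs2 : ∑ y, isingProb θ y * I y ≤ 1 := by
    rw [← sum_isingProb θ]
    exact Finset.sum_le_sum fun y _ => mul_le_of_le_one_right (isingProb_nonneg θ y) (hI1 y)
  have e1 : ∀ g : Fin n → ℝ, 1 / (n : ℝ) * ∑ i, I (x i) * g i = ∑ i, 1 / (n : ℝ) * I (x i) * g i :=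
    fun g => by rw [Finset.mul_sum]; exact Finset.sum_congr rfl fun i _ => by ring
  have e2 : ∀ g : Config p → ℝ, isingExp θ (fun y => I y * g y) = ∑ y, isingProb θ y * I y * g y :=
    fun g => Finset.sum_congr rfl fun y _ => by ring
  -- The index set joins the sample points and the whole configuration space, so one average of net
  -- points approximates `v` in the empirical and the population mean square at once. The final loss
  -- `3ξ` consists of these two approximation errors and one deviation.
  obtain ⟨f, hfA, hf⟩ := exists_sum_near_smul (J := Fin n ⊕ Config p)
    (c := Sum.elim (fun i => 1 / (n : ℝ) * I (x i)) (fun y => isingProb θ y * I y))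
    (by rintro (i | y); exacts [hw1 i, hw2 y])
    (Sum.elim (fun i => condStat θ I (x i)) (condStat θ I)) hv (D := D₁ + D₂) (by
      intro a ha
      rw [Fintype.sum_sum_type]
      simp only [Sum.elim_inl, Sum.elim_inr]
      rw [← e1, ← e2]
      exact add_le_add (hemp a ha) (hpop a ha)) k
  rw [Fintype.sum_sum_type] at hf
  simp only [Sum.elim_inl, Sum.elim_inr] at hf
  set u := (2 * L / k) • ∑ i, f i with hu
  have hdiff : u - (2 * L) • v = (2 * L / k) • (∑ i, f i - (k : ℝ) • v) := by
    rw [smul_sub, smul_smul, div_mul_cancel₀ _ hk0.ne']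
  have hQ : ∑ i, 1 / (n : ℝ) * I (x i) * condStat θ I (x i) (u - (2 * L) • v) ^ 2 +
      ∑ y, isingProb θ y * I y * condStat θ I y (u - (2 * L) • v) ^ 2 ≤ ξ ^ 2 := by
    have := mul_le_mul_of_nonneg_left hf (sq_nonneg (2 * L / k))
    rw [mul_add, Finset.mul_sum, Finset.mul_sum] at this
    simp only [hdiff, map_smul, smul_eq_mul, mul_pow (2 * L / k : ℝ)]
    calc _ = _ := by
          congr 1 <;> exact Finset.sum_congr rfl fun _ _ => mul_left_comm _ _ _
      _ ≤ _ := this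
      _ = 16 * L ^ 2 * (D₁ + D₂) / k := by field_simp; ring
      _ ≤ ξ ^ 2 := by rwa [div_le_iff₀ hk0]
  have hA : ∀ {J : Type} [Fintype J] (w : J → ℝ) (l : J → Param p →ₗ[ℝ] ℝ), (∀ j, 0 ≤ w j) →
      ∑ j, w j ≤ 1 → ∑ j, w j * l j (u - (2 * L) • v) ^ 2 ≤ ξ ^ 2 →
      |∑ j, w j * clip M (l j u) - ∑ j, w j * clip M (l j ((2 * L) • v))| ≤ ξ := by
    intro J _ w l hw hw1 hle
    have h1 : |∑ j, w j * clip M (l j u) - ∑ j, w j * clip M (l j ((2 * L) • v))| ≤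
        ∑ j, w j * |l j (u - (2 * L) • v)| := by
      rw [← Finset.sum_sub_distrib]
      refine (Finset.abs_sum_le_sum_abs _ _).trans (Finset.sum_le_sum fun j _ => ?_)
      rw [← mul_sub, abs_mul, abs_of_nonneg (hw j), map_sub]
      exact mul_le_mul_of_nonneg_left (abs_clip_sub_clip_le _ _ _) (hw j)
    refine h1.trans (abs_le_of_sq_le_sq' ?_ hξ).2
    refine (sq_sum_le_sum_sq hw hw1 _).trans ?_
    simpa only [sq_abs] using hle
  have hq1 : 0 ≤ ∑ i, 1 / (n : ℝ) * I (x i) * condStat θ I (x i) (u - (2 * L) • v) ^ 2 :=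
    Finset.sum_nonneg fun i _ => mul_nonneg (hw1 i) (sq_nonneg _)
  have hq2 : 0 ≤ ∑ y, isingProb θ y * I y * condStat θ I y (u - (2 * L) • v) ^ 2 :=
    Finset.sum_nonneg fun y _ => mul_nonneg (hw2 y) (sq_nonneg _)
  have hd1 := hA _ (fun i => condStat θ I (x i)) hw1 hs1 (by linarith)
  have hd2 := hA _ (condStat θ I) hw2 hs2 (by linarith)
  have hcl := hclip f hfA
  rw [← hu] at hcl
  rw [e1, e2] at hcl
  rw [e2] at hκ
  rw [e1]
  rw [abs_le] at hd1 hd2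
  linarith [hd1.1, hd1.2, hd2.1, hd2.2]

open Classical in
/-- The indicator of `r(x | δ) > η₀`. -/
noncomputable def ratioInd (η₀ : ℝ) (θ δ : Param p) (x : Config p) : ℝ :=
  if η₀ < densityRatio θ δ x then 1 else 0

lemma ratioInd_nonneg (η₀ : ℝ) (θ δ : Param p) (x : Config p) : 0 ≤ ratioInd η₀ θ δ x := by
  unfold ratioInd; split_ifs <;> norm_num

lemma ratioInd_le_one (η₀ : ℝ) (θ δ : Param p) (x : Config p) : ratioInd η₀ θ δ x ≤ 1 := by
  unfold ratioInd; split_ifs <;> norm_num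

variable {β η₀ ρ : ℝ} {δ : Param p}

lemma NondegenerateStat.le_isingExp (hnd : NondegenerateStat G θ δ β η₀ ρ) {u : Param p}
    (hu : u ∈ errorCone G δ β) (b : ℝ) :
    ρ * ‖u‖ ^ 2 ≤ isingExp θ (fun x => ratioInd η₀ θ δ x * (⟪u, suffStat x⟫ - b) ^ 2) := by
  refine (hnd u hu b).trans (le_of_eq ?_)
  congr 1; funext x
  unfold ratioInd
  split_ifs <;> simp

/-- Nondegeneracy in the unit direction of `-δ` gives `ρ ≤ E[I Y²]`, and Cauchy–Schwarz gives `(E[I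
Y²])² ≤ E[I] E[Y⁴]`. A unit direction requires `δ ≠ 0`. -/
lemma le_isingExp_ratioInd (hβ : 1 < β) (hK : 0 < K) (hρ : 0 < ρ) (hδ : δ ∈ admissible G)
    (hδ0 : δ ≠ 0) (hsub : SubGaussianStat G θ K) (hnd : NondegenerateStat G θ δ β η₀ ρ) :
    ρ ^ 2 / (16 * K ^ 4) ≤ isingExp θ (ratioInd η₀ θ δ) := by
  set u : Param p := ‖δ‖⁻¹ • (-δ)
  have hu : u ∈ errorCone G δ β :=
    smul_mem_errorCone (errorSet_subset_errorCone (neg_mem_errorSet hβ hδ)) (by positivity)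
  have hu1 : ‖u‖ = 1 := by
    rw [norm_smul, norm_neg, norm_inv, norm_norm, inv_mul_cancel₀ (norm_ne_zero_iff.2 hδ0)]
  have h1 := hnd.le_isingExp hu (isingExp θ (fun y => ⟪u, suffStat y⟫))
  rw [hu1, one_pow, mul_one] at h1
  change ρ ≤ isingExp θ (fun x => ratioInd η₀ θ δ x * centredStat θ u x ^ 2) at h1
  have h4 := isingExp_centredStat_pow_le hK hsub (errorCone_subset_admissible hu) hu1.le 2
  norm_num at h4
  have hc := sq_sum_sq_le (w := fun x => isingProb θ x * ratioInd η₀ θ δ x)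
    (fun x => mul_nonneg (isingProb_nonneg θ x) (ratioInd_nonneg _ _ _ x)) (centredStat θ u)
  have h5 : ∑ x, isingProb θ x * ratioInd η₀ θ δ x * centredStat θ u x ^ 4 ≤ 16 * K ^ 4 := by
    calc _ ≤ isingExp θ (fun x => centredStat θ u x ^ 4) := by
          refine Finset.sum_le_sum fun x _ => ?_
          rw [mul_assoc]
          exact mul_le_mul_of_nonneg_left (mul_le_of_le_one_left (by positivity)
            (ratioInd_le_one _ _ _ x)) (isingProb_nonneg θ x)
      _ ≤ _ := h4.trans (le_of_eq (by ring))
  have h6 : isingExp θ (fun x => ratioInd η₀ θ δ x * centredStat θ u x ^ 2) =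
      ∑ x, isingProb θ x * ratioInd η₀ θ δ x * centredStat θ u x ^ 2 :=
    Finset.sum_congr rfl fun x _ => by ring
  rw [div_le_iff₀ (by positivity)]
  rw [h6] at h1
  calc ρ ^ 2 ≤ (∑ x, isingProb θ x * ratioInd η₀ θ δ x * centredStat θ u x ^ 2) ^ 2 := by gcongr
    _ ≤ _ := hc
    _ ≤ _ := mul_le_mul_of_nonneg_left h5 (isingExp_nonneg θ (ratioInd_nonneg _ _ _))

lemma exists_le_isingExp_clip (K ρ : ℝ) (hK : 0 < K) (hρ : 0 < ρ) :
    ∃ M κ : ℝ, 0 < M ∧ 0 < κ ∧ ∀ {p N : ℕ} {G : Fin N → Finset (Fin p × Fin p)}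
      {θ : Param p} {I : Config p → ℝ} {u : Param p}, SubGaussianStat G θ K →
      (∀ x, 0 ≤ I x) → (∀ x, I x ≤ 1) → ρ ^ 2 / (16 * K ^ 4) ≤ isingExp θ I →
      u ∈ admissible G → ‖u‖ ≤ 1 → ρ ≤ isingExp θ (fun x => I x * condStat θ I x u ^ 2) →
      κ ≤ isingExp θ (fun x => I x * clip M (condStat θ I x u)) := by
  set p₀ := ρ ^ 2 / (16 * K ^ 4)
  have hp₀ : 0 < p₀ := by positivity
  set V₂ := 4 * K ^ 2 + 2 * (2 * K ^ 2 / p₀)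
  set V₄ := 128 * K ^ 4 + 8 * (2 * K ^ 2 / p₀) ^ 2
  have hV₂ : 0 < V₂ := by positivity
  have hV₄ : 0 < V₄ := by positivity
  set h := ρ / (2 * Real.sqrt (2 * V₄ / ρ))
  have hh : 0 < h := by positivity
  refine ⟨V₂ / h, h / 4, by positivity, by positivity, ?_⟩
  intro p N G θ I u hsub hI0 hI1 hI hu hu1 hρu
  obtain ⟨hm2, hm4⟩ := isingExp_mul_condStat_moments hK hsub hu hu1 hI0 hI1 hp₀ hI
  have hw : ∀ x, 0 ≤ isingProb θ x * I x := fun x => mul_nonneg (isingProb_nonneg θ x) (hI0 x)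
  have e : ∀ g : Config p → ℝ, isingExp θ (fun y => I y * g y) = ∑ y, isingProb θ y * I y * g y :=
    fun g => Finset.sum_congr rfl fun y _ => by ring
  have h0 := isingExp_mul_condStat θ (hp₀.trans_le hI).ne' u
  rw [e] at hm2 hm4 hρu h0 ⊢
  exact le_sum_clip hw hh hV₂ h0 (le_sum_abs hw hρ hV₄ hρu hm4) hm2

end Conditional

end DirectChange

namespace DirectChange

/-! ### Uniform restricted lower bound for truncated averages. -/

section RestrictedCurvature

lemma measureReal_biUnion_le_card_mul {Ω ι : Type*} [MeasurableSpace Ω] {P : Measure Ω}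
    [IsProbabilityMeasure P] (B : Finset ι) (E : ι → Set Ω) {q : ℝ}
    (h : ∀ b ∈ B, P.real (E b) ≤ q) : P.real (⋃ b ∈ B, E b) ≤ B.card * q := by
  refine (measureReal_biUnion_finset_le B E).trans ?_
  rw [← nsmul_eq_mul]
  exact Finset.sum_le_card_nsmul _ _ _ h

lemma card_le_exp_of_le {N m c : ℕ} (hN : 0 < N) (h : c ≤ N * 5 ^ m) :
    (c : ℝ) ≤ Real.exp (2 * ((m : ℝ) + Real.log N)) := by
  have hN0 : (0 : ℝ) < N := by exact_mod_cast hN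
  have hlog : 0 ≤ Real.log N := Real.log_natCast_nonneg N
  have h5 : (5 : ℝ) ≤ Real.exp 2 := by
    have h1 := Real.exp_one_gt_d9
    have e : Real.exp 2 = Real.exp 1 ^ 2 := by rw [← Real.exp_nat_mul]; norm_num
    rw [e]; nlinarith
  calc (c : ℝ) ≤ N * 5 ^ m := by exact_mod_cast h
    _ ≤ Real.exp (Real.log N) * Real.exp 2 ^ m := by rw [Real.exp_log hN0]; gcongr
    _ = Real.exp (Real.log N + m * 2) := by rw [Real.exp_add, Real.exp_nat_mul]
    _ ≤ _ := Real.exp_le_exp.2 (by linarith)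

variable {p N : ℕ} {G : Fin N → Finset (Fin p × Fin p)} {S : Finset (Fin N)} {δ : Param p}

lemma card_pos_of_ne_zero (hδ : δ ∈ admissible G)
    (hδS : ∀ g, g ∉ S → ∀ e ∈ G g, δ e = 0) (hδ0 : δ ≠ 0) : 0 < S.card := by
  rw [Finset.card_pos]
  by_contra hS
  rw [Finset.not_nonempty_iff_eq_empty] at hS
  refine hδ0 ?_
  ext e
  by_cases h : ∃ g, e ∈ G g
  · obtain ⟨g, hg⟩ := h
    exact hδS g (by simp [hS]) e hg
  · push Not at h
    exact hδ.2.2 e.1 e.2 h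

lemma eq_zero_of_groups_trivial {u : Param p} (hu : u ∈ admissible G)
    (h : N = 0 ∨ maxGroupSize G = 0) : u = 0 := by
  ext e
  refine hu.2.2 e.1 e.2 fun g hg => ?_
  rcases h with h | h
  · subst h; exact g.elim0
  · have h1 := Finset.le_sup (f := fun g => (G g).card) (Finset.mem_univ g)
    have h2 : 0 < (G g).card := Finset.card_pos.2 ⟨e, hg⟩
    have h3 : (G g).card ≤ maxGroupSize G := h1
    omega

set_option maxHeartbeats 1600000 in
-- Two families of events are excluded: a large empirical second moment at a net point, and a
-- downward deviation of the clipped average at a scaled sum of `k` net points. Maurey's method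
-- extends the bound to the whole cone.
theorem exists_restricted_lower_bound (β K ρ η₀ : ℝ) (hβ : 1 < β) (hK : 0 < K) (hρ : 0 < ρ) :
    ∃ c κ M c₀ : ℝ, 0 < c ∧ 0 < κ ∧ 0 < M ∧ 0 < c₀ ∧
      ∀ {p N : ℕ} {G : Fin N → Finset (Fin p × Fin p)}, IsGroupSystem G →
      ∀ {S : Finset (Fin N)} {θ δ : Param p}, δ ∈ admissible G → δ ≠ 0 →
        (∀ g, g ∉ S → ∀ e ∈ G g, δ e = 0) → SubGaussianStat G θ K →
        NondegenerateStat G θ δ β η₀ ρ →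
      ∀ {n : ℕ}, 0 < n →
        c * ((S.card : ℝ) * ((maxGroupSize G : ℝ) + Real.log N)) ≤ (n : ℝ) →
      ∀ {Ω : Type*} [MeasurableSpace Ω] {P : Measure Ω} [IsProbabilityMeasure P]
        {X : Fin n → Ω → Config p}, (∀ i, HasLaw (X i) (isingMeasure θ) P) → iIndepFun X P →
      ∃ bad : Set Ω, P.real bad ≤ 2 * Real.exp (-(c₀ * n)) ∧ ∀ ω, ω ∉ bad →
        ∀ u ∈ errorCone G δ β, ‖u‖ = 1 → ∀ a : ℝ,
          κ ≤ (1 / (n : ℝ)) * ∑ i, ratioInd η₀ θ δ (X i ω) *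
            min |⟪u, suffStat (X i ω)⟫ - a| M := by
  classical
  obtain ⟨M, κ₃, hM, hκ₃, hclip⟩ := exists_le_isingExp_clip K ρ hK hρ
  set p₀ := ρ ^ 2 / (16 * K ^ 4)
  have hp₀ : 0 < p₀ := by positivity
  set D₀ := 2 * K ^ 2 / p₀
  set V₂ := 4 * K ^ 2 + 2 * D₀
  have hr := expSqRate_pos hK
  set r := 96 * expSqRate K with hr_def
  have hrpos : 0 < r := by positivity
  set D₁ := 2 * (4 / r) + 2 * D₀
  have hD : 0 < D₁ + V₂ := by positivity
  set ξ := κ₃ / 6 with hξ_def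
  have hξ : 0 < ξ := by positivity
  set Cβ := 2 * β / (β - 1)
  -- The Maurey length `k = k₀|S|` must beat `L² = Cβ²|S|`; the factors `|S|` cancel, so `k₀`
  -- depends on the given constants only.
  obtain ⟨κ₀, hκ₀⟩ := exists_nat_ge (16 * Cβ ^ 2 * (D₁ + V₂) / ξ ^ 2)
  set k₀ := κ₀ + 1
  have hk₀ : 16 * Cβ ^ 2 * (D₁ + V₂) ≤ ξ ^ 2 * k₀ := by
    rw [div_le_iff₀ (by positivity)] at hκ₀
    push_cast [k₀]
    nlinarith [sq_nonneg ξ]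
  have hk₀pos : (0 : ℝ) < k₀ := by positivity
  set b := ξ ^ 2 / (2 * M ^ 2) with hb_def
  have hb : 0 < b := by positivity
  -- The summand `1` pays for the `e^{2Λ}` net points against `e^{-3n}`. The summand `4k₀/b` pays
  -- for the `e^{2k₀|S|Λ}` tuples against `e^{-nb}` and leaves `e^{-nb/2}`.
  refine ⟨1 + 4 * k₀ / b, κ₃ / 2, M, min 1 (b / 2), by positivity, by positivity, hM,
    by positivity, ?_⟩
  intro p N G hG S θ δ hδ hδ0 hδS hsub hnd n hn hcn Ω _ P _ X hX hind
  have hs := card_pos_of_ne_zero hδ hδS hδ0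
  have hN : 0 < N := by
    by_contra h
    exact hδ0 (eq_zero_of_groups_trivial hδ (Or.inl (by omega)))
  have hs1 : (1 : ℝ) ≤ S.card := by exact_mod_cast hs
  have hn0 : (0 : ℝ) < n := by exact_mod_cast hn
  set Λ := (maxGroupSize G : ℝ) + Real.log N with hΛ_def
  have hΛ : 0 ≤ Λ := add_nonneg (Nat.cast_nonneg _) (Real.log_natCast_nonneg N)
  have hsΛ : Λ ≤ S.card * Λ := by nlinarith
  have hsΛ0 : 0 ≤ S.card * Λ := by positivity
  have hn1 : S.card * Λ ≤ n := by
    have : 0 ≤ 4 * k₀ / b * (S.card * Λ) := by positivity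
    linarith
  have hn2 : 4 * k₀ * (S.card * Λ) ≤ b * n := by
    have : 4 * k₀ / b * (S.card * Λ) ≤ n := by linarith
    rw [div_mul_eq_mul_div, div_le_iff₀ hb] at this
    linarith
  obtain ⟨A, hAcard, hA, hnet⟩ := exists_admissible_net hG hN
  have hAexp := card_le_exp_of_le hN hAcard
  rw [← hΛ_def] at hAexp
  set I := ratioInd η₀ θ δ with hI_def
  have hI0 := ratioInd_nonneg η₀ θ δ
  have hI1 := ratioInd_le_one η₀ θ δ
  have hI := le_isingExp_ratioInd hβ hK hρ hδ hδ0 hsub hnd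
  set L := Cβ * Real.sqrt S.card with hL_def
  set k := k₀ * S.card with hk_def
  have hk : 0 < k := by positivity
  let U : (Fin k → Param p) → Param p := fun f => (2 * L / k) • ∑ i, f i
  let m : (Fin k → Param p) → ℝ := fun f => isingExp θ (fun y => I y * clip M (condStat θ I y (U f)))
  let E₁ : Param p → Set Ω := fun a => {ω | n * (4 / r) ≤ ∑ i, centredStat θ a (X i ω) ^ 2}
  let E₂ : (Fin k → Param p) → Set Ω := fun f =>
    {ω | n * ξ ≤ ∑ i, (m f - I (X i ω) * clip M (condStat θ I (X i ω) (U f)))}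
  have hE₁ : ∀ a ∈ A, P.real (E₁ a) ≤ Real.exp (-(3 * n)) := by
    intro a ha
    have h := prob_le_sum_le hX hind (fun x => centredStat θ a x ^ 2) hrpos.le (4 / r)
    refine h.trans ?_
    have e3 : Real.exp (-(3 * (n : ℝ))) = Real.exp (-3) ^ n := by
      rw [← Real.exp_nat_mul]; congr 1; ring
    rw [e3]
    refine pow_le_pow_left₀ (mul_nonneg (Real.exp_pos _).le
      (isingExp_nonneg _ fun _ => (Real.exp_pos _).le)) ?_ n
    have h2 := isingExp_exp_centredStat_sq_le hK hsub (hA a ha).1 (hA a ha).2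
    calc _ ≤ Real.exp (-(r * (4 / r))) * 2 := mul_le_mul_of_nonneg_left h2 (Real.exp_pos _).le
      _ ≤ Real.exp (-4) * Real.exp 1 := by
          rw [mul_div_cancel₀ _ hrpos.ne']
          have := Real.add_one_le_exp 1
          exact mul_le_mul_of_nonneg_left (by linarith) (Real.exp_pos _).le
      _ = Real.exp (-3) := by rw [← Real.exp_add]; norm_num
  have hE₂ : ∀ f ∈ Fintype.piFinset (fun _ : Fin k => A), P.real (E₂ f) ≤ Real.exp (-(n * b)) := by
    intro f _
    have h := prob_le_sum_le_of_quadratic hX hind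
      (f := fun x => m f - I x * clip M (condStat θ I x (U f)))
      (A := M ^ 2 / 2) (t₀ := ξ / M ^ 2) (τ := ξ) (by positivity) (fun t ht _ => by
        exact sum_exp_neg_le (isingProb_nonneg θ) (sum_isingProb θ)
          (f := fun x => I x * clip M (condStat θ I x (U f)))
          (fun x => mul_nonneg (hI0 x) (clip_nonneg hM.le _))
          (fun x => (mul_le_of_le_one_left (clip_nonneg hM.le _) (hI1 x)).trans (clip_le _ _)) ht)
      hξ.le (by field_simp; rfl)
    refine h.trans (le_of_eq ?_)
    rw [hb_def]; congr 3; ring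
  refine ⟨(⋃ a ∈ A, E₁ a) ∪ ⋃ f ∈ Fintype.piFinset (fun _ : Fin k => A), E₂ f, ?_, ?_⟩
  · refine (measureReal_union_le _ _).trans ?_
    have h1 := measureReal_biUnion_le_card_mul A E₁ hE₁
    have h2 := measureReal_biUnion_le_card_mul _ E₂ hE₂
    have b1 : (A.card : ℝ) * Real.exp (-(3 * n)) ≤ Real.exp (-(min 1 (b / 2) * n)) := by
      refine (mul_le_mul_of_nonneg_right hAexp (Real.exp_pos _).le).trans ?_
      rw [← Real.exp_add]
      refine Real.exp_le_exp.2 ?_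
      have : min 1 (b / 2) * n ≤ 1 * n := mul_le_mul_of_nonneg_right (min_le_left _ _) hn0.le
      linarith
    have b2 : ((Fintype.piFinset (fun _ : Fin k => A)).card : ℝ) * Real.exp (-(n * b)) ≤
        Real.exp (-(min 1 (b / 2) * n)) := by
      have hc : ((Fintype.piFinset (fun _ : Fin k => A)).card : ℝ) ≤
          Real.exp (2 * (k₀ * (S.card * Λ))) := by
        rw [Fintype.card_piFinset]
        simp only [Finset.prod_const, Finset.card_univ, Fintype.card_fin]
        push_cast
        refine (pow_le_pow_left₀ (Nat.cast_nonneg _) hAexp k).trans (le_of_eq ?_)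
        rw [← Real.exp_nat_mul, hk_def]
        congr 1; push_cast; ring
      refine (mul_le_mul_of_nonneg_right hc (Real.exp_pos _).le).trans ?_
      rw [← Real.exp_add]
      refine Real.exp_le_exp.2 ?_
      have : min 1 (b / 2) * n ≤ b / 2 * n := mul_le_mul_of_nonneg_right (min_le_right _ _) hn0.le
      linarith
    linarith
  intro ω hω u hu hu1 a
  simp only [Set.mem_union, Set.mem_iUnion, not_or, not_exists] at hω
  obtain ⟨hω₁, hω₂⟩ := hω
  have huA := errorCone_subset_admissible hu
  have huL : groupNorm G u ≤ L := by
    have := groupNorm_le_of_mem_errorCone hG hβ hδS hu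
    rwa [hu1, mul_one] at this
  have key : ∀ v ∈ admissible G, groupNorm G v ≤ L → ‖v‖ ≤ 1 →
      ρ ≤ isingExp θ (fun x => I x * condStat θ I x v ^ 2) →
      κ₃ / 2 ≤ (1 / (n : ℝ)) * ∑ i, I (X i ω) * clip M (condStat θ I (X i ω) v) := by
    intro v hv hvL hv1 hvρ
    have hpop := hclip hsub hI0 hI1 hI hv hv1 hvρ
    obtain ⟨v', hv', hvv'⟩ := hnet v hv L hvL
    rw [hvv'] at hpop ⊢
    have := le_clip_average_of_net (θ := θ) (I := I) hn hk (fun i => X i ω) (A := A) (M := M)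
      (ξ := ξ) (L := L) (κ := κ₃) (D₁ := D₁) (D₂ := V₂) hI0 hI1 ?_ ?_ ?_ hξ.le ?_ hv' hpop
    · refine le_trans (le_of_eq ?_) this
      rw [hξ_def]; ring
    · intro a ha
      obtain ⟨d, hd, hc⟩ := condStat_eq_centredStat_sub hK hsub (hA a ha).1 (hA a ha).2 hI0 hI1
        hp₀ hI
      have hlt : ∑ i, centredStat θ a (X i ω) ^ 2 < n * (4 / r) := not_le.1 (hω₁ a ha)
      rw [one_div, inv_mul_le_iff₀ hn0]
      calc ∑ i, I (X i ω) * condStat θ I (X i ω) a ^ 2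
          ≤ ∑ i : Fin n, (2 * centredStat θ a (X i ω) ^ 2 + 2 * D₀) := by
            refine Finset.sum_le_sum fun i _ => ?_
            refine (mul_le_of_le_one_left (sq_nonneg _) (hI1 _)).trans ?_
            rw [hc]
            nlinarith [sq_nonneg (centredStat θ a (X i ω) + d)]
        _ = 2 * ∑ i, centredStat θ a (X i ω) ^ 2 + n * (2 * D₀) := by
            rw [Finset.sum_add_distrib, ← Finset.mul_sum]; simp
        _ ≤ n * D₁ := by
            have : (n : ℝ) * D₁ = 2 * (n * (4 / r)) + n * (2 * D₀) := by ring
            linarith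
    · intro a ha
      exact (isingExp_mul_condStat_moments hK hsub (hA a ha).1 (hA a ha).2 hI0 hI1 hp₀ hI).1
    · intro f hf
      have hlt : ∑ i, (m f - I (X i ω) * clip M (condStat θ I (X i ω) (U f))) < n * ξ :=
        not_le.1 (hω₂ f (Fintype.mem_piFinset.2 hf))
      rw [Finset.sum_sub_distrib] at hlt
      simp only [Finset.sum_const, Finset.card_univ, Fintype.card_fin, nsmul_eq_mul] at hlt
      change m f - ξ ≤ 1 / (n : ℝ) * ∑ i, I (X i ω) * clip M (condStat θ I (X i ω) (U f))
      rw [one_div, le_inv_mul_iff₀ hn0]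
      linarith
    · rw [hL_def, mul_pow, Real.sq_sqrt (by positivity), hk_def]
      push_cast
      nlinarith
  have hndu := hnd.le_isingExp hu (isingExp θ (fun y => I y * ⟪u, suffStat y⟫) / isingExp θ I)
  rw [hu1, one_pow, mul_one] at hndu
  -- Uniformity in `a` comes for free: below the weighted mean, `|⟨u, T⟩ - a|` dominates the
  -- positive part of the centred statistic of `u`; above it, that of `-u`. Only the bound at the
  -- weighted mean was needed.
  rcases le_total a (isingExp θ (fun y => I y * ⟪u, suffStat y⟫) / isingExp θ I) with ha | ha
  · refine (key u huA huL hu1.le hndu).trans ?_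
    refine mul_le_mul_of_nonneg_left (Finset.sum_le_sum fun i _ =>
      mul_le_mul_of_nonneg_left (min_le_min_right M ?_) (hI0 _)) (by positivity)
    refine max_le ?_ (abs_nonneg _)
    rw [condStat_apply]
    exact le_trans (by linarith) (le_abs_self _)
  · refine (key (-u) ((admissibleSubmodule G).neg_mem huA) (by rwa [groupNorm_neg])
      (by rw [norm_neg, hu1]) (by simp only [map_neg, neg_sq]; exact hndu)).trans ?_
    refine mul_le_mul_of_nonneg_left (Finset.sum_le_sum fun i _ =>
      mul_le_mul_of_nonneg_left (min_le_min_right M ?_) (hI0 _)) (by positivity)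
    refine max_le ?_ (abs_nonneg _)
    rw [map_neg, condStat_apply]
    exact le_trans (by linarith) (neg_le_abs _)

end RestrictedCurvature

end DirectChange

namespace DirectChange

/-! ### Uniform bound on the gradient of the loss at the true change. -/

section Score

variable {p N n₁ n₂ : ℕ} {G : Fin N → Finset (Fin p × Fin p)}

/-- The weights of the second sample in the gradient of the loss at `δ`. -/
noncomputable def sampleWeight (θ δ : Param p) (x : Fin n₂ → Config p) (i : Fin n₂) : ℝ :=
  densityRatio θ δ (x i) / ∑ j, densityRatio θ δ (x j)

/-- The directional derivative `-⟨∇L(δ), u⟩` of the negative loss. -/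
noncomputable def score (θ δ : Param p) (x₁ : Fin n₁ → Config p) (x₂ : Fin n₂ → Config p)
    (u : Param p) : ℝ :=
  (1 / (n₁ : ℝ)) * ∑ i, ⟪u, suffStat (x₁ i)⟫ - ∑ i, sampleWeight θ δ x₂ i * ⟪u, suffStat (x₂ i)⟫

lemma sampleWeight_nonneg (θ δ : Param p) (x : Fin n₂ → Config p) (i : Fin n₂) :
    0 ≤ sampleWeight θ δ x i :=
  div_nonneg (densityRatio_pos _ _ _).le (Finset.sum_nonneg fun _ _ => (densityRatio_pos _ _ _).le)

lemma sum_densityRatio_pos (hn : 0 < n₂) (θ δ : Param p) (x : Fin n₂ → Config p) :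
    0 < ∑ j, densityRatio θ δ (x j) :=
  Finset.sum_pos (fun _ _ => densityRatio_pos _ _ _) ⟨⟨0, hn⟩, Finset.mem_univ _⟩

lemma sum_sampleWeight (hn : 0 < n₂) (θ δ : Param p) (x : Fin n₂ → Config p) :
    ∑ i, sampleWeight θ δ x i = 1 := by
  unfold sampleWeight
  rw [← Finset.sum_div]
  exact div_self (sum_densityRatio_pos hn θ δ x).ne'

lemma isLinearMap_score (θ δ : Param p) (x₁ : Fin n₁ → Config p) (x₂ : Fin n₂ → Config p) :
    IsLinearMap ℝ (score θ δ x₁ x₂) := by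
  constructor
  · intro u v
    simp only [score, inner_add_left, mul_add, Finset.sum_add_distrib]; ring
  · intro a u
    simp only [score, real_inner_smul_left, mul_left_comm _ a, ← Finset.mul_sum, smul_eq_mul]
    ring

/-- The weights sum to one, so any common centring cancels. Centring at the `θ₁`-mean makes both
sums mean-zero when `δ = θ₁ - θ₂`. -/
lemma score_eq_centred (hn₁ : 0 < n₁) (hn₂ : 0 < n₂) (θ δ θ' : Param p) (x₁ : Fin n₁ → Config p)
    (x₂ : Fin n₂ → Config p) (u : Param p) :
    score θ δ x₁ x₂ u = (1 / (n₁ : ℝ)) * ∑ i, centredStat θ' u (x₁ i) +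
      (∑ i, -(densityRatio θ δ (x₂ i) * centredStat θ' u (x₂ i))) /
        ∑ j, densityRatio θ δ (x₂ j) := by
  have hn : (n₁ : ℝ) ≠ 0 := by positivity
  have h1 := sum_sampleWeight hn₂ θ δ x₂
  have e : (∑ i, -(densityRatio θ δ (x₂ i) * centredStat θ' u (x₂ i))) /
        ∑ j, densityRatio θ δ (x₂ j) = -∑ i, sampleWeight θ δ x₂ i * centredStat θ' u (x₂ i) := by
    rw [Finset.sum_neg_distrib, neg_div, Finset.sum_div]
    congr 1
    exact Finset.sum_congr rfl fun i _ => by unfold sampleWeight; ring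
  rw [e, score]
  simp only [centredStat, mul_sub, Finset.sum_sub_distrib, ← Finset.sum_mul, h1]
  simp only [Finset.sum_const, Finset.card_univ, Fintype.card_fin, nsmul_eq_mul]
  field_simp
  ring

lemma score_le_of_net {A : Finset (Param p)} {θ δ : Param p} {x₁ : Fin n₁ → Config p}
    {x₂ : Fin n₂ → Config p} {τ : ℝ}
    (hnet : ∀ u ∈ admissible G, ∀ L : ℝ, groupNorm G u ≤ L →
        ∃ v ∈ convexHull ℝ (A : Set (Param p)), u = (2 * L) • v)
    (hA : ∀ a ∈ A, score θ δ x₁ x₂ a ≤ τ / 2) {u : Param p} (hu : u ∈ admissible G) :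
    score θ δ x₁ x₂ u ≤ τ * groupNorm G u := by
  obtain ⟨v, hv, huv⟩ := hnet u hu _ le_rfl
  have hlin := isLinearMap_score θ δ x₁ x₂
  have hv' : score θ δ x₁ x₂ v ≤ τ / 2 := convexHull_min hA (convex_halfSpace_le hlin _) hv
  have h0 := groupNorm_nonneg (G := G) u
  have e : score θ δ x₁ x₂ u = 2 * groupNorm G u * score θ δ x₁ x₂ v := by
    conv_lhs => rw [huv]
    rw [hlin.map_smul, smul_eq_mul]
  rw [e]
  nlinarith

lemma exp_net_tail_le {Λ q ε s : ℝ} (hΛ : 1 ≤ Λ) (hε : 0 ≤ ε) (hs : s ≤ Real.exp (2 * Λ))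
    (hq : 3 * ((1 + ε) ^ 2 * Λ) ≤ q) : s * Real.exp (-q) ≤ Real.exp (-ε ^ 2) := by
  refine (mul_le_mul_of_nonneg_right hs (Real.exp_pos _).le).trans ?_
  rw [← Real.exp_add]
  refine Real.exp_le_exp.2 ?_
  have h1 : (1 + ε ^ 2) * Λ ≤ (1 + ε) ^ 2 * Λ := by
    refine mul_le_mul_of_nonneg_right ?_ (by linarith); nlinarith
  nlinarith [mul_nonneg (sq_nonneg ε) (sub_nonneg.2 hΛ)]

set_option maxHeartbeats 1600000 in
theorem exists_score_bound (β K : ℝ) (hβ : 0 < β) (hK : 0 < K) :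
    ∃ c η c₀ : ℝ, 0 < c ∧ 0 < η ∧ 0 < c₀ ∧
      ∀ {p N : ℕ} {G : Fin N → Finset (Fin p × Fin p)}, IsGroupSystem G → 0 < N →
        0 < maxGroupSize G →
      ∀ {S : Finset (Fin N)} {θ₁ θ₂ : Param p}, θ₁ - θ₂ ∈ admissible G →
        (∀ g, g ∉ S → ∀ e ∈ G g, (θ₁ - θ₂) e = 0) →
        SmoothDensityRatio G θ₂ (θ₁ - θ₂) → SubGaussianStat G θ₂ K →
      ∀ {n₁ n₂ : ℕ}, 0 < n₁ → 0 < n₂ →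
        c * ((S.card : ℝ) * ((maxGroupSize G : ℝ) + Real.log N)) ≤ (n₂ : ℝ) →
      ∀ {Ω : Type*} [MeasurableSpace Ω] {P : Measure Ω} [IsProbabilityMeasure P]
        {X₁ : Fin n₁ → Ω → Config p} {X₂ : Fin n₂ → Ω → Config p},
        (∀ i, HasLaw (X₁ i) (isingMeasure θ₁) P) → iIndepFun X₁ P →
        (∀ i, HasLaw (X₂ i) (isingMeasure θ₂) P) → iIndepFun X₂ P →
      ∀ ε : ℝ, 0 ≤ ε →
      ∃ bad : Set Ω, P.real bad ≤ 2 * Real.exp (-ε ^ 2) + 3 * Real.exp (-(c₀ * n₂)) ∧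
        ∀ ω, ω ∉ bad →
          ∑ i, densityRatio θ₂ (θ₁ - θ₂) (X₂ i ω) ≤ 2 * n₂ ∧
          ∀ u ∈ admissible G,
            score θ₂ (θ₁ - θ₂) (fun i => X₁ i ω) (fun i => X₂ i ω) u ≤
              η * refLevel G n₁ n₂ ε / β * groupNorm G u := by
  classical
  have hr := expSqRate_pos hK
  set A₂ := 48 * Real.exp 1 / expSqRate K with hA₂_def
  have hA₂ : 0 < A₂ := by positivity
  have hA₁₂ : 1 / expSqRate K ≤ A₂ := by
    rw [hA₂_def]
    refine div_le_div_of_nonneg_right ?_ hr.le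
    linarith [Real.add_one_le_exp 1]
  set t₀ := Real.sqrt (expSqRate K / (16 * Real.exp 1))
  have ht₀ : 0 < t₀ := Real.sqrt_pos.2 (by positivity)
  set b := A₂ * t₀ ^ 2 with hb_def
  have hb : 0 < b := by positivity
  -- The value `12A₂` makes the Chernoff exponent `n s²/(4A₂)` at least `3(1+ε)²Λ`: of the three
  -- units of `Λ`, two pay for the net, and the rest leaves at least `ε²`.
  set η' := Real.sqrt (12 * A₂)
  have hη' : 0 < η' := Real.sqrt_pos.2 (by positivity)
  have hη'sq : η' ^ 2 = 12 * A₂ := Real.sq_sqrt (by positivity)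
  -- At each net point the score is at most `3s`, one `s` from the first sample and `2s` from the
  -- second, bounded by `4s`; the factor `2` of the net then gives `8`. The rate `1/16` is that of
  -- the deviation `1/2` of the mean ratio.
  refine ⟨4 / b, 8 * β * η', min (1 / 16) (b / 2), by positivity, by positivity, by positivity, ?_⟩
  intro p N G hG hN hm S θ₁ θ₂ hδ hδS hsm hsub n₁ n₂ hn₁ hn₂ hcn Ω _ P _ X₁ X₂ hX₁ hi₁ hX₂ hi₂ ε hε
  set Λ := (maxGroupSize G : ℝ) + Real.log N with hΛ_def
  have hΛ : 1 ≤ Λ := by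
    have h1 : (1 : ℝ) ≤ maxGroupSize G := by exact_mod_cast hm
    have h2 := Real.log_natCast_nonneg N
    linarith
  have hn₁0 : (0 : ℝ) < n₁ := by exact_mod_cast hn₁
  have hn₂0 : (0 : ℝ) < n₂ := by exact_mod_cast hn₂
  have hmin0 : (0 : ℝ) < (min n₁ n₂ : ℕ) := by exact_mod_cast lt_min hn₁ hn₂
  have hmin₁ : ((min n₁ n₂ : ℕ) : ℝ) ≤ n₁ := by exact_mod_cast min_le_left _ _
  have hmin₂ : ((min n₁ n₂ : ℕ) : ℝ) ≤ n₂ := by exact_mod_cast min_le_right _ _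
  set s := η' * refLevel G n₁ n₂ ε with hs_def
  have hs0 : 0 ≤ s := by
    rw [hs_def, refLevel]; positivity
  have hssq : s ^ 2 = 12 * A₂ * ((1 + ε) ^ 2 * (Λ / (min n₁ n₂ : ℕ))) := by
    rw [hs_def, refLevel, mul_pow, mul_pow, hη'sq, Real.sq_sqrt (by positivity)]
  have hlevel : ∀ n : ℕ, ((min n₁ n₂ : ℕ) : ℝ) ≤ n →
      3 * ((1 + ε) ^ 2 * Λ) ≤ n * (s ^ 2 / (4 * A₂)) := by
    intro n hn
    have e : s ^ 2 / (4 * A₂) = 3 * ((1 + ε) ^ 2 * Λ) / (min n₁ n₂ : ℕ) := by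
      rw [hssq]; field_simp; ring
    rw [e, mul_div_assoc', le_div_iff₀ hmin0, mul_comm]
    exact mul_le_mul_of_nonneg_right hn (by positivity)
  obtain ⟨A, hAcard, hA, hnet⟩ := exists_admissible_net hG hN
  have hAexp := card_le_exp_of_le hN hAcard
  rw [← hΛ_def] at hAexp
  let r : Config p → ℝ := densityRatio θ₂ (θ₁ - θ₂)
  let E₁ : Param p → Set Ω := fun a => {ω | n₁ * s ≤ ∑ i, centredStat θ₁ a (X₁ i ω)}
  let E₂ : Param p → Set Ω := fun a =>
    {ω | n₂ * s ≤ ∑ i, -(r (X₂ i ω) * centredStat θ₁ a (X₂ i ω))}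
  let E₃ : Set Ω := {ω | n₂ * (1 : ℝ) ≤ ∑ i, (r (X₂ i ω) - 1)}
  let E₄ : Set Ω := {ω | n₂ * (1 / 2 : ℝ) ≤ ∑ i, -(r (X₂ i ω) - 1)}
  have hE₁ : ∀ a ∈ A, P.real (E₁ a) ≤ Real.exp (-(n₁ * (s ^ 2 / (4 * A₂)))) := by
    intro a ha
    refine prob_le_sum_le_of_quadratic hX₁ hi₁ (t₀ := s / (2 * A₂)) hA₂ (fun t _ _ => ?_) hs0
      (by field_simp; rfl)
    refine (isingExp_exp_centredStat_le hK hsub (hA a ha).1 (hA a ha).2 hsm t).trans ?_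
    exact Real.exp_le_exp.2 (mul_le_mul_of_nonneg_right hA₁₂ (sq_nonneg t))
  have hE₁' : P.real (⋃ a ∈ A, E₁ a) ≤ Real.exp (-ε ^ 2) :=
    (measureReal_biUnion_le_card_mul A E₁ hE₁).trans
      (exp_net_tail_le hΛ hε hAexp (hlevel n₁ hmin₁))
  have hE₂' : P.real (⋃ a ∈ A, E₂ a) ≤
      Real.exp (-ε ^ 2) + Real.exp (-(min (1 / 16) (b / 2) * n₂)) := by
    -- A level beyond the sub-exponential range is lowered to its endpoint `2A₂t₀`. The exponent is
    -- then `n₂b`, and the sample size condition absorbs the net.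
    rcases le_or_gt s (2 * A₂ * t₀) with hst | hst
    · have h : ∀ a ∈ A, P.real (E₂ a) ≤ Real.exp (-(n₂ * (s ^ 2 / (4 * A₂)))) := fun a ha =>
        prob_le_sum_le_of_quadratic hX₂ hi₂
          (f := fun x => -(r x * centredStat θ₁ a x)) hA₂ (fun t ht htt =>
          isingExp_exp_weightedStat_le hK hsub (hA a ha).1 (hA a ha).2 hsm ht htt) hs0 hst
      refine (measureReal_biUnion_le_card_mul A E₂ h).trans
        ((exp_net_tail_le hΛ hε hAexp (hlevel n₂ hmin₂)).trans ?_)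
      linarith [Real.exp_pos (-(min (1 / 16) (b / 2) * n₂))]
    · rcases eq_or_ne (θ₁ - θ₂) 0 with hδ0 | hδ0
      · have hθ : θ₂ = θ₁ := (sub_eq_zero.1 hδ0).symm
        have h : ∀ a ∈ A, P.real (E₂ a) ≤ Real.exp (-(n₂ * (s ^ 2 / (4 * A₂)))) := fun a ha => by
          refine prob_le_sum_le_of_quadratic hX₂ hi₂ (t₀ := s / (2 * A₂))
            (f := fun x => -(r x * centredStat θ₁ a x)) hA₂ (fun t _ _ => ?_) hs0
            (by field_simp; rfl)
          have h1 := isingExp_exp_centredStat_le hK hsub (hA a ha).1 (hA a ha).2 hsm (-t)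
          simp only [r, hδ0, densityRatio_zero, one_mul]
          rw [neg_sq] at h1
          simp only [neg_mul] at h1
          simp only [mul_neg, hθ]
          exact h1.trans (Real.exp_le_exp.2 (mul_le_mul_of_nonneg_right hA₁₂ (sq_nonneg t)))
        refine (measureReal_biUnion_le_card_mul A E₂ h).trans
          ((exp_net_tail_le hΛ hε hAexp (hlevel n₂ hmin₂)).trans ?_)
        linarith [Real.exp_pos (-(min (1 / 16) (b / 2) * n₂))]
      · have hS := card_pos_of_ne_zero hδ hδS hδ0
        have hS1 : (1 : ℝ) ≤ S.card := by exact_mod_cast hS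
        have hΛn : 2 * Λ ≤ b / 2 * n₂ := by
          have h1 : Λ ≤ S.card * Λ := by nlinarith
          rw [div_mul_eq_mul_div, div_le_iff₀ hb] at hcn
          nlinarith
        have h : ∀ a ∈ A, P.real (E₂ a) ≤ Real.exp (-(n₂ * b)) := fun a ha => by
          have h1 := prob_le_sum_le_of_quadratic hX₂ hi₂ (τ := 2 * A₂ * t₀)
            (f := fun x => -(r x * centredStat θ₁ a x)) hA₂ (fun t ht htt =>
            isingExp_exp_weightedStat_le hK hsub (hA a ha).1 (hA a ha).2 hsm ht htt)
            (by positivity) le_rfl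
          refine (measureReal_mono fun ω hω => ?_).trans (h1.trans (le_of_eq ?_))
          · exact (mul_le_mul_of_nonneg_left hst.le hn₂0.le).trans hω
          · rw [hb_def]; congr 3; field_simp; norm_num
        refine (measureReal_biUnion_le_card_mul A E₂ h).trans ?_
        refine (mul_le_mul_of_nonneg_right hAexp (Real.exp_pos _).le).trans ?_
        rw [← Real.exp_add]
        have hle : 2 * Λ + -(n₂ * b) ≤ -(min (1 / 16) (b / 2) * n₂) := by
          have := mul_le_mul_of_nonneg_right (min_le_right (1 / 16) (b / 2)) hn₂0.le
          linarith
        linarith [Real.exp_le_exp.2 hle, Real.exp_pos (-ε ^ 2)]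
  have hratio : ∀ q : ℝ, 1 / 16 ≤ q →
      Real.exp (-(n₂ * q)) ≤ Real.exp (-(min (1 / 16) (b / 2) * n₂)) := fun q hq => by
    refine Real.exp_le_exp.2 ?_
    have h1 := mul_le_mul_of_nonneg_right (min_le_left (1 / 16) (b / 2)) hn₂0.le
    have h2 := mul_le_mul_of_nonneg_left hq hn₂0.le
    linarith
  have hE₃ : P.real E₃ ≤ Real.exp (-(min (1 / 16) (b / 2) * n₂)) := by
    have h := prob_le_sum_le_of_quadratic hX₂ hi₂ (f := fun x => r x - 1) (A := 1) (t₀ := 1)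
      (τ := 1) one_pos (fun t _ _ => by rw [one_mul]; exact isingExp_exp_densityRatio_le hsm t)
      zero_le_one (by norm_num)
    exact h.trans (hratio _ (by norm_num))
  have hE₄ : P.real E₄ ≤ Real.exp (-(min (1 / 16) (b / 2) * n₂)) := by
    have h := prob_le_sum_le_of_quadratic hX₂ hi₂ (f := fun x => -(r x - 1)) (A := 1) (t₀ := 1)
      (τ := 1 / 2) one_pos (fun t _ _ => by
        have := isingExp_exp_densityRatio_le hsm (-t)
        rw [one_mul]
        simpa only [mul_neg, neg_mul, neg_sq] using this)
      (by norm_num) (by norm_num)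
    exact h.trans (hratio _ (by norm_num))
  refine ⟨((⋃ a ∈ A, E₁ a) ∪ ⋃ a ∈ A, E₂ a) ∪ (E₃ ∪ E₄), ?_, ?_⟩
  · refine (measureReal_union_le _ _).trans ?_
    have h1 := measureReal_union_le (μ := P) (⋃ a ∈ A, E₁ a) (⋃ a ∈ A, E₂ a)
    have h2 := measureReal_union_le (μ := P) E₃ E₄
    linarith
  intro ω hω
  simp only [Set.mem_union, Set.mem_iUnion, not_or, not_exists] at hω
  obtain ⟨⟨hω₁, hω₂⟩, hω₃, hω₄⟩ := hω
  have hlt₃ : ∑ i, (r (X₂ i ω) - 1) < n₂ * (1 : ℝ) := not_le.1 hω₃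
  have hlt₄ : ∑ i, -(r (X₂ i ω) - 1) < n₂ * (1 / 2 : ℝ) := not_le.1 hω₄
  rw [Finset.sum_neg_distrib] at hlt₄
  rw [Finset.sum_sub_distrib] at hlt₃ hlt₄
  simp only [Finset.sum_const, Finset.card_univ, Fintype.card_fin, nsmul_eq_mul, mul_one]
    at hlt₃ hlt₄
  have hlow : (n₂ : ℝ) / 2 ≤ ∑ i, r (X₂ i ω) := by linarith
  have hpos : 0 < ∑ i, r (X₂ i ω) := by linarith
  refine ⟨by change ∑ i, r (X₂ i ω) ≤ _; linarith, fun u hu => ?_⟩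
  refine score_le_of_net hnet (fun a ha => ?_) hu
  have hlt₁ : ∑ i, centredStat θ₁ a (X₁ i ω) < n₁ * s := not_le.1 (hω₁ a ha)
  have hlt₂ : ∑ i, -(r (X₂ i ω) * centredStat θ₁ a (X₂ i ω)) < n₂ * s := not_le.1 (hω₂ a ha)
  have e : 8 * β * η' * refLevel G n₁ n₂ ε / β / 2 = 4 * s := by
    rw [hs_def]; field_simp; ring
  rw [e, score_eq_centred hn₁ hn₂ θ₂ (θ₁ - θ₂) θ₁]
  have h1 : 1 / (n₁ : ℝ) * ∑ i, centredStat θ₁ a (X₁ i ω) ≤ s := by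
    rw [one_div, inv_mul_le_iff₀ hn₁0]; exact hlt₁.le
  have h2 : (∑ i, -(r (X₂ i ω) * centredStat θ₁ a (X₂ i ω))) / ∑ i, r (X₂ i ω) ≤ 2 * s := by
    rw [div_le_iff₀ hpos]
    have := mul_le_mul_of_nonneg_left hlow hs0
    linarith
  change 1 / (n₁ : ℝ) * ∑ i, centredStat θ₁ a (X₁ i ω) +
    (∑ i, -(r (X₂ i ω) * centredStat θ₁ a (X₂ i ω))) / ∑ i, r (X₂ i ω) ≤ 4 * s
  linarith

end Score

end DirectChange

namespace DirectChange

/-! ### Growth of the log-sum-exp function. -/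

section LogSumExp

variable {α : Type*} [Fintype α] {w : α → ℝ}

lemma sq_min_le_exp_sub (y : ℝ) : 1 / 3 * min |y| 1 ^ 2 ≤ Real.exp y - 1 - y := by
  have hm : 0 ≤ min |y| 1 := le_min (abs_nonneg y) zero_le_one
  rcases le_or_gt 0 y with hy | hy
  · have h1 := Real.quadratic_le_exp_of_nonneg hy
    have h2 : min |y| 1 ^ 2 ≤ y ^ 2 := by
      rw [← sq_abs y]; exact pow_le_pow_left₀ hm (min_le_left _ _) 2
    nlinarith [sq_nonneg y]
  · rcases le_or_gt (-1) y with h | h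
    · have h1 := Real.exp_bound' (x := -y) (by linarith) (by linarith) (n := 3) (by norm_num)
      have h2 : min |y| 1 ^ 2 ≤ y ^ 2 := by
        rw [← sq_abs y]; exact pow_le_pow_left₀ hm (min_le_left _ _) 2
      norm_num [Finset.sum_range_succ, Nat.factorial] at h1
      have h3 : 1 + y + 1 / 3 * y ^ 2 ≤ Real.exp y := by
        rw [← neg_neg y, Real.exp_neg, neg_neg, ← one_div, le_div_iff₀ (Real.exp_pos _)]
        have h4 : 0 ≤ 1 + y + 1 / 3 * y ^ 2 := by nlinarith [sq_nonneg y]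
        refine (mul_le_mul_of_nonneg_left h1 h4).trans ?_
        have h5 : 0 ≤ -y ^ 3 := by have := mul_nonneg (sq_nonneg y) (by linarith : 0 ≤ -y); nlinarith
        have h6 : -y ^ 3 ≤ y ^ 2 := by nlinarith [mul_nonneg (sq_nonneg y) (by linarith : 0 ≤ y + 1)]
        have h7 : -y ^ 5 ≤ y ^ 2 := by
          have e5 : -y ^ 5 = -y ^ 3 * y ^ 2 := by ring
          rw [e5]
          nlinarith [mul_nonneg h5 (by nlinarith : 0 ≤ 1 - y ^ 2)]
        nlinarith [sq_nonneg (y ^ 2)]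
      linarith
    · have h1 : 1 / 3 * min |y| 1 ^ 2 ≤ 1 / 3 := by
        have := pow_le_pow_left₀ hm (min_le_right |y| 1) 2
        linarith
      have h2 := Real.add_one_le_exp (y + 1)
      have h3 : Real.exp y = Real.exp (y + 1) * Real.exp (-1) := by
        rw [← Real.exp_add]; congr 1; ring
      have h4 : 1 / 3 < Real.exp (-1) := by
        rw [Real.exp_neg, one_div]
        refine inv_strictAnti₀ (Real.exp_pos 1) ?_
        linarith [Real.exp_one_lt_d9]
      have h5 : Real.exp (-1) < 1 := by
        rw [Real.exp_lt_one_iff]; norm_num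
      nlinarith

/-- The mean of `e^Y - 1 - Y` is at least `q/3` by Jensen, and `log (1 + q/3) ≥ q/(3 + q) ≥ q/4`
because `q ≤ 1`. -/
lemma quarter_sq_le_log_sum_exp (hw : ∀ x, 0 ≤ w x) (hw1 : ∑ x, w x = 1) {Y : α → ℝ}
    (h0 : ∑ x, w x * Y x = 0) :
    1 / 4 * (∑ x, w x * min |Y x| 1) ^ 2 ≤ Real.log (∑ x, w x * Real.exp (Y x)) := by
  set q := (∑ x, w x * min |Y x| 1) ^ 2 with hq
  have hm : ∀ x, 0 ≤ min |Y x| 1 := fun x => le_min (abs_nonneg _) zero_le_one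
  have hs0 : 0 ≤ ∑ x, w x * min |Y x| 1 := Finset.sum_nonneg fun x _ => mul_nonneg (hw x) (hm x)
  have hq1 : q ≤ 1 := by
    refine pow_le_one₀ hs0 (le_of_le_of_eq ?_ hw1)
    exact Finset.sum_le_sum fun x _ => mul_le_of_le_one_right (hw x) (min_le_right _ _)
  have h1 : 1 + 1 / 3 * q ≤ ∑ x, w x * Real.exp (Y x) := by
    have hj := sq_sum_le_sum_sq hw hw1.le (fun x => min |Y x| 1)
    have h2 : ∑ x, w x * (1 / 3 * min |Y x| 1 ^ 2) ≤ ∑ x, w x * (Real.exp (Y x) - 1 - Y x) :=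
      Finset.sum_le_sum fun x _ => mul_le_mul_of_nonneg_left (sq_min_le_exp_sub _) (hw x)
    simp only [mul_sub, mul_one, Finset.sum_sub_distrib, hw1, h0, mul_left_comm _ (1 / 3 : ℝ),
      ← Finset.mul_sum] at h2
    linarith
  have hq0 : 0 ≤ q := sq_nonneg _
  have h3 := Real.one_sub_inv_le_log_of_pos (x := 1 + 1 / 3 * q) (by positivity)
  refine le_trans ?_ (h3.trans (Real.log_le_log (by positivity) h1))
  have : (1 + 1 / 3 * q)⁻¹ ≤ 1 - 1 / 4 * q := by
    rw [inv_le_iff_one_le_mul₀ (by positivity)]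
    nlinarith
  linarith

lemma log_sum_exp_mul_le (hw : ∀ x, 0 ≤ w x) (hw1 : ∑ x, w x = 1) (Y : α → ℝ) {t : ℝ}
    (ht0 : 0 < t) (ht1 : t ≤ 1) :
    Real.log (∑ x, w x * Real.exp (t * Y x)) ≤ t * Real.log (∑ x, w x * Real.exp (Y x)) := by
  have hpos : ∀ Z : α → ℝ, 0 < ∑ x, w x * Real.exp (Z x) := by
    intro Z
    obtain ⟨x, _, hx⟩ : ∃ x ∈ Finset.univ, 0 < w x := by
      by_contra hcon
      push Not at hcon
      have := Finset.sum_nonpos hcon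
      linarith
    exact Finset.sum_pos' (fun x _ => mul_nonneg (hw x) (Real.exp_pos _).le)
      ⟨x, Finset.mem_univ _, mul_pos hx (Real.exp_pos _)⟩
  have h := Real.arith_mean_le_rpow_mean Finset.univ w (fun x => Real.exp (t * Y x))
    (fun x _ => hw x) hw1 (fun x _ => (Real.exp_pos _).le) (p := 1 / t)
    ((one_le_div ht0).2 ht1)
  have e : ∀ x, Real.exp (t * Y x) ^ (1 / t) = Real.exp (Y x) := fun x => by
    rw [← Real.exp_mul]; congr 1; field_simp
  simp only [e, one_div_one_div] at h
  refine (Real.log_le_log (hpos _) h).trans (le_of_eq ?_)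
  rw [Real.log_rpow (hpos _)]

/-- Up to `l = 1/M` the quadratic bound applies to `lY`. Beyond it, the cumulant function is convex
and vanishes at `0`, so it grows at least linearly from its value at `1/M`. -/
lemma le_log_sum_exp_mul (hw : ∀ x, 0 ≤ w x) (hw1 : ∑ x, w x = 1) {Y : α → ℝ} {M κ l : ℝ}
    (hM : 0 < M) (hκ : 0 ≤ κ) (hl : 0 < l) (h0 : ∑ x, w x * Y x = 0)
    (h : κ ≤ ∑ x, w x * min |Y x| M) :
    1 / 4 * κ ^ 2 * l * min l (1 / M) ≤ Real.log (∑ x, w x * Real.exp (l * Y x)) := by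
  have hsmall : ∀ s : ℝ, 0 < s → s ≤ 1 / M →
      1 / 4 * κ ^ 2 * s ^ 2 ≤ Real.log (∑ x, w x * Real.exp (s * Y x)) := by
    intro s hs hsM
    have hsM' : s * M ≤ 1 := by rwa [le_div_iff₀ hM] at hsM
    have hz : ∑ x, w x * (s * Y x) = 0 := by
      simp only [mul_left_comm _ s, ← Finset.mul_sum, h0, mul_zero]
    refine le_trans ?_ (quarter_sq_le_log_sum_exp hw hw1 hz)
    have h1 : κ * s ≤ ∑ x, w x * min |s * Y x| 1 := by
      calc κ * s ≤ (∑ x, w x * min |Y x| M) * s := mul_le_mul_of_nonneg_right h hs.le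
        _ = ∑ x, w x * (s * min |Y x| M) := by
            rw [Finset.sum_mul]; exact Finset.sum_congr rfl fun x _ => by ring
        _ ≤ _ := by
            refine Finset.sum_le_sum fun x _ => mul_le_mul_of_nonneg_left ?_ (hw x)
            rw [abs_mul, abs_of_pos hs, mul_min_of_nonneg _ _ hs.le]
            exact min_le_min_left _ hsM'
    have h2 := pow_le_pow_left₀ (by positivity) h1 2
    linarith
  rcases le_or_gt l (1 / M) with hlM | hlM
  · rw [min_eq_left hlM]
    have := hsmall l hl hlM
    linarith
  · rw [min_eq_right hlM.le]
    have h1 := hsmall (1 / M) (by positivity) le_rfl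
    have h2 := log_sum_exp_mul_le hw hw1 (fun x => l * Y x) (t := 1 / (M * l)) (by positivity) (by
      rw [div_le_one (by positivity)]
      rw [div_lt_iff₀ hM] at hlM
      linarith)
    have e : ∀ x, 1 / (M * l) * (l * Y x) = 1 / M * Y x := fun x => by field_simp
    simp only [e] at h2
    have h3 : 1 / 4 * κ ^ 2 * (1 / M) ^ 2 ≤
        Real.log (∑ x, w x * Real.exp (l * Y x)) / (M * l) :=
      (h1.trans h2).trans_eq (by ring)
    rw [le_div_iff₀ (by positivity)] at h3
    refine le_trans (le_of_eq ?_) h3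
    field_simp

end LogSumExp

/-! ### Deterministic error bound from the score and curvature conditions. -/

section Estimator

variable {p N n₁ n₂ : ℕ} {G : Fin N → Finset (Fin p × Fin p)}

/-- The Bregman divergence of the loss at `δ` in the direction `u`. -/
noncomputable def divergence (θ δ : Param p) (x : Fin n₂ → Config p) (u : Param p) : ℝ :=
  Real.log (∑ i, sampleWeight θ δ x i *
    Real.exp (⟪u, suffStat (x i)⟫ - ∑ j, sampleWeight θ δ x j * ⟪u, suffStat (x j)⟫))

lemma loss_add (hn₂ : 0 < n₂) (θ δ u : Param p) (x₁ : Fin n₁ → Config p)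
    (x₂ : Fin n₂ → Config p) :
    loss x₁ x₂ (δ + u) = loss x₁ x₂ δ - score θ δ x₁ x₂ u + divergence θ δ x₂ u := by
  have hn : (0 : ℝ) < n₂ := by exact_mod_cast hn₂
  set m := ∑ j, sampleWeight θ δ x₂ j * ⟪u, suffStat (x₂ j)⟫ with hm
  have hne : (Finset.univ : Finset (Fin n₂)).Nonempty := ⟨⟨0, hn₂⟩, Finset.mem_univ _⟩
  have hZ := isingExp_exp_pos θ (fun y => ⟪suffStat y, δ⟫)
  have hSpos : 0 < ∑ i, Real.exp ⟪suffStat (x₂ i), δ⟫ :=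
    Finset.sum_pos (fun _ _ => Real.exp_pos _) hne
  have hw : ∀ i, sampleWeight θ δ x₂ i =
      Real.exp ⟪suffStat (x₂ i), δ⟫ / ∑ j, Real.exp ⟪suffStat (x₂ j), δ⟫ := fun i => by
    unfold sampleWeight densityRatio
    rw [← Finset.sum_div, div_div_div_cancel_right₀ hZ.ne']
  have hWpos : 0 < ∑ i, sampleWeight θ δ x₂ i * Real.exp (⟪u, suffStat (x₂ i)⟫ - m) := by
    refine Finset.sum_pos (fun i _ => mul_pos ?_ (Real.exp_pos _)) hne
    rw [hw]; exact div_pos (Real.exp_pos _) hSpos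
  have hlog : Real.log ((1 / (n₂ : ℝ)) * ∑ i, Real.exp ⟪suffStat (x₂ i), δ + u⟫) =
      Real.log ((1 / (n₂ : ℝ)) * ∑ i, Real.exp ⟪suffStat (x₂ i), δ⟫) + m +
        divergence θ δ x₂ u := by
    have e : (1 / (n₂ : ℝ)) * ∑ i, Real.exp ⟪suffStat (x₂ i), δ + u⟫ =
        ((1 / (n₂ : ℝ)) * ∑ i, Real.exp ⟪suffStat (x₂ i), δ⟫) * Real.exp m *
          ∑ i, sampleWeight θ δ x₂ i * Real.exp (⟪u, suffStat (x₂ i)⟫ - m) := by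
      rw [mul_assoc, mul_assoc, Finset.mul_sum Finset.univ _ (Real.exp m), Finset.mul_sum
        Finset.univ _ (∑ i, Real.exp ⟪suffStat (x₂ i), δ⟫)]
      congr 1
      refine Finset.sum_congr rfl fun i _ => ?_
      rw [hw, inner_add_right, Real.exp_add, Real.exp_sub, real_inner_comm u]
      field_simp
    rw [e, Real.log_mul (by positivity) hWpos.ne', Real.log_mul (by positivity) (Real.exp_pos _).ne',
      Real.log_exp]
    rfl
  unfold loss
  rw [hlog, score, ← hm]
  simp only [inner_add_right, Finset.sum_add_distrib, real_inner_comm u]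
  ring

variable {θ δ : Param p} {β lam : ℝ} {x₁ : Fin n₁ → Config p} {x₂ : Fin n₂ → Config p}

lemma sum_sampleWeight_mul_sub (hn₂ : 0 < n₂) (θ δ u : Param p) (x₂ : Fin n₂ → Config p) :
    ∑ i, sampleWeight θ δ x₂ i *
      (⟪u, suffStat (x₂ i)⟫ - ∑ j, sampleWeight θ δ x₂ j * ⟪u, suffStat (x₂ j)⟫) = 0 := by
  simp only [mul_sub, Finset.sum_sub_distrib, ← Finset.sum_mul, sum_sampleWeight hn₂, one_mul,
    sub_self]

lemma divergence_nonneg (hn₂ : 0 < n₂) (u : Param p) : 0 ≤ divergence θ δ x₂ u :=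
  le_trans (by positivity) (quarter_sq_le_log_sum_exp (sampleWeight_nonneg θ δ x₂)
    (sum_sampleWeight hn₂ θ δ x₂) (sum_sampleWeight_mul_sub hn₂ θ δ u x₂))

lemma divergence_le_of_isEstimator (hn₂ : 0 < n₂) (hδ : δ ∈ admissible G)
    (hscore : ∀ u ∈ admissible G, score θ δ x₁ x₂ u ≤ lam / β * groupNorm G u)
    {δhat : Param p} (hest : IsEstimator G x₁ x₂ lam δhat) :
    divergence θ δ x₂ (δhat - δ) ≤ lam * (groupNorm G δ + 1 / β * groupNorm G (δhat - δ)
      - groupNorm G δhat) := by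
  have h1 := hest.2 hδ
  have h2 := loss_add (n₁ := n₁) hn₂ θ δ (δhat - δ) x₁ x₂
  rw [add_sub_cancel] at h2
  have h3 := hscore _ ((admissibleSubmodule G).sub_mem hest.1 hδ)
  simp only [Set.mem_ofPred_eq] at h1
  rw [h2] at h1
  have e : lam / β * groupNorm G (δhat - δ) = lam * (1 / β * groupNorm G (δhat - δ)) := by ring
  rw [e] at h3
  linarith

lemma sub_mem_errorSet_of_isEstimator (hn₂ : 0 < n₂) (hlam : 0 < lam) (hδ : δ ∈ admissible G)
    (hscore : ∀ u ∈ admissible G, score θ δ x₁ x₂ u ≤ lam / β * groupNorm G u)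
    {δhat : Param p} (hest : IsEstimator G x₁ x₂ lam δhat) :
    δhat - δ ∈ errorSet G δ β := by
  refine ⟨(admissibleSubmodule G).sub_mem hest.1 hδ, ?_⟩
  have h1 := divergence_le_of_isEstimator hn₂ hδ hscore hest
  have h2 : 0 ≤ lam * (groupNorm G δ + 1 / β * groupNorm G (δhat - δ) - groupNorm G δhat) :=
    (divergence_nonneg hn₂ _).trans h1
  rw [add_sub_cancel]
  have := nonneg_of_mul_nonneg_right h2 hlam
  linarith

/-- Two upper bounds on the divergence are played against its growth: `2λΨ‖Δ‖` in the quadratic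
regime and `2λΨB` in the linear one. They yield the two summands of `1 + BM`. -/
lemma norm_sub_le_of_isEstimator {S : Finset (Fin N)} {η₀ κ M B : ℝ} (hG : IsGroupSystem G)
    (hn₂ : 0 < n₂) (hβ : 1 < β) (hη₀ : 0 < η₀) (hκ : 0 < κ) (hM : 0 < M) (hlam : 0 < lam)
    (hδ : δ ∈ admissible G) (hδS : ∀ g, g ∉ S → ∀ e ∈ G g, δ e = 0) (hδB : ‖δ‖ ≤ B)
    (hscore : ∀ u ∈ admissible G, score θ δ x₁ x₂ u ≤ lam / β * groupNorm G u)
    (hratio : ∑ i, densityRatio θ δ (x₂ i) ≤ 2 * n₂)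
    (hcurv : ∀ u ∈ errorCone G δ β, ‖u‖ = 1 → ∀ a : ℝ,
      κ ≤ (1 / (n₂ : ℝ)) * ∑ i, ratioInd η₀ θ δ (x₂ i) * min |⟪u, suffStat (x₂ i)⟫ - a| M)
    {δhat : Param p} (hest : IsEstimator G x₁ x₂ lam δhat) :
    ‖δhat - δ‖ ≤ 32 * (1 + B * M) / (η₀ * κ) ^ 2 *
      compatConst G (errorCone G δ β) * lam := by
  set u := δhat - δ with hu
  set Ψ := compatConst G (errorCone G δ β) with hΨ_def
  have hΨ : 0 ≤ Ψ := compatConst_nonneg _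
  have hB : 0 ≤ B := (norm_nonneg δ).trans hδB
  rcases eq_or_ne u 0 with hu0 | hu0
  · rw [hu0, norm_zero]; positivity
  have hl : 0 < ‖u‖ := norm_pos_iff.2 hu0
  have huE := sub_mem_errorSet_of_isEstimator hn₂ hlam hδ hscore hest
  rw [← hu] at huE
  have huC := errorSet_subset_errorCone huE
  have hD := divergence_le_of_isEstimator hn₂ hδ hscore hest
  rw [← hu] at hD
  have hRu := groupNorm_le_compatConst_mul hG hβ hδS huC
  have hRδ : groupNorm G δ ≤ Ψ * B := by
    have h1 := groupNorm_le_compatConst_mul hG hβ hδS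
      (errorSet_subset_errorCone (neg_mem_errorSet hβ hδ))
    rw [groupNorm_neg, norm_neg] at h1
    exact h1.trans (mul_le_mul_of_nonneg_left hδB hΨ)
  have hβ0 : 0 < β := by linarith
  have hβ1 : 1 / β ≤ 1 := by rw [div_le_one hβ0]; exact hβ.le
  have hRhat : 0 ≤ groupNorm G δhat := groupNorm_nonneg _
  have hRu0 : 0 ≤ groupNorm G u := groupNorm_nonneg _
  have htri : groupNorm G δ ≤ groupNorm G δhat + groupNorm G u := by
    have := groupNorm_add_le (G := G) δhat (-u)
    rwa [groupNorm_neg, show δhat + -u = δ by rw [hu]; abel] at this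
  have htri' : groupNorm G u ≤ groupNorm G δhat + groupNorm G δ := by
    have := groupNorm_add_le (G := G) δhat (-δ)
    rwa [groupNorm_neg, ← sub_eq_add_neg] at this
  have hD1 : divergence θ δ x₂ u ≤ lam * (2 * (Ψ * ‖u‖)) := by
    refine hD.trans (mul_le_mul_of_nonneg_left ?_ hlam.le)
    nlinarith [mul_le_mul_of_nonneg_right hβ1 hRu0]
  -- Bounding `R(Δ)/β ≤ R(δhat) + R(δ*)` cancels `R(δhat)` and leaves `2λR(δ*)`, which does not
  -- depend on `‖Δ‖`.
  have hD2 : divergence θ δ x₂ u ≤ lam * (2 * (Ψ * B)) := by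
    refine hD.trans (mul_le_mul_of_nonneg_left ?_ hlam.le)
    have h1 : 1 / β * groupNorm G u ≤ 1 / β * (groupNorm G δhat + groupNorm G δ) :=
      mul_le_mul_of_nonneg_left htri' (by positivity)
    have h2 := mul_le_mul_of_nonneg_right hβ1 (add_nonneg hRhat (groupNorm_nonneg (G := G) δ))
    linarith
  have hn : (0 : ℝ) < n₂ := by exact_mod_cast hn₂
  set v := ‖u‖⁻¹ • u with hv
  have hv1 : ‖v‖ = 1 := by
    rw [hv, norm_smul, norm_inv, norm_norm, inv_mul_cancel₀ hl.ne']
  have huv : u = ‖u‖ • v := by rw [hv, smul_inv_smul₀ hl.ne']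
  set a := ∑ j, sampleWeight θ δ x₂ j * ⟪v, suffStat (x₂ j)⟫ with ha
  have hc := hcurv v (smul_mem_errorCone huC (by positivity)) hv1 a
  have hSpos := sum_densityRatio_pos hn₂ θ δ x₂
  -- On the indicator event `r > η₀`, and the ratios sum to at most `2n₂`, so each weight is at
  -- least `η₀/(2n₂)` times the indicator.
  have hκw : η₀ * κ / 2 ≤ ∑ i, sampleWeight θ δ x₂ i * min |⟪v, suffStat (x₂ i)⟫ - a| M := by
    rw [one_div, le_inv_mul_iff₀ hn] at hc
    have h1 : η₀ * ∑ i, ratioInd η₀ θ δ (x₂ i) * min |⟪v, suffStat (x₂ i)⟫ - a| M ≤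
        ∑ i, densityRatio θ δ (x₂ i) * min |⟪v, suffStat (x₂ i)⟫ - a| M := by
      rw [Finset.mul_sum]
      refine Finset.sum_le_sum fun i _ => ?_
      rw [← mul_assoc]
      refine mul_le_mul_of_nonneg_right ?_ (le_min (abs_nonneg _) hM.le)
      unfold ratioInd
      split_ifs with h
      · rw [mul_one]; exact h.le
      · rw [mul_zero]; exact (densityRatio_pos _ _ _).le
    have h2 : ∑ i, sampleWeight θ δ x₂ i * min |⟪v, suffStat (x₂ i)⟫ - a| M =
        (∑ i, densityRatio θ δ (x₂ i) * min |⟪v, suffStat (x₂ i)⟫ - a| M) /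
          ∑ j, densityRatio θ δ (x₂ j) := by
      rw [Finset.sum_div]
      exact Finset.sum_congr rfl fun i _ => by unfold sampleWeight; ring
    rw [h2, le_div_iff₀ hSpos]
    have h3 := mul_le_mul_of_nonneg_left hc hη₀.le
    have h4 := mul_le_mul_of_nonneg_left hratio (by positivity : 0 ≤ η₀ * κ / 2)
    linarith
  have hlow := le_log_sum_exp_mul (sampleWeight_nonneg θ δ x₂) (sum_sampleWeight hn₂ θ δ x₂)
    hM (by positivity) hl (sum_sampleWeight_mul_sub hn₂ θ δ v x₂) hκw
  have hdiv : divergence θ δ x₂ u = Real.log (∑ i, sampleWeight θ δ x₂ i *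
      Real.exp (‖u‖ * (⟪v, suffStat (x₂ i)⟫ - a))) := by
    unfold divergence
    have e : ∀ i, ⟪u, suffStat (x₂ i)⟫ = ‖u‖ * ⟪v, suffStat (x₂ i)⟫ := fun i => by
      conv_lhs => rw [huv]
      rw [real_inner_smul_left]
    simp only [e, ha, mul_sub, Finset.mul_sum, mul_left_comm (sampleWeight _ _ _ _) ‖u‖]
  rw [← hdiv] at hlow
  have hg : 0 < (η₀ * κ) ^ 2 := by positivity
  have hgoal : ‖u‖ * (η₀ * κ) ^ 2 ≤ 32 * (1 + B * M) * Ψ * lam := by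
    have e : 1 / 4 * (η₀ * κ / 2) ^ 2 = (η₀ * κ) ^ 2 / 16 := by ring
    rw [e] at hlow
    have hBM : 0 ≤ B * M * (Ψ * lam) := by positivity
    have hΨl : 0 ≤ Ψ * lam := by positivity
    rcases le_or_gt ‖u‖ (1 / M) with h | h
    · rw [min_eq_left h] at hlow
      have h1 := hlow.trans hD1
      have h2 : ((η₀ * κ) ^ 2 / 16 * ‖u‖) * ‖u‖ ≤ (lam * (2 * Ψ)) * ‖u‖ := by linarith
      have h3 := le_of_mul_le_mul_right h2 hl
      linarith
    · rw [min_eq_right h.le, mul_one_div] at hlow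
      have h1 := hlow.trans hD2
      rw [div_le_iff₀ hM] at h1
      linarith
  calc ‖u‖ ≤ 32 * (1 + B * M) * Ψ * lam / (η₀ * κ) ^ 2 := by rwa [le_div_iff₀ hg]
    _ = _ := by ring

/-- Nondegeneracy is applied to `-δ` with `a = -log Z`, where the squared statistic is `(log r)²`.
On `r > η₀` this is at most `(log η₀)² + r²`, and `E r² ≤ 12`. -/
lemma norm_le_of_nondegenerate {ρ η₀ : ℝ} (hβ : 1 < β) (hρ : 0 < ρ) (hη₀ : 0 < η₀)
    (hδ : δ ∈ admissible G) (hsm : SmoothDensityRatio G θ δ)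
    (hnd : NondegenerateStat G θ δ β η₀ ρ) :
    ‖δ‖ ≤ Real.sqrt ((Real.log η₀ ^ 2 + 12) / ρ) := by
  refine Real.le_sqrt_of_sq_le ?_
  rw [le_div_iff₀ hρ, mul_comm]
  set Z := isingExp θ (fun y => Real.exp ⟪suffStat y, δ⟫) with hZ
  have hZpos : 0 < Z := isingExp_exp_pos θ _
  have h1 := hnd.le_isingExp (errorSet_subset_errorCone (neg_mem_errorSet hβ hδ)) (-Real.log Z)
  rw [norm_neg] at h1
  refine h1.trans ?_
  have h2 : ∀ x, ratioInd η₀ θ δ x * (⟪-δ, suffStat x⟫ - -Real.log Z) ^ 2 ≤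
      Real.log η₀ ^ 2 + densityRatio θ δ x ^ 2 := by
    intro x
    have hr := densityRatio_pos θ δ x
    have hlog : Real.log (densityRatio θ δ x) = ⟪δ, suffStat x⟫ - Real.log Z := by
      unfold densityRatio
      rw [Real.log_div (Real.exp_pos _).ne' hZpos.ne', Real.log_exp, real_inner_comm]
    have e : (⟪-δ, suffStat x⟫ - -Real.log Z) ^ 2 = Real.log (densityRatio θ δ x) ^ 2 := by
      rw [hlog, inner_neg_left]; ring
    rw [e]
    unfold ratioInd
    split_ifs with h
    · rw [one_mul]
      rcases le_or_gt 1 (densityRatio θ δ x) with h1 | h1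
      · have h3 : Real.log (densityRatio θ δ x) ^ 2 ≤ densityRatio θ δ x ^ 2 :=
          pow_le_pow_left₀ (Real.log_nonneg h1)
            ((Real.log_le_sub_one_of_pos hr).trans (by linarith)) 2
        linarith [sq_nonneg (Real.log η₀)]
      · have h3 := Real.log_lt_log hη₀ h
        have h4 := Real.log_neg hr h1
        nlinarith [sq_nonneg (densityRatio θ δ x)]
    · rw [zero_mul]; positivity
  refine (isingExp_mono θ h2).trans ?_
  rw [isingExp_add, isingExp_const]
  linarith [isingExp_densityRatio_sq_le hsm]

end Estimator

end DirectChange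

/-! ### Assembly of the main theorem. -/

theorem mainTheorem5 (β K ρ η₀ : ℝ) (hβ : 1 < β) (hK : 0 < K) (hρ : 0 < ρ) (hη₀ : 0 < η₀) :
    ∃ c η c₃ C C₀ c₀ : ℝ, 0 < c ∧ 0 < η ∧ 0 < c₃ ∧ 0 < C ∧ 0 < C₀ ∧ 0 < c₀ ∧
      ∀ (p N : ℕ) (G : Fin N → Finset (Fin p × Fin p)), IsGroupSystem G →
      ∀ (S : Finset (Fin N)) (θ₁ θ₂ : Param p),
        θ₁ - θ₂ ∈ admissible G →
        (∀ g, g ∉ S → ∀ e ∈ G g, (θ₁ - θ₂) e = 0) →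
        SmoothDensityRatio G θ₂ (θ₁ - θ₂) →
        SubGaussianStat G θ₂ K →
        NondegenerateStat G θ₂ (θ₁ - θ₂) β η₀ ρ →
        (2 ≤ β →
          compatConst G (errorCone G (θ₁ - θ₂) β) ≤ 4 * Real.sqrt (S.card : ℝ)) ∧
        ∀ (n₁ n₂ : ℕ), 0 < n₁ → 0 < n₂ →
          c * ((maxGroupSize G : ℝ) * (S.card : ℝ) + (S.card : ℝ) * Real.log N) ≤ (n₂ : ℝ) →
        ∀ (Ω : Type*) [MeasurableSpace Ω] (P : Measure Ω) [IsProbabilityMeasure P]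
          (X₁ : Fin n₁ → Ω → Config p) (X₂ : Fin n₂ → Ω → Config p),
          (∀ i, HasLaw (X₁ i) (isingMeasure θ₁) P) → iIndepFun X₁ P →
          (∀ i, HasLaw (X₂ i) (isingMeasure θ₂) P) → iIndepFun X₂ P →
        ∀ ε : ℝ, 0 ≤ ε →
          1 - C₀ * (Real.exp (-ε ^ 2) + Real.exp (-c₀ * (n₂ : ℝ))) ≤
            P.real {ω |
              (∀ lam : ℝ, η * refLevel G n₁ n₂ ε ≤ lam → ∀ δhat : Param p,
                IsEstimator G (fun i => X₁ i ω) (fun i => X₂ i ω) lam δhat →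
                ‖δhat - (θ₁ - θ₂)‖ ≤ c₃ * compatConst G (errorCone G (θ₁ - θ₂) β) * lam) ∧
              (∀ δhat : Param p,
                IsEstimator G (fun i => X₁ i ω) (fun i => X₂ i ω)
                  (η * refLevel G n₁ n₂ ε) δhat →
                ‖δhat - (θ₁ - θ₂)‖ ≤ C * (1 + ε) *
                  Real.sqrt (((S.card : ℝ) * (maxGroupSize G : ℝ) + (S.card : ℝ) * Real.log N)
                    / (min n₁ n₂ : ℕ)))} := by
  classical
  obtain ⟨c₁, κ, M, d₁, hc₁, hκ, hM, hd₁, hcurv⟩ := exists_restricted_lower_bound β K ρ η₀ hβ hK hρ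
  obtain ⟨c₂, η, d₂, hc₂, hη, hd₂, hscore⟩ := exists_score_bound β K (by linarith) hK
  set B := Real.sqrt ((Real.log η₀ ^ 2 + 12) / ρ) with hB
  set c₃ := 32 * (1 + B * M) / (η₀ * κ) ^ 2 with hc₃_def
  have hc₃ : 0 < c₃ := by positivity
  have hβ1 : 0 < β - 1 := by linarith
  set Cβ := 2 * β / (β - 1) with hCβ_def
  have hCβ : 0 < Cβ := by positivity
  refine ⟨c₁ + c₂, η, c₃, c₃ * Cβ * η, 5, min d₁ d₂, by positivity, hη, hc₃, by positivity,
    by norm_num, lt_min hd₁ hd₂, ?_⟩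
  intro p N G hG S θ₁ θ₂ hδ hδS hsm hsub hnd
  refine ⟨fun hβ2 => compatConst_errorCone_le_four hG hβ2 hδS, ?_⟩
  intro n₁ n₂ hn₁ hn₂ hcn Ω _ P _ X₁ X₂ hX₁ hi₁ hX₂ hi₂ ε hε
  set δ := θ₁ - θ₂ with hδ_def
  set Ψ := compatConst G (errorCone G δ β) with hΨ_def
  have hΨ : 0 ≤ Ψ := compatConst_nonneg _
  have hΨS : Ψ ≤ Cβ * Real.sqrt S.card := compatConst_errorCone_le hG hβ hδS
  set lam₀ := η * refLevel G n₁ n₂ ε with hlam₀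
  have hlog := Real.log_natCast_nonneg N
  have hlam₀_nonneg : 0 ≤ lam₀ := by rw [hlam₀, refLevel]; positivity
  have hsecond : c₃ * Ψ * lam₀ ≤ c₃ * Cβ * η * (1 + ε) *
      Real.sqrt (((S.card : ℝ) * (maxGroupSize G : ℝ) + (S.card : ℝ) * Real.log N)
        / (min n₁ n₂ : ℕ)) := by
    rw [← mul_add, mul_div_assoc, Real.sqrt_mul (by positivity)]
    calc c₃ * Ψ * lam₀ ≤ c₃ * (Cβ * Real.sqrt S.card) * lam₀ := by gcongr
      _ = _ := by rw [hlam₀, refLevel]; ring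
  -- Only subadditivity and monotonicity of `P` on arbitrary sets are used, so the success event
  -- need not be shown measurable.
  have hreduce : ∀ bad : Set Ω,
      P.real bad ≤ 5 * (Real.exp (-ε ^ 2) + Real.exp (-(min d₁ d₂) * (n₂ : ℝ))) →
      (∀ ω, ω ∉ bad → ∀ lam, lam₀ ≤ lam → ∀ δhat,
        IsEstimator G (fun i => X₁ i ω) (fun i => X₂ i ω) lam δhat →
          ‖δhat - δ‖ ≤ c₃ * Ψ * lam) →
      1 - 5 * (Real.exp (-ε ^ 2) + Real.exp (-(min d₁ d₂) * (n₂ : ℝ))) ≤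
        P.real {ω | (∀ lam : ℝ, lam₀ ≤ lam → ∀ δhat : Param p,
            IsEstimator G (fun i => X₁ i ω) (fun i => X₂ i ω) lam δhat →
            ‖δhat - δ‖ ≤ c₃ * Ψ * lam) ∧
          (∀ δhat : Param p,
            IsEstimator G (fun i => X₁ i ω) (fun i => X₂ i ω) lam₀ δhat →
            ‖δhat - δ‖ ≤ c₃ * Cβ * η * (1 + ε) *
              Real.sqrt (((S.card : ℝ) * (maxGroupSize G : ℝ) + (S.card : ℝ) * Real.log N)
                / (min n₁ n₂ : ℕ)))} := by
    intro bad hbad hgood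
    have hcover : ∀ s : Set Ω, (∀ ω, ω ∉ bad → ω ∈ s) → 1 ≤ P.real s + P.real bad := by
      intro s hs
      have h := (measureReal_mono (μ := P) (fun ω (_ : ω ∈ Set.univ) =>
        (or_iff_not_imp_right.2 (hs ω) : ω ∈ s ∪ bad))).trans (measureReal_union_le _ _)
      rwa [probReal_univ] at h
    refine (sub_le_sub_left hbad 1).trans (sub_le_iff_le_add.2 (hcover _ fun ω hω => ?_))
    exact ⟨hgood ω hω, fun δhat hest => (hgood ω hω lam₀ le_rfl δhat hest).trans hsecond⟩
  -- Without a nonempty group the only admissible parameter is `0`. Excluding this case makes the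
  -- reference level positive, as the error-set argument requires.
  by_cases htriv : N = 0 ∨ maxGroupSize G = 0
  · refine hreduce ∅ (by rw [measureReal_empty]; positivity) fun ω _ lam hlam δhat hest => ?_
    rw [eq_zero_of_groups_trivial ((admissibleSubmodule G).sub_mem hest.1 hδ) htriv, norm_zero]
    have := hlam₀_nonneg.trans hlam
    positivity
  push Not at htriv
  have hN : 0 < N := Nat.pos_of_ne_zero htriv.1
  have hm : 0 < maxGroupSize G := Nat.pos_of_ne_zero htriv.2
  have hlam₀_pos : 0 < lam₀ := by
    have h1 : (0 : ℝ) < maxGroupSize G := by exact_mod_cast hm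
    have h2 : (0 : ℝ) < (min n₁ n₂ : ℕ) := by exact_mod_cast lt_min hn₁ hn₂
    rw [hlam₀, refLevel]; positivity
  have hT : 0 ≤ (S.card : ℝ) * ((maxGroupSize G : ℝ) + Real.log N) := by positivity
  have hcn' : (c₁ + c₂) * ((S.card : ℝ) * ((maxGroupSize G : ℝ) + Real.log N)) ≤ n₂ := by
    rw [mul_add (S.card : ℝ), mul_comm (S.card : ℝ) (maxGroupSize G : ℝ)]; exact hcn
  have hn₂0 : (0 : ℝ) ≤ n₂ := Nat.cast_nonneg _
  have he₁ : Real.exp (-(d₁ * n₂)) ≤ Real.exp (-(min d₁ d₂) * (n₂ : ℝ)) := by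
    refine Real.exp_le_exp.2 ?_
    have := mul_le_mul_of_nonneg_right (min_le_left d₁ d₂) hn₂0
    linarith
  have he₂ : Real.exp (-(d₂ * n₂)) ≤ Real.exp (-(min d₁ d₂) * (n₂ : ℝ)) := by
    refine Real.exp_le_exp.2 ?_
    have := mul_le_mul_of_nonneg_right (min_le_right d₁ d₂) hn₂0
    linarith
  have hpε := Real.exp_pos (-ε ^ 2)
  have hpn := Real.exp_pos (-(min d₁ d₂) * (n₂ : ℝ))
  obtain ⟨bad₂, hbad₂, hgood₂⟩ := hscore hG hN hm hδ hδS hsm hsub hn₁ hn₂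
    (by nlinarith) hX₁ hi₁ hX₂ hi₂ ε hε
  have hscore' : ∀ ω, ω ∉ bad₂ → ∀ lam, lam₀ ≤ lam → ∀ u ∈ admissible G,
      score θ₂ δ (fun i => X₁ i ω) (fun i => X₂ i ω) u ≤ lam / β * groupNorm G u := by
    intro ω hω lam hlam u hu
    refine ((hgood₂ ω hω).2 u hu).trans (mul_le_mul_of_nonneg_right ?_ (groupNorm_nonneg u))
    exact div_le_div_of_nonneg_right hlam (by linarith)
  -- For `δ* = 0` the curvature bound is unavailable but unnecessary: `E_r` reduces to `R(Δ) ≤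
  -- R(Δ)/β`, so `Δ = 0`.
  rcases eq_or_ne δ 0 with hδ0 | hδ0
  · refine hreduce bad₂ (by linarith) fun ω hω lam hlam δhat hest => ?_
    have hlam_pos : 0 < lam := hlam₀_pos.trans_le hlam
    have hE := sub_mem_errorSet_of_isEstimator hn₂ hlam_pos hδ (hscore' ω hω lam hlam) hest
    have h := groupNorm_le_of_mem_errorSet (S := ∅) hG hβ
      (fun g _ e _ => by rw [hδ0]; rfl) hE
    rw [Finset.card_empty, Nat.cast_zero, Real.sqrt_zero, mul_zero, zero_mul] at h
    refine ((norm_le_groupNorm hG hE.1).trans h).trans (by positivity)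
  · obtain ⟨bad₁, hbad₁, hgood₁⟩ := hcurv hG hδ hδ0 hδS hsub hnd hn₂ (by nlinarith) hX₂ hi₂
    refine hreduce (bad₁ ∪ bad₂) ?_ fun ω hω lam hlam δhat hest => ?_
    · refine (measureReal_union_le _ _).trans ?_
      linarith
    · rw [Set.mem_union, not_or] at hω
      exact norm_sub_le_of_isEstimator hG hn₂ hβ hη₀ hκ hM (hlam₀_pos.trans_le hlam) hδ hδS
        (norm_le_of_nondegenerate hβ hρ hη₀ hδ hsm hnd) (hscore' ω hω.2 lam hlam)
        (hgood₂ ω hω.2).1 (hgood₁ ω hω.1) hest
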